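/- **Model.** An algorithm is a deterministic random access machine program over integers (assignment, $+,-,\times$, integer division, indirect access to arrays, branching, while-loops) with logarithmic cost: each operation is charged the bit lengths of the numbers and addresses it touches. SETH is the statement that for every $\varepsilon>0$ there is a $k$ such that no algorithm decides satisfiability of $k$-CNF formulas with $N$ variables and $M$ clauses in time $O(2^{(1-\varepsilon)N}\cdot\mathrm{poly}(M))$. **Setting.** Let $\sigma(z)=1/(1+e^{-z})$ and let $\ell$ be the hinge loss $\ell(z)=\max(0,1-z)$ or the logistic loss $\ell(z)=\frac1{\ln 2}\ln(1+e^{-z})$. For examples $x_1,\dots,x_m\in\mathbb R^d$ with labels $y_i\in\{\pm1\}$ and a network $F_\alpha(x)=\sum_{j=1}^n\alpha_j\,\sigma(x^{\mathsf T}w_j)$ with $n$ sigmoid units, the empirical risk is $R(\alpha)=\sum_{i=1}^m\ell(y_iF_\alpha(x_i))$; gradients are taken with respect to $\alpha\in\mathbb R^n$. To compute the gradient means to output, for every $j$, a fraction that is within $1/10$ of the $j$-th entry of $\nabla R(\alpha)$. **Theorem.** 1. Assume SETH. Let $D:\mathbb N\to\mathbb N$ satisfy $D(n)/\log n\to\infty$,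 let $\kappa>0$ be rational and let $\varepsilon>0$. Then no algorithm computes $\nabla R(\alpha)$ in time $O((nm)^{1-\varepsilon})$ on all instances with $n\ge 1$ units, $m=n^{\kappa}$ examples, dimension $d\le D(n)$, and integer data (examples, labels, unit weights $w_j$, top layer $\alpha$). That is, computing the gradient requires time $(nm)^{1-o(1)}$. This holds even if the algorithm only has to be correct and fast on the instances with $x_i\in\{0,1\}^d$, $y_i=+1$, $\alpha=0$, and $w_j\in\mathbb Z^d$ with entries of absolute value at most $D(n)$. 2. We have $\ell'(0)\ne0$. Let $n\ge1$, $m\le n^8$, $a_1,\dots,a_m,b_1,\dots,b_n\in\{0,1\}^d$, and consider the examples $x_i=a_i$ with labels $+1$ and the unit weights $w_j=-10(\log n)\,b_j$ (natural logarithm), so that unit $j$ computes $S(a,b_j)=\sigma(-10(\log n)\,a^{\mathsf T}b_j)$. Then $R$ is differentiable at $\alpha=0$, and the sum of the entries of $\nabla R(0)$ has absolute value at least $|\ell'(0)|/2$ if $a_i^{\mathsf T}b_j=0$ for some $i,j$, and at most $|\ell'(0)|/n$ otherwise. -/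

import Mathlib

/-! ## Machine model: random access machine with logarithmic cost

Programs are structured (while-) programs.  The memory of the machine consists of integer
variables and of one-sided infinite integer arrays, indexed indirectly; the names of variables
and arrays occurring in a program are fixed in its text.  Every elementary operation is charged
the bit lengths of the numbers it touches, addresses included. -/

namespace RAM

/-- The arithmetic operations of the machine (`div` is the integer quotient). -/
inductive Op where
  | add
  | sub
  | mul
  | div

/-- The value of an arithmetic operation. -/
def Op.eval : Op → ℤ → ℤ → ℤ
  | .add, a, b => a + b
  | .sub, a, b => a - b
  | .mul, a, b => a * b
  | .div, a, b => a / b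

/-- Programs.
* `const x c`: `x := c`;
* `arith o x y z`: `x := y o z`;
* `load x a y`: `x := a[y]`;
* `store a x y`: `a[x] := y`;
* `seq c₁ c₂`: first `c₁`, then `c₂`;
* `ite x c₁ c₂`: if `x > 0` then `c₁` else `c₂`;
* `loop x c`: while `x > 0` do `c`. -/
inductive Program where
  | const (x : ℕ) (c : ℤ)
  | arith (o : Op) (x y z : ℕ)
  | load (x a y : ℕ)
  | store (a x y : ℕ)
  | seq (c₁ c₂ : Program)
  | ite (x : ℕ) (c₁ c₂ : Program)
  | loop (x : ℕ) (c : Program)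

/-- The memory: `var x` is the content of variable `x`, and `arr a i` the content of cell `i` of
array `a`. -/
@[ext]
structure Memory where
  var : ℕ → ℤ
  arr : ℕ → ℕ → ℤ

/-- Assignment to a variable. -/
def Memory.setVar (s : Memory) (x : ℕ) (v : ℤ) : Memory :=
  { s with var := Function.update s.var x v }

/-- Assignment to an array cell. -/
def Memory.setArr (s : Memory) (a i : ℕ) (v : ℤ) : Memory :=
  { s with arr := Function.update s.arr a (Function.update (s.arr a) i v) }

/-- Bit length of an integer (sign included). -/
def len (z : ℤ) : ℕ := Nat.size z.natAbs + 1

/-- `Exec c s s' t`: the program `c`, started in memory `s`, halts in memory `s'` and the total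
cost of the run is `t`.  A negative array index is read as `0`. -/
inductive Exec : Program → Memory → Memory → ℕ → Prop where
  | const (x : ℕ) (c : ℤ) (s : Memory) :
      Exec (.const x c) s (s.setVar x c) (1 + len c)
  | arith (o : Op) (x y z : ℕ) (s : Memory) :
      Exec (.arith o x y z) s (s.setVar x (o.eval (s.var y) (s.var z)))
        (1 + len (s.var y) + len (s.var z))
  | load (x a y : ℕ) (s : Memory) :
      Exec (.load x a y) s (s.setVar x (s.arr a (s.var y).toNat))
        (1 + len (s.var y) + len (s.arr a (s.var y).toNat))
  | store (a x y : ℕ) (s : Memory) :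
      Exec (.store a x y) s (s.setArr a (s.var x).toNat (s.var y))
        (1 + len (s.var x) + len (s.var y))
  | seq {c₁ c₂ : Program} {s s' s'' : Memory} {t₁ t₂ : ℕ}
      (h₁ : Exec c₁ s s' t₁) (h₂ : Exec c₂ s' s'' t₂) :
      Exec (.seq c₁ c₂) s s'' (t₁ + t₂)
  | ite_pos {x : ℕ} {c₁ c₂ : Program} {s s' : Memory} {t : ℕ}
      (hx : 0 < s.var x) (h : Exec c₁ s s' t) :
      Exec (.ite x c₁ c₂) s s' (1 + len (s.var x) + t)
  | ite_neg {x : ℕ} {c₁ c₂ : Program} {s s' : Memory} {t : ℕ}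
      (hx : ¬ 0 < s.var x) (h : Exec c₂ s s' t) :
      Exec (.ite x c₁ c₂) s s' (1 + len (s.var x) + t)
  | loop_pos {x : ℕ} {c : Program} {s s' s'' : Memory} {t₁ t₂ : ℕ}
      (hx : 0 < s.var x) (h₁ : Exec c s s' t₁) (h₂ : Exec (.loop x c) s' s'' t₂) :
      Exec (.loop x c) s s'' (1 + len (s.var x) + t₁ + t₂)
  | loop_neg {x : ℕ} {c : Program} {s : Memory} (hx : ¬ 0 < s.var x) :
      Exec (.loop x c) s s (1 + len (s.var x))

/-- A vector as the content of an array (`0` beyond its length). -/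
def ofVec {n : ℕ} (v : Fin n → ℤ) (t : ℕ) : ℤ :=
  if h : t < n then v ⟨t, h⟩ else 0

/-- A matrix, row by row, as the content of an array: entry `(i, k)` of an `m × d` matrix is in
cell `i * d + k`. -/
def ofMat {m d : ℕ} (v : Fin m → Fin d → ℤ) (t : ℕ) : ℤ :=
  if h : t / d < m ∧ t % d < d then v ⟨t / d, h.1⟩ ⟨t % d, h.2⟩ else 0

end RAM

/-! ## The Strong Exponential Time Hypothesis -/

/-- A `k`-CNF formula with `numVars` variables and `numClauses` clauses.  A literal is a variable
with a sign (`true` for the positive literal); literals of a clause may coincide, so that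
non-empty clauses with fewer than `k` literals are included. -/
structure KCNF (k : ℕ) where
  numVars : ℕ
  numClauses : ℕ
  lit : Fin numClauses → Fin k → Fin numVars × Bool

namespace KCNF

/-- Satisfiability. -/
def Satisfiable {k : ℕ} (φ : KCNF k) : Prop :=
  ∃ x : Fin φ.numVars → Bool, ∀ c, ∃ l, x (φ.lit c l).1 = (φ.lit c l).2

/-- The formula as an input: variables `0`, `1` hold the numbers of variables and of clauses, and
array `0` holds the literals, clause by clause; the literals of the `i`-th variable (`i ≥ 0`) are
written `i + 1` and `-(i + 1)`. -/
def input {k : ℕ} (φ : KCNF k) : RAM.Memory where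
  var := fun x => if x = 0 then (φ.numVars : ℤ) else if x = 1 then (φ.numClauses : ℤ) else 0
  arr := fun a t => if a = 0 then
      RAM.ofMat (fun c l => if (φ.lit c l).2 then (((φ.lit c l).1 : ℕ) : ℤ) + 1
        else -((((φ.lit c l).1 : ℕ) : ℤ) + 1)) t
    else 0

/-- `P` decides the satisfiability of `φ` at cost at most `T`: it leaves `1` in variable `0` if
`φ` is satisfiable, and `0` otherwise. -/
def DecidedBy {k : ℕ} (φ : KCNF k) (P : RAM.Program) (T : ℝ) : Prop :=
  ∃ (s : RAM.Memory) (t : ℕ), RAM.Exec P φ.input s t ∧ (t : ℝ) ≤ T ∧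
    (φ.Satisfiable → s.var 0 = 1) ∧ (¬ φ.Satisfiable → s.var 0 = 0)

end KCNF

/-- The Strong Exponential Time Hypothesis: for every `ε > 0` there is a `k` such that no algorithm
decides the satisfiability of `k`-CNF formulas with `N` variables and `M` clauses in time
`O(2 ^ ((1 - ε) N) · poly(M))`. -/
def SETH : Prop :=
  ∀ ε : ℝ, 0 < ε → ∃ k : ℕ, ¬ ∃ (P : RAM.Program) (C : ℝ) (e : ℕ), ∀ φ : KCNF k,
    φ.DecidedBy P (C * (2 : ℝ) ^ ((1 - ε) * (φ.numVars : ℝ)) * ((φ.numClauses : ℝ) + 1) ^ e)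

/-! ## Neural networks with sigmoid units -/

/-- The hinge loss as a function of the product of label and prediction. -/
noncomputable def hingeLoss (z : ℝ) : ℝ := max 0 (1 - z)

/-- The logistic loss as a function of the product of label and prediction. -/
noncomputable def logisticLoss (z : ℝ) : ℝ := 1 / Real.log 2 * Real.log (1 + Real.exp (-z))

/-- The network with `d` inputs, `n` sigmoid units with weight vectors `w j`, and one linear output
with weights `α`. -/
noncomputable def network {n d : ℕ} (w : Fin n → Fin d → ℝ) (α : EuclideanSpace ℝ (Fin n))
    (x : Fin d → ℝ) : ℝ :=
  ∑ j, α j * Real.sigmoid (∑ k, x k * w j k)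

/-- The empirical risk of the network on the examples `x i` with labels `y i`, as a function of the
top layer `α`. -/
noncomputable def empiricalRisk {n m d : ℕ} (ℓ : ℝ → ℝ) (x : Fin m → Fin d → ℝ) (y : Fin m → ℝ)
    (w : Fin n → Fin d → ℝ) (α : EuclideanSpace ℝ (Fin n)) : ℝ :=
  ∑ i, ℓ (y i * network w α (x i))

/-! ## The computational problem -/

/-- An instance of the gradient problem: `m` examples in dimension `d` with labels `±1`, and a
network with `n` units, all with integer data. -/
structure GradInstance where
  n : ℕ
  m : ℕ
  d : ℕ
  x : Fin m → Fin d → ℤ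
  y : Fin m → ℤˣ
  w : Fin n → Fin d → ℤ
  α : Fin n → ℤ

namespace GradInstance

/-- The instance as an input: variables `0`, `1`, `2` hold `n`, `m`, `d`, and arrays
`0`, `1`, `2`, `3` hold the examples, the unit weights, the labels and the top layer. -/
def input (I : GradInstance) : RAM.Memory where
  var := fun v => if v = 0 then (I.n : ℤ) else if v = 1 then (I.m : ℤ)
    else if v = 2 then (I.d : ℤ) else 0
  arr := fun a t => if a = 0 then RAM.ofMat I.x t else if a = 1 then RAM.ofMat I.w t
    else if a = 2 then RAM.ofVec (fun i => (I.y i : ℤ)) t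
    else if a = 3 then RAM.ofVec I.α t else 0

/-- The empirical risk of the instance as a function of the top layer. -/
noncomputable def risk (ℓ : ℝ → ℝ) (I : GradInstance) : EuclideanSpace ℝ (Fin I.n) → ℝ :=
  empiricalRisk ℓ (fun i k => (I.x i k : ℝ)) (fun i => ((I.y i : ℤ) : ℝ))
    (fun j k => (I.w j k : ℝ))

/-- `P` computes the gradient of the empirical risk of `I` (with respect to the top layer, at the
top layer of `I`) at cost at most `T`, up to an additive error of `1 / 10` in every entry: the
`j`-th entry is written as a fraction with its numerator in cell `j` of array `4` and its
denominator in cell `j` of array `5`. -/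
def GradientComputedBy (ℓ : ℝ → ℝ) (I : GradInstance) (P : RAM.Program) (T : ℝ) : Prop :=
  ∃ (s : RAM.Memory) (t : ℕ), RAM.Exec P I.input s t ∧ (t : ℝ) ≤ T ∧
    ∃ g : EuclideanSpace ℝ (Fin I.n),
      HasGradientAt (I.risk ℓ) g (WithLp.toLp 2 fun j => (I.α j : ℝ)) ∧
      ∀ j : Fin I.n, 0 < s.arr 5 j ∧ |(s.arr 4 j : ℝ) / (s.arr 5 j : ℝ) - g j| ≤ 1 / 10

/-- The instances of dimension at most `D n` with `0`-`1` examples, all labels `+1`, unit weights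
of absolute value at most `D n`, and top layer `0`. -/
def IsBasic (D : ℕ → ℕ) (I : GradInstance) : Prop :=
  I.d ≤ D I.n ∧ (∀ i k, I.x i k = 0 ∨ I.x i k = 1) ∧ (∀ i, I.y i = 1) ∧
    (∀ j k, |I.w j k| ≤ (D I.n : ℤ)) ∧ (∀ j, I.α j = 0)

end GradInstance

namespace RAM

/-! ## Bit lengths -/

/-! At `α = 0` the `j`-th gradient entry is `ℓ'(0) * ∑ i, σ(x i ⬝ w j)`
(`hasGradientAt_empiricalRisk`). Let the examples be 0-1 vectors and `w j = -W * b j` with `b j` 0-1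
and `W` slightly above `log m`. An orthogonal pair `(i, j)` contributes `|ℓ'(0)| / 2` to entry `j`;
if there is none, every entry is at most `m * exp (-W) * |ℓ'(0)|`. So even a rough gradient solves
the orthogonal vectors problem. The second half of the theorem is this computation with `W = 10 log
n`, summed over `j`.

For part 1, `k`-SAT on `N` variables is turned into orthogonal vectors by split and list: examples
stand for assignments of the first `E₁` variables, units for assignments of the rest, and a
coordinate is `1` on both sides exactly if the corresponding clause is violated by both halves. The
dimension is then the number of clauses. As `D` is only known to exceed every multiple of `log n`,
the formula must first be made sparse, with `O(N)` clauses.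

The sparsification branches on flowers, that is, many clauses of one size `c` sharing a heart `H`:
an assignment either satisfies `H` or satisfies all petals `Z \ H`. A weighted count of clauses
(`potential`) rises by at least `1` at each heart step and by `γ ^ k` at each petal step
(`Inv.heart`, `Inv.petals`), and is at most of order `V * k * 4 ^ k * γ ^ k / γ` (`potential_le`).
Hence branches are few: each is described by a number with at most `N / Z + 1` digits in base `2 * γ
^ k` (`exists_code`, `Consts.Valid.exists_hit`), where `Z` may be chosen large.

All branches go into one gradient instance. Examples and units are pairs of a partial assignment and
a code `s`; extra coordinates, two per bit of `s`, give a common `1` as soon as the codes differ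
(`Consts.Valid.exists_common`). With `κ = p / q` the numbers of examples and units are exact powers
of two with exponents in ratio `p : q`, and `n * m` is `2 ^ E` with `E` only slightly above `N`.
Time `(n * m) ^ (1 - ε)`, together with the time `(n + m) * poly` for writing the instance, is then
`2 ^ ((1 - ε') * N) * poly`, against SETH (`Consts.Valid.exists_time_le`).

The reduction has to be an actual machine program. It is written in a small expression language with
bounded folds; compiled expressions are correct at polynomial cost (`Ex.correct`), loops and tables
are handled by cost-bounded Hoare triples (`Wp`), and the given gradient program is run as a
subroutine on fresh names (`exec_of_agreeBelow`, `Consts.exists_program`). -/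

theorem len_le_of_natAbs_le {a b : ℤ} (h : a.natAbs ≤ b.natAbs) : len a ≤ len b :=
  Nat.succ_le_succ (Nat.size_le_size h)

theorem len_le_of_lt_two_pow {a : ℤ} {j : ℕ} (h : a.natAbs < 2 ^ j) : len a ≤ j + 1 :=
  Nat.succ_le_succ (Nat.size_le.2 h)

theorem one_le_len (a : ℤ) : 1 ≤ len a := Nat.le_add_left _ _

theorem natAbs_lt_two_pow_len (a : ℤ) : a.natAbs < 2 ^ (len a - 1) := by
  simpa [len] using Nat.lt_size_self a.natAbs

theorem len_zero : len 0 = 1 := by simp [len]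

theorem len_one : len 1 = 2 := by simp [len]

theorem len_natCast_le (i : ℕ) : len (i : ℤ) ≤ i + 1 :=
  len_le_of_lt_two_pow (by simpa using Nat.lt_two_pow_self)

theorem len_neg (a : ℤ) : len (-a) = len a := by simp [len]

theorem len_add_le (a b : ℤ) : len (a + b) ≤ len a + len b := by
  have ha := natAbs_lt_two_pow_len a
  have hb := natAbs_lt_two_pow_len b
  have h1 := one_le_len a
  have h2 := one_le_len b
  have : (a + b).natAbs < 2 ^ (len a - 1 + (len b - 1) + 1) := by
    calc (a + b).natAbs ≤ a.natAbs + b.natAbs := Int.natAbs_add_le a b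
      _ < 2 ^ (len a - 1) + 2 ^ (len b - 1) := by omega
      _ ≤ 2 ^ (len a - 1 + (len b - 1)) + 2 ^ (len a - 1 + (len b - 1)) := by
        gcongr <;> omega
      _ = _ := by ring
  have := len_le_of_lt_two_pow this
  omega

theorem len_sub_le (a b : ℤ) : len (a - b) ≤ len a + len b := by
  simpa [sub_eq_add_neg, len_neg] using len_add_le a (-b)

theorem len_mul_le (a b : ℤ) : len (a * b) ≤ len a + len b := by
  have ha := natAbs_lt_two_pow_len a
  have hb := natAbs_lt_two_pow_len b
  have h1 := one_le_len a
  have h2 := one_le_len b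
  have : (a * b).natAbs < 2 ^ (len a - 1 + (len b - 1)) := by
    rw [Int.natAbs_mul, pow_add]
    exact Nat.mul_lt_mul'' ha hb
  have := len_le_of_lt_two_pow this
  omega

theorem len_div_le (a b : ℤ) : len (a / b) ≤ len a + len b :=
  (len_le_of_natAbs_le (Int.natAbs_ediv_le_natAbs a b)).trans (Nat.le_add_right _ _)

/-- Subadditivity for all four operations, products included, is what keeps the accumulator of a
bounded fold at polynomial length: each round adds only the length of its new term. -/
theorem len_eval_le (o : Op) (a b : ℤ) : len (o.eval a b) ≤ len a + len b := by
  cases o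
  exacts [len_add_le a b, len_sub_le a b, len_mul_le a b, len_div_le a b]

/-! ## Expressions with bounded folds -/

/-- Pure expressions over global variables `g x`, local variables `l x` and arrays.  The bound of a
fold is one of the first ten global variables. -/
inductive Ex where
  | c (z : ℤ)
  | g (x : ℕ)
  | l (x : ℕ)
  | arr (a : ℕ) (e : Ex)
  | bin (o : Op) (e f : Ex)
  | cond (e f h : Ex)
  | bind (x : ℕ) (e f : Ex)
  | fold (o : Op) (x : ℕ) (b : Fin 10) (e f : Ex)

/-- The value of an expression; `G` are the global variables, `A` the arrays, and the last argument
the local variables. -/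
def Ex.eval (G : ℕ → ℤ) (A : ℕ → ℕ → ℤ) : Ex → (ℕ → ℤ) → ℤ
  | .c z, _ => z
  | .g x, _ => G x
  | .l x, ρ => ρ x
  | .arr a e, ρ => A a (e.eval G A ρ).toNat
  | .bin o e f, ρ => o.eval (e.eval G A ρ) (f.eval G A ρ)
  | .cond e f h, ρ => if 0 < e.eval G A ρ then f.eval G A ρ else h.eval G A ρ
  | .bind x e f, ρ => f.eval G A (Function.update ρ x (e.eval G A ρ))
  | .fold o x b e f, ρ => Nat.rec (e.eval G A ρ)
      (fun j v => o.eval v (f.eval G A (Function.update ρ x (j : ℤ)))) (G b).toNat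

/-- The exponent of a polynomial bound for the cost of evaluating an expression. -/
def Ex.deg : Ex → ℕ
  | .c z => len z + 2
  | .g _ => 3
  | .l _ => 3
  | .arr _ e => e.deg + 2
  | .bin _ e f => e.deg + f.deg + 3
  | .cond e f h => e.deg + f.deg + h.deg + 2
  | .bind _ e f => e.deg * f.deg + 3
  | .fold _ _ _ e f => e.deg + f.deg + 8

/-- The machine variable of the global variable `x`. -/
def gv (R x : ℕ) : ℕ := R + 2 * x

/-- The machine variable of the temporary `j`. -/
def tv (R j : ℕ) : ℕ := R + 2 * j + 1

/-- Copy variable `y` to variable `x ≠ y`. -/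
def copy (x y : ℕ) : Program := .seq (.const x 0) (.arith .add x y x)

/-- Compilation of an expression: the value is left in temporary `r`, and only temporaries from `r`
on are changed.  The local variable `x` resides in temporary `Γ x`. -/
def Ex.comp (R : ℕ) : Ex → (ℕ → ℕ) → ℕ → Program
  | .c z, _, r => .const (tv R r) z
  | .g x, _, r => copy (tv R r) (gv R x)
  | .l x, Γ, r => copy (tv R r) (tv R (Γ x))
  | .arr a e, Γ, r => .seq (e.comp R Γ r) (.load (tv R r) a (tv R r))
  | .bin o e f, Γ, r => .seq (e.comp R Γ r) (.seq (f.comp R Γ (r + 1))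
      (.arith o (tv R r) (tv R r) (tv R (r + 1))))
  | .cond e f h, Γ, r => .seq (e.comp R Γ r) (.ite (tv R r) (f.comp R Γ r) (h.comp R Γ r))
  | .bind x e f, Γ, r => .seq (e.comp R Γ r) (.seq (f.comp R (Function.update Γ x r) (r + 1))
      (copy (tv R r) (tv R (r + 1))))
  | .fold o x b e f, Γ, r => .seq (e.comp R Γ r) (.seq (.const (tv R (r + 1)) 0)
      (.seq (.arith .sub (tv R (r + 2)) (gv R b) (tv R (r + 1)))
        (.loop (tv R (r + 2)) (.seq (f.comp R (Function.update Γ x (r + 1)) (r + 3))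
          (.seq (.arith o (tv R r) (tv R r) (tv R (r + 3)))
            (.seq (.const (tv R (r + 2)) 1)
              (.seq (.arith .add (tv R (r + 1)) (tv R (r + 1)) (tv R (r + 2)))
                (.arith .sub (tv R (r + 2)) (gv R b) (tv R (r + 1))))))))))

theorem setVar_var (s : Memory) (x y : ℕ) (v : ℤ) :
    (s.setVar x v).var y = if y = x then v else s.var y := by
  simp [Memory.setVar, Function.update_apply]

theorem setVar_arr (s : Memory) (x : ℕ) (v : ℤ) : (s.setVar x v).arr = s.arr := rfl

theorem exec_copy (s : Memory) {x y : ℕ} (h : y ≠ x) :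
    ∃ s', Exec (copy x y) s s' (len (s.var y) + 4) ∧ s'.arr = s.arr ∧ s'.var x = s.var y ∧
      ∀ z, z ≠ x → s'.var z = s.var z := by
  refine ⟨(s.setVar x 0).setVar x (s.var y), ?_, rfl, ?_, ?_⟩
  · have := Exec.seq (Exec.const x 0 s) (Exec.arith .add x y x (s.setVar x 0))
    simp only [setVar_var, h, if_true, if_false, len_zero, Op.eval, add_zero] at this
    rwa [show 1 + 1 + (1 + len (s.var y) + 1) = len (s.var y) + 4 by ring] at this
  · simp [setVar_var]
  · intro z hz; simp [setVar_var, hz]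

/-! ### Correctness and polynomial cost of compiled expressions. -/

theorem Ex.one_le_deg (e : Ex) : 1 ≤ e.deg := by cases e <;> simp [Ex.deg]

/-- The assertion that compiled code is correct for `e`, at a cost that is polynomial in a common
bound `X` for all bit lengths and for the values of the fold bounds. -/
def Ex.Correct (e : Ex) : Prop :=
  ∀ (R : ℕ) (Γ : ℕ → ℕ) (r : ℕ) (ρ : ℕ → ℤ) (s : Memory) (G : ℕ → ℤ) (X : ℕ), 2 ≤ X →
    (∀ x, s.var (gv R x) = G x) → (∀ x, Γ x < r ∧ s.var (tv R (Γ x)) = ρ x) →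
    (∀ x, len (G x) ≤ X) → (∀ x, len (ρ x) ≤ X) → (∀ a i, len (s.arr a i) ≤ X) →
    (∀ b, b < 10 → G b ≤ X) →
    ∃ s' t, Exec (e.comp R Γ r) s s' t ∧ s'.arr = s.arr ∧
      s'.var (tv R r) = e.eval G s.arr ρ ∧
      (∀ x, (∀ j, r ≤ j → x ≠ tv R j) → s'.var x = s.var x) ∧
      t ≤ X ^ e.deg ∧ len (e.eval G s.arr ρ) ≤ X ^ e.deg

theorem gv_ne_tv (R x j : ℕ) : gv R x ≠ tv R j := by simp only [gv, tv]; omega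

theorem tv_inj {R i j : ℕ} : tv R i = tv R j ↔ i = j := by simp only [tv]; omega

theorem pow_le_of_le {X a b : ℕ} (hX : 2 ≤ X) (h : a ≤ b) : X ^ a ≤ X ^ b :=
  Nat.pow_le_pow_right (by omega) h

theorem four_mul_pow_le {X a : ℕ} (hX : 2 ≤ X) : 4 * X ^ a ≤ X ^ (a + 2) := by
  rw [pow_add, mul_comm]
  exact Nat.mul_le_mul_left _ (by nlinarith)

theorem eight_mul_pow_le {X a : ℕ} (hX : 2 ≤ X) : 8 * X ^ a ≤ X ^ (a + 3) := by
  have := four_mul_pow_le (a := a + 1) hX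
  rw [pow_succ] at this
  nlinarith [Nat.zero_le (X ^ a)]

theorem Ex.correct_c (z : ℤ) : (Ex.c z).Correct := by
  intro R Γ r ρ s G X hX hG hΓ hlG hlρ hA hb
  refine ⟨_, _, Exec.const _ _ _, rfl, by simp [setVar_var, Ex.eval], ?_, ?_, ?_⟩
  · intro x hx; simp [setVar_var, hx r le_rfl]
  all_goals
    simp only [Ex.deg, Ex.eval]
    -- Only `2 ≤ X` is known, so a literal constant is absorbed by raising `X` to its own length.
    have h1 : len z < 2 ^ len z := Nat.lt_two_pow_self
    have h2 : 2 ^ len z ≤ X ^ len z := Nat.pow_le_pow_left hX _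
    have h3 := pow_le_of_le hX (show len z ≤ len z + 2 by omega)
    omega

theorem Ex.correct_g (y : ℕ) : (Ex.g y).Correct := by
  intro R Γ r ρ s G X hX hG hΓ hlG hlρ hA hb
  obtain ⟨s', he, ha, hv, hf⟩ := exec_copy s (gv_ne_tv R y r)
  refine ⟨s', _, he, ha, by rw [hv, hG]; rfl, fun x hx => hf x (hx r le_rfl), ?_, ?_⟩
  all_goals
    have := hlG y
    have h3 := eight_mul_pow_le (a := 0) hX
    have h4 := four_mul_pow_le (a := 1) hX
    simp only [Ex.deg, Ex.eval, hG, pow_one, pow_zero, Nat.reduceAdd] at *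
    omega

theorem Ex.correct_l (y : ℕ) : (Ex.l y).Correct := by
  intro R Γ r ρ s G X hX hG hΓ hlG hlρ hA hb
  have hne : tv R (Γ y) ≠ tv R r := by rw [Ne, tv_inj]; exact (hΓ y).1.ne
  obtain ⟨s', he, ha, hv, hf⟩ := exec_copy s hne
  refine ⟨s', _, he, ha, by rw [hv, (hΓ y).2]; rfl, fun x hx => hf x (hx r le_rfl), ?_, ?_⟩
  all_goals
    have := hlρ y
    have h3 := eight_mul_pow_le (a := 0) hX
    have h4 := four_mul_pow_le (a := 1) hX
    simp only [Ex.deg, Ex.eval, (hΓ y).2, pow_one, pow_zero, Nat.reduceAdd] at *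
    omega

theorem Ex.correct_arr (a : ℕ) {e : Ex} (ih : e.Correct) : (Ex.arr a e).Correct := by
  intro R Γ r ρ s G X hX hG hΓ hlG hlρ hA hb
  obtain ⟨s', t, he, ha, hv, hf, ht, hl⟩ := ih R Γ r ρ s G X hX hG hΓ hlG hlρ hA hb
  refine ⟨_, _, Exec.seq he (Exec.load _ _ _ _), ?_, ?_, ?_, ?_, ?_⟩
  · rw [setVar_arr, ha]
  · simp [setVar_var, Ex.eval, hv, ha]
  · intro x hx; simp [setVar_var, hx r le_rfl, hf x hx]
  · have h2 := hA a (e.eval G s.arr ρ).toNat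
    have h3 := four_mul_pow_le (a := e.deg) hX
    have h4 := pow_le_of_le hX e.one_le_deg
    simp only [hv, ha, Ex.deg, pow_one] at *
    omega
  · have h2 := hA a (e.eval G s.arr ρ).toNat
    have h4 := pow_le_of_le hX (show 1 ≤ e.deg + 2 by omega)
    simp only [Ex.deg, pow_one, Ex.eval] at *
    omega

theorem Ex.correct_bin (o : Op) {e f : Ex} (ihe : e.Correct) (ihf : f.Correct) :
    (Ex.bin o e f).Correct := by
  intro R Γ r ρ s G X hX hG hΓ hlG hlρ hA hb
  obtain ⟨s₁, t₁, he₁, ha₁, hv₁, hf₁, ht₁, hl₁⟩ := ihe R Γ r ρ s G X hX hG hΓ hlG hlρ hA hb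
  obtain ⟨s₂, t₂, he₂, ha₂, hv₂, hf₂, ht₂, hl₂⟩ := ihf R Γ (r + 1) ρ s₁ G X hX
    (fun x => by rw [hf₁ _ fun j _ => gv_ne_tv R x j, hG])
    (fun x => ⟨by have := (hΓ x).1; omega, by
      rw [hf₁, (hΓ x).2]; intro j hj; rw [Ne, tv_inj]; have := (hΓ x).1; omega⟩)
    hlG hlρ (by rwa [ha₁]) hb
  rw [ha₁] at hv₂ hl₂
  have hr : s₂.var (tv R r) = e.eval G s.arr ρ := by
    rw [hf₂, hv₁]; intro j hj; rw [Ne, tv_inj]; omega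
  refine ⟨_, _, Exec.seq he₁ (Exec.seq he₂ (Exec.arith _ _ _ _ _)), ?_, ?_, ?_, ?_, ?_⟩
  · rw [setVar_arr, ha₂, ha₁]
  · simp [setVar_var, Ex.eval, hr, hv₂]
  · intro x hx
    rw [setVar_var, if_neg (hx r le_rfl), hf₂ x fun j hj => hx j (by omega), hf₁ x hx]
  · have h3 := eight_mul_pow_le (a := e.deg + f.deg) hX
    have h4 := pow_le_of_le hX (show e.deg ≤ e.deg + f.deg by omega)
    have h5 := pow_le_of_le hX (show f.deg ≤ e.deg + f.deg by omega)
    have h6 := pow_le_of_le hX (show 0 ≤ e.deg + f.deg by omega)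
    simp only [hr, hv₂, Ex.deg, pow_zero] at *
    omega
  · have h3 := eight_mul_pow_le (a := e.deg + f.deg) hX
    have h4 := pow_le_of_le hX (show e.deg ≤ e.deg + f.deg by omega)
    have h5 := pow_le_of_le hX (show f.deg ≤ e.deg + f.deg by omega)
    have h6 := len_eval_le o (e.eval G s.arr ρ) (f.eval G s.arr ρ)
    simp only [Ex.deg, Ex.eval] at *
    omega

theorem Ex.correct_cond {e f h : Ex} (ihe : e.Correct) (ihf : f.Correct) (ihh : h.Correct) :
    (Ex.cond e f h).Correct := by
  intro R Γ r ρ s G X hX hG hΓ hlG hlρ hA hb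
  obtain ⟨s₁, t₁, he₁, ha₁, hv₁, hf₁, ht₁, hl₁⟩ := ihe R Γ r ρ s G X hX hG hΓ hlG hlρ hA hb
  have h3 := four_mul_pow_le (a := e.deg + f.deg + h.deg) hX
  have h4 := pow_le_of_le hX (show e.deg ≤ e.deg + f.deg + h.deg by omega)
  have h5 := pow_le_of_le hX (show f.deg ≤ e.deg + f.deg + h.deg by omega)
  have h6 := pow_le_of_le hX (show h.deg ≤ e.deg + f.deg + h.deg by omega)
  have h7 := pow_le_of_le hX (show 0 ≤ e.deg + f.deg + h.deg by omega)
  have key : ∀ f' : Ex, f'.Correct → ∃ s' t, Exec (f'.comp R Γ r) s₁ s' t ∧ s'.arr = s₁.arr ∧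
      s'.var (tv R r) = f'.eval G s.arr ρ ∧
      (∀ x, (∀ j, r ≤ j → x ≠ tv R j) → s'.var x = s₁.var x) ∧
      t ≤ X ^ f'.deg ∧ len (f'.eval G s.arr ρ) ≤ X ^ f'.deg := by
    intro f' ih
    rw [← ha₁]
    exact ih R Γ r ρ s₁ G X hX
      (fun x => by rw [hf₁ _ fun j _ => gv_ne_tv R x j, hG])
      (fun x => ⟨(hΓ x).1, by
        rw [hf₁, (hΓ x).2]; intro j hj; rw [Ne, tv_inj]; have := (hΓ x).1; omega⟩)
      hlG hlρ (by rwa [ha₁]) hb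
  by_cases hc : 0 < e.eval G s.arr ρ
  · obtain ⟨s₂, t₂, he₂, ha₂, hv₂, hf₂, ht₂, hl₂⟩ := key f ihf
    refine ⟨_, _, Exec.seq he₁ (Exec.ite_pos (by rwa [hv₁]) he₂), ?_, ?_, ?_, ?_, ?_⟩
    · rw [ha₂, ha₁]
    · simp [Ex.eval, hv₂, hc]
    · intro x hx; rw [hf₂ x hx, hf₁ x hx]
    · simp only [hv₁, Ex.deg, pow_zero] at *
      omega
    · simp only [Ex.deg, Ex.eval, if_pos hc] at *
      omega
  · obtain ⟨s₂, t₂, he₂, ha₂, hv₂, hf₂, ht₂, hl₂⟩ := key h ihh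
    refine ⟨_, _, Exec.seq he₁ (Exec.ite_neg (by rwa [hv₁]) he₂), ?_, ?_, ?_, ?_, ?_⟩
    · rw [ha₂, ha₁]
    · simp [Ex.eval, hv₂, hc]
    · intro x hx; rw [hf₂ x hx, hf₁ x hx]
    · simp only [hv₁, Ex.deg, pow_zero] at *
      omega
    · simp only [Ex.deg, Ex.eval, if_neg hc] at *
      omega

/-- The bound value can have length `X ^ e.deg`, so the body is treated with `X ^ e.deg` in the role
of `X`. This is why the degrees multiply here. -/
theorem Ex.correct_bind (y : ℕ) {e f : Ex} (ihe : e.Correct) (ihf : f.Correct) :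
    (Ex.bind y e f).Correct := by
  intro R Γ r ρ s G X hX hG hΓ hlG hlρ hA hb
  obtain ⟨s₁, t₁, he₁, ha₁, hv₁, hf₁, ht₁, hl₁⟩ := ihe R Γ r ρ s G X hX hG hΓ hlG hlρ hA hb
  have hXe : X ≤ X ^ e.deg := by simpa using pow_le_of_le hX e.one_le_deg
  obtain ⟨s₂, t₂, he₂, ha₂, hv₂, hf₂, ht₂, hl₂⟩ := ihf R (Function.update Γ y r) (r + 1)
    (Function.update ρ y (e.eval G s.arr ρ)) s₁ G (X ^ e.deg) (hX.trans hXe)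
    (fun x => by rw [hf₁ _ fun j _ => gv_ne_tv R x j, hG])
    (fun x => by
      by_cases hx : x = y
      · subst hx; simp [hv₁]
      · simp only [Function.update_of_ne hx]
        refine ⟨by have := (hΓ x).1; omega, ?_⟩
        rw [hf₁, (hΓ x).2]; intro j hj; rw [Ne, tv_inj]; have := (hΓ x).1; omega)
    (fun x => (hlG x).trans hXe)
    (fun x => by
      by_cases hx : x = y
      · subst hx; simpa using hl₁
      · simpa [Function.update_of_ne hx] using (hlρ x).trans hXe)
    (by rw [ha₁]; exact fun a i => (hA a i).trans hXe)
    (fun b h => (hb b h).trans (by exact_mod_cast hXe))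
  rw [ha₁] at hv₂ hl₂
  have hne : tv R (r + 1) ≠ tv R r := by rw [Ne, tv_inj]; omega
  obtain ⟨s₃, he₃, ha₃, hv₃, hf₃⟩ := exec_copy s₂ hne
  rw [← pow_mul] at ht₂ hl₂
  have h3 := eight_mul_pow_le (a := e.deg * f.deg) hX
  have h4 := pow_le_of_le hX (show e.deg ≤ e.deg * f.deg from
    Nat.le_mul_of_pos_right _ f.one_le_deg)
  have h5 := pow_le_of_le hX (show 1 ≤ e.deg * f.deg from
    Nat.mul_pos e.one_le_deg f.one_le_deg)
  refine ⟨_, _, Exec.seq he₁ (Exec.seq he₂ he₃), ?_, ?_, ?_, ?_, ?_⟩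
  · rw [ha₃, ha₂, ha₁]
  · simp [Ex.eval, hv₃, hv₂]
  · intro x hx
    rw [hf₃ x (hx r le_rfl), hf₂ x fun j hj => hx j (by omega), hf₁ x hx]
  · simp only [hv₂, Ex.deg, pow_one] at *
    omega
  · simp only [Ex.deg, Ex.eval] at *
    omega


/-- The body sees the index but not the accumulator, and the index is below the fold bound, hence
below `X`; so every round is evaluated under the same bound `X`. The accumulator grows additively by
`X ^ f.deg` per round, over at most `X` rounds, and no iterated blow-up occurs. -/
theorem Ex.correct_fold (o : Op) (y : ℕ) (b : Fin 10) {e f : Ex} (ihe : e.Correct)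
    (ihf : f.Correct) : (Ex.fold o y b e f).Correct := by
  intro R Γ r ρ s G X hX hG hΓ hlG hlρ hA hb
  obtain ⟨s₁, t₁, he₁, ha₁, hv₁, hf₁, ht₁, hl₁⟩ := ihe R Γ r ρ s G X hX hG hΓ hlG hlρ hA hb
  set Y := X ^ (e.deg + f.deg + 1) with hY
  have hXY : X ≤ Y := by simpa using pow_le_of_le hX (show 1 ≤ e.deg + f.deg + 1 by omega)
  have heY : X ^ e.deg ≤ Y := pow_le_of_le hX (by omega)
  have hfY : X * X ^ f.deg ≤ Y := by rw [← pow_succ']; exact pow_le_of_le hX (by omega)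
  have hfY' : X ^ f.deg ≤ Y := pow_le_of_le hX (by omega)
  set body := fun j : ℕ => f.eval G s.arr (Function.update ρ y (j : ℤ)) with hbody
  set acc := fun j : ℕ => (Nat.rec (e.eval G s.arr ρ) (fun j v => o.eval v (body j)) j : ℤ)
    with hacc
  set n := (G b).toNat with hn
  have hnX : n ≤ X := by have := hb b b.2; omega
  -- Correctness of the body is applied to an artificial memory with the index in temporary `r`,
  -- only to extract the length bound.
  have hbodylen : ∀ j < n, len (body j) ≤ X ^ f.deg := by
    intro j hj
    obtain ⟨-, -, -, -, -, -, -, hl⟩ := ihf R (Function.update Γ y r) (r + 1)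
      (Function.update ρ y (j : ℤ)) (s.setVar (tv R r) j) G X hX
      (fun x => by rw [setVar_var, if_neg (gv_ne_tv R x r), hG])
      (fun x => by
        by_cases hx : x = y
        · subst hx; simp [setVar_var]
        · have := (hΓ x).1
          simp only [Function.update_of_ne hx, setVar_var, tv_inj, this.ne, if_false]
          exact ⟨by omega, (hΓ x).2⟩)
      hlG
      (fun x => by
        by_cases hx : x = y
        · subst hx; simpa using (len_natCast_le j).trans (by omega)
        · simpa [Function.update_of_ne hx] using hlρ x)
      hA hb
    exact hl
  have hacclen : ∀ j ≤ n, len (acc j) ≤ X ^ e.deg + j * X ^ f.deg := by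
    intro j
    induction j with
    | zero => intro _; simpa [hacc] using hl₁
    | succ j ih =>
      intro hj
      have h1 := ih (by omega)
      have h2 := hbodylen j (by omega)
      have h3 := len_eval_le o (acc j) (body j)
      have h4 : acc (j + 1) = o.eval (acc j) (body j) := rfl
      rw [h4, add_mul]; omega
  have hacclen' : ∀ j ≤ n, len (acc j) ≤ 2 * Y := by
    intro j hj
    have h1 := hacclen j hj
    have h2 : j * X ^ f.deg ≤ X * X ^ f.deg := Nat.mul_le_mul_right _ (by omega)
    omega
  have hsublen : ∀ j ≤ n, len (G b - j) ≤ 3 * X := by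
    intro j hj
    have h1 := len_sub_le (G b) j
    have h2 := hlG b
    have h3 := len_natCast_le j
    omega
  -- Induction on the number `i` of remaining rounds. Temporaries `r`, `r + 1`, `r + 2` hold the
  -- accumulator, the index and the bound minus the index, which is the loop test.
  have hloop : ∀ (i j : ℕ) (s₀ : Memory), j + i = n → s₀.arr = s.arr →
      (∀ x, s₀.var (gv R x) = G x) → (∀ x, s₀.var (tv R (Γ x)) = ρ x) →
      s₀.var (tv R r) = acc j → s₀.var (tv R (r + 1)) = j →
      s₀.var (tv R (r + 2)) = G b - j →
      ∃ s' t, Exec (.loop (tv R (r + 2)) (.seq (f.comp R (Function.update Γ y (r + 1)) (r + 3))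
          (.seq (.arith o (tv R r) (tv R r) (tv R (r + 3)))
            (.seq (.const (tv R (r + 2)) 1)
              (.seq (.arith .add (tv R (r + 1)) (tv R (r + 1)) (tv R (r + 2)))
                (.arith .sub (tv R (r + 2)) (gv R b) (tv R (r + 1)))))))) s₀ s' t ∧
        s'.arr = s.arr ∧ s'.var (tv R r) = acc n ∧
        (∀ x, (∀ j, r ≤ j → x ≠ tv R j) → s'.var x = s₀.var x) ∧ t ≤ i * (30 * Y) + 4 * Y := by
    intro i
    induction i with
    | zero =>
      intro j s₀ hj h1 h2 h3 h4 h5 h6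
      have hj : j = n := by omega
      subst hj
      refine ⟨s₀, _, Exec.loop_neg (by rw [h6]; omega), h1, h4, fun _ _ => rfl, ?_⟩
      have := hsublen n le_rfl
      rw [h6]; omega
    | succ i ih =>
      intro j s₀ hj h1 h2 h3 h4 h5 h6
      obtain ⟨s₂, t₂, he₂, ha₂, hv₂, hf₂, ht₂, hl₂⟩ := ihf R (Function.update Γ y (r + 1)) (r + 3)
        (Function.update ρ y (j : ℤ)) s₀ G X hX h2
        (fun x => by
          by_cases hx : x = y
          · subst hx; simp [h5]
          · simp only [Function.update_of_ne hx]
            exact ⟨by have := (hΓ x).1; omega, h3 x⟩)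
        hlG
        (fun x => by
          by_cases hx : x = y
          · subst hx; simpa using (len_natCast_le j).trans (by omega)
          · simpa [Function.update_of_ne hx] using hlρ x)
        (by rwa [h1]) hb
      rw [h1] at ha₂ hv₂ hl₂
      have ht : ∀ j < r + 3, s₂.var (tv R j) = s₀.var (tv R j) := by
        intro j hj; rw [hf₂]; intro j' hj'; rw [Ne, tv_inj]; omega
      have hg : ∀ x, s₂.var (gv R x) = G x := by
        intro x; rw [hf₂ _ fun j _ => gv_ne_tv R x j, h2]
      have hgt : ∀ x j, (gv R x = tv R j) = False := fun x j => eq_false (gv_ne_tv R x j)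
      have htg : ∀ x j, (tv R j = gv R x) = False := fun x j => eq_false (gv_ne_tv R x j).symm
      have hΓne : ∀ x i, r ≤ i → (Γ x = i) = False := fun x i hi =>
        eq_false (by have := (hΓ x).1; omega)
      obtain ⟨s₃, t₃, he₃, ha₃, hv₃, hf₃, ht₃⟩ := ih (j + 1)
        (((((s₂.setVar (tv R r) (acc (j + 1))).setVar (tv R (r + 2)) 1).setVar (tv R (r + 1))
          (j + 1)).setVar (tv R (r + 2)) (G b - (j + 1)))) (by omega)
        (by simp [setVar_arr, ha₂])
        (fun x => by simp [setVar_var, hgt, hg])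
        (fun x => by
          have := (hΓ x).1
          simp [setVar_var, tv_inj, hΓne, ht (Γ x) (by omega), h3])
        (by simp [setVar_var, tv_inj])
        (by simp [setVar_var, tv_inj])
        (by simp [setVar_var])
      have hex := Exec.loop_pos (x := tv R (r + 2)) (s := s₀) (by rw [h6]; omega)
        (Exec.seq he₂ (Exec.seq (Exec.arith o (tv R r) (tv R r) (tv R (r + 3)) _)
          (Exec.seq (Exec.const (tv R (r + 2)) 1 _)
            (Exec.seq (Exec.arith .add (tv R (r + 1)) (tv R (r + 1)) (tv R (r + 2)) _)
              (Exec.arith .sub (tv R (r + 2)) (gv R b) (tv R (r + 1)) _)))))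
        (s'' := s₃) (t₂ := t₃) (by
          convert he₃ using 1
          have hacc1 : acc (j + 1) = o.eval (acc j) (body j) := rfl
          simp [setVar_var, tv_inj, hgt, hg, ht, h4, h5, hv₂, hacc1, Op.eval, hbody])
      refine ⟨s₃, _, hex, ha₃, hv₃, ?_, ?_⟩
      · intro x hx
        rw [hf₃ x hx]
        simp [setVar_var, hx, hf₂ x fun j hj => hx j (by omega)]
      · have e1 := hsublen j (by omega)
        have e2 := hacclen' j (by omega)
        have e3 := hbodylen j (by omega)
        have e4 := len_natCast_le j
        have e5 := len_natCast_le (j + 1)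
        have e6 := hlG b
        push_cast at e5
        simp [setVar_var, tv_inj, hgt, hg, ht, h4, h5, h6, hv₂, Op.eval, len_one]
        change len (f.eval G s.arr (Function.update ρ y (j : ℤ))) ≤ _ at e3
        rw [add_mul]
        omega
  have hgt : ∀ x j, (gv R x = tv R j) = False := fun x j => eq_false (gv_ne_tv R x j)
  have hΓne : ∀ x i, r ≤ i → (Γ x = i) = False := fun x i hi =>
    eq_false (by have := (hΓ x).1; omega)
  have hg₁ : ∀ x, s₁.var (gv R x) = G x := fun x => by rw [hf₁ _ fun j _ => gv_ne_tv R x j, hG]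
  obtain ⟨s₃, t₃, he₃, ha₃, hv₃, hf₃, ht₃⟩ := hloop n 0
    ((s₁.setVar (tv R (r + 1)) 0).setVar (tv R (r + 2)) (G b - 0)) (by omega)
    (by simp [setVar_arr, ha₁])
    (fun x => by simp [setVar_var, hgt, hg₁])
    (fun x => by
      have := (hΓ x).1
      rw [setVar_var, setVar_var, if_neg (by rw [tv_inj]; omega), if_neg (by rw [tv_inj]; omega),
        hf₁, (hΓ x).2]
      intro j hj; rw [Ne, tv_inj]; omega)
    (by simp [setVar_var, tv_inj, hv₁, hacc])
    (by simp [setVar_var, tv_inj])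
    (by simp [setVar_var])
  refine ⟨s₃, _, Exec.seq he₁ (Exec.seq (Exec.const _ 0 _) (Exec.seq
    (Exec.arith .sub (tv R (r + 2)) (gv R b) (tv R (r + 1)) _) (t₂ := t₃) (s'' := s₃) (by
      convert he₃ using 1
      simp [setVar_var, hgt, hg₁, Op.eval]))), ha₃, ?_, ?_, ?_, ?_⟩
  · rw [hv₃]; rfl
  · intro x hx
    rw [hf₃ x hx]
    simp [setVar_var, hx, hf₁ x hx]
  · have e6 := hlG b
    have h8 : X * Y * 64 = 64 * (X * Y) := by ring
    have h9 : X ^ (e.deg + f.deg + 8) = X * Y * X ^ 6 := by rw [hY]; ring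
    have h10 : 64 ≤ X ^ 6 := by calc 64 = 2 ^ 6 := by norm_num
      _ ≤ X ^ 6 := Nat.pow_le_pow_left hX 6
    have h11 : X * Y * 64 ≤ X * Y * X ^ 6 := Nat.mul_le_mul_left _ h10
    have h12 : n * (30 * Y) ≤ X * (30 * Y) := Nat.mul_le_mul_right _ hnX
    have h13 : X * (30 * Y) = 30 * (X * Y) := by ring
    have h14 : 2 * Y ≤ X * Y := Nat.mul_le_mul_right _ hX
    simp [setVar_var, hgt, hg₁, len_zero, Ex.deg]
    omega
  · have h1 := hacclen' n le_rfl
    have h9 : X ^ (e.deg + f.deg + 8) = Y * X ^ 7 := by rw [hY]; ring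
    have h10 : 2 ≤ X ^ 7 := by calc 2 ≤ 2 ^ 7 := by norm_num
      _ ≤ X ^ 7 := Nat.pow_le_pow_left hX 7
    have h11 : Y * 2 ≤ Y * X ^ 7 := Nat.mul_le_mul_left _ h10
    change len (acc n) ≤ X ^ (e.deg + f.deg + 8)
    omega

theorem Ex.correct (e : Ex) : e.Correct := by
  induction e with
  | c z => exact correct_c z
  | g x => exact correct_g x
  | l x => exact correct_l x
  | arr a e ih => exact correct_arr a ih
  | bin o e f ihe ihf => exact correct_bin o ihe ihf
  | cond e f h ihe ihf ihh => exact correct_cond ihe ihf ihh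
  | bind x e f ihe ihf => exact correct_bind x ihe ihf
  | fold o x b e f ihe ihf => exact correct_fold o x b ihe ihf

end RAM

namespace RAM

/-! ## Commands on abstract states

The state of a program in the expression language is a `Memory` whose variables are the global
variables; machine variables below `R` are left alone. -/

/-- The machine memory `s` implements the abstract state `σ`, with contents `low` of the machine
variables below `R`. -/
def Impl (R : ℕ) (low : ℕ → ℤ) (σ s : Memory) : Prop :=
  (∀ x, s.var (gv R x) = σ.var x) ∧ s.arr = σ.arr ∧ ∀ x < R, s.var x = low x

/-- From abstract state `σ`, the program `c` halts at cost at most `T` in a state satisfying `Q`. -/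
def Wp (R : ℕ) (low : ℕ → ℤ) (c : Program) (T : ℕ) (σ : Memory) (Q : Memory → Prop) : Prop :=
  ∀ s, Impl R low σ s → ∃ s' t σ', Exec c s s' t ∧ t ≤ T ∧ Impl R low σ' s' ∧ Q σ'

theorem Wp.mono {R : ℕ} {low : ℕ → ℤ} {c : Program} {T T' : ℕ} {σ : Memory}
    {Q Q' : Memory → Prop} (h : Wp R low c T σ Q) (hT : T ≤ T') (hQ : ∀ σ', Q σ' → Q' σ') :
    Wp R low c T' σ Q' := by
  intro s hs
  obtain ⟨s', t, σ', he, ht, hi, hq⟩ := h s hs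
  exact ⟨s', t, σ', he, ht.trans hT, hi, hQ _ hq⟩

theorem Wp.seq {R : ℕ} {low : ℕ → ℤ} {c₁ c₂ : Program} {T₁ T₂ : ℕ} {σ : Memory}
    {Q₁ Q : Memory → Prop} (h₁ : Wp R low c₁ T₁ σ Q₁) (h₂ : ∀ σ', Q₁ σ' → Wp R low c₂ T₂ σ' Q) :
    Wp R low (.seq c₁ c₂) (T₁ + T₂) σ Q := by
  intro s hs
  obtain ⟨s', t, σ', he, ht, hi, hq⟩ := h₁ s hs
  obtain ⟨s'', t', σ'', he', ht', hi', hq'⟩ := h₂ σ' hq s' hi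
  exact ⟨s'', _, σ'', he.seq he', by omega, hi', hq'⟩

/-- All bit lengths are at most `X`, and so are the first ten global variables. -/
structure Bounded (X : ℕ) (σ : Memory) : Prop where
  two_le : 2 ≤ X
  var : ∀ x, len (σ.var x) ≤ X
  arr : ∀ a i, len (σ.arr a i) ≤ X
  small : ∀ x < 10, σ.var x ≤ X

theorem Bounded.setVar {X : ℕ} {σ : Memory} (h : Bounded X σ) {x : ℕ} {v : ℤ} (hv : len v ≤ X)
    (hs : x < 10 → v ≤ X) : Bounded X (σ.setVar x v) := by
  refine ⟨h.two_le, fun y => ?_, h.arr, fun y hy => ?_⟩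
  · rw [setVar_var]; split_ifs
    exacts [hv, h.var y]
  · rw [setVar_var]; split_ifs with hyx
    exacts [hs (hyx ▸ hy), h.small y hy]

/-- The value of a closed expression. -/
def Ex.val (e : Ex) (σ : Memory) : ℤ := e.eval σ.var σ.arr fun _ => 0

/-- The length bound is part of `Ex.Correct`, so it suffices to exhibit some memory implementing
`σ`: with `R = 0`, even cells carry the global variables and odd cells are zero temporaries. -/
theorem Bounded.len_val {X : ℕ} {σ : Memory} (h : Bounded X σ) (e : Ex) :
    len (e.val σ) ≤ X ^ e.deg := by
  obtain ⟨-, -, -, -, -, -, -, hl⟩ := e.correct 0 (fun _ => 0) 1 (fun _ => 0)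
    ⟨fun x => if x % 2 = 0 then σ.var (x / 2) else 0, σ.arr⟩ σ.var X h.two_le
    (fun x => by simp [gv]) (fun x => by simp [tv]) h.var
    (fun x => by rw [len_zero]; have := h.two_le; omega) h.arr h.small
  exact hl

/-- Unbound local variables all reside in temporary `0`, which must therefore hold their default
value `0`; the compiled code starts at `r ≥ 1` in order not to overwrite it. -/
theorem exec_comp {R : ℕ} {low : ℕ → ℤ} {X : ℕ} {σ s : Memory} (hσ : Bounded X σ)
    (hs : Impl R low σ s) (h0 : s.var (tv R 0) = 0) (e : Ex) {r : ℕ} (hr : 1 ≤ r) :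
    ∃ s' t, Exec (e.comp R (fun _ => 0) r) s s' t ∧ Impl R low σ s' ∧
      s'.var (tv R r) = e.val σ ∧ (∀ j < r, s'.var (tv R j) = s.var (tv R j)) ∧
      t ≤ X ^ e.deg := by
  obtain ⟨s', t, he, ha, hv, hf, ht, -⟩ := e.correct R (fun _ => 0) r (fun _ => 0) s σ.var X
    hσ.two_le hs.1 (fun x => ⟨hr, h0⟩) hσ.var
    (fun x => by rw [len_zero]; have := hσ.two_le; omega) (by rw [hs.2.1]; exact hσ.arr) hσ.small
  refine ⟨s', t, he, ⟨fun x => ?_, ha.trans hs.2.1, fun x hx => ?_⟩, ?_, fun j hj => hf _ ?_, ht⟩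
  · rw [hf _ fun j _ => gv_ne_tv R x j, hs.1]
  · rw [hf x, hs.2.2 x hx]; intro j _; simp only [tv]; omega
  · rw [hv, Ex.val, hs.2.1]
  · intro i hi; rw [Ne, tv_inj]; omega

theorem Impl.setVar_tv {R : ℕ} {low : ℕ → ℤ} {σ s : Memory} (hs : Impl R low σ s) (j : ℕ) (v : ℤ) :
    Impl R low σ (s.setVar (tv R j) v) := by
  refine ⟨fun x => ?_, hs.2.1, fun x hx => ?_⟩
  · rw [setVar_var, if_neg (gv_ne_tv R x j), hs.1]
  · rw [setVar_var, if_neg (by simp only [tv]; omega), hs.2.2 x hx]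

theorem gv_inj {R x y : ℕ} : gv R x = gv R y ↔ x = y := by simp only [gv]; omega

theorem Impl.setVar_gv {R : ℕ} {low : ℕ → ℤ} {σ s : Memory} (hs : Impl R low σ s) (x : ℕ) (v : ℤ) :
    Impl R low (σ.setVar x v) (s.setVar (gv R x) v) := by
  refine ⟨fun y => ?_, hs.2.1, fun y hy => ?_⟩
  · simp only [setVar_var, gv_inj, hs.1]
  · rw [setVar_var, if_neg (by simp only [gv]; omega), hs.2.2 y hy]

/-- The assignment of the value of an expression to a global variable. -/
def assign (R x : ℕ) (e : Ex) : Program :=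
  .seq (.const (tv R 0) 0) (.seq (e.comp R (fun _ => 0) 1)
    (.arith .add (gv R x) (tv R 1) (tv R 0)))

theorem Wp.assign {R : ℕ} {low : ℕ → ℤ} {X : ℕ} {σ : Memory} (hσ : Bounded X σ) (x : ℕ) (e : Ex) :
    Wp R low (assign R x e) (X ^ (e.deg + 3)) σ (· = σ.setVar x (e.val σ)) := by
  intro s hs
  obtain ⟨s', t, he, hi, hv, hf, ht⟩ := exec_comp hσ (hs.setVar_tv 0 0) (by simp [setVar_var]) e
    le_rfl
  have h0 : s'.var (tv R 0) = 0 := by rw [hf 0 one_pos]; simp [setVar_var]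
  refine ⟨_, _, _, Exec.seq (Exec.const _ _ _) (Exec.seq he (Exec.arith _ _ _ _ _)), ?_,
    hi.setVar_gv x _, ?_⟩
  · have h1 := hσ.len_val e
    have h2 := eight_mul_pow_le (a := e.deg) hσ.two_le
    have h3 := pow_le_of_le hσ.two_le e.one_le_deg
    have h4 := hσ.two_le
    simp only [h0, hv, len_zero, pow_one] at *
    omega
  · simp [h0, hv, Op.eval]

/-- The assignment of the value of the expression `f` to the cell with index `e` of array `a`. -/
def assignArr (R a : ℕ) (e f : Ex) : Program :=
  .seq (.const (tv R 0) 0) (.seq (e.comp R (fun _ => 0) 1) (.seq (f.comp R (fun _ => 0) 2)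
    (.store a (tv R 1) (tv R 2))))

theorem Wp.assignArr {R : ℕ} {low : ℕ → ℤ} {X : ℕ} {σ : Memory} (hσ : Bounded X σ) (a : ℕ)
    (e f : Ex) : Wp R low (assignArr R a e f) (X ^ (e.deg + f.deg + 3)) σ
      (· = σ.setArr a (e.val σ).toNat (f.val σ)) := by
  intro s hs
  obtain ⟨s₁, t₁, he₁, hi₁, hv₁, hf₁, ht₁⟩ := exec_comp hσ (hs.setVar_tv 0 0)
    (by simp [setVar_var]) e le_rfl
  obtain ⟨s₂, t₂, he₂, hi₂, hv₂, hf₂, ht₂⟩ := exec_comp hσ hi₁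
    (by rw [hf₁ 0 one_pos]; simp [setVar_var]) f one_le_two
  have h1 : s₂.var (tv R 1) = e.val σ := by rw [hf₂ 1 one_lt_two, hv₁]
  refine ⟨_, _, _, Exec.seq (Exec.const _ _ _) (Exec.seq he₁ (Exec.seq he₂ (Exec.store _ _ _ _))),
    ?_, ?_, rfl⟩
  · have h3 := hσ.len_val e
    have h4 := hσ.len_val f
    have h5 := eight_mul_pow_le (a := e.deg + f.deg) hσ.two_le
    have h6 := pow_le_of_le hσ.two_le (show e.deg ≤ e.deg + f.deg by omega)
    have h7 := pow_le_of_le hσ.two_le (show f.deg ≤ e.deg + f.deg by omega)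
    have h8 := pow_le_of_le hσ.two_le (show 1 ≤ e.deg + f.deg by have := e.one_le_deg; omega)
    have h9 := hσ.two_le
    simp only [h1, hv₂, len_zero, pow_one] at *
    omega
  · exact ⟨hi₂.1, by simp [Memory.setArr, hi₂.2.1, h1, hv₂], hi₂.2.2⟩

/-- The loop `for x = 0, …, b - 1`, where `x` and `b` are global variables. -/
def forLoop (R x b : ℕ) (c : Program) : Program :=
  .seq (.const (gv R x) 0) (.seq (.arith .sub (tv R 0) (gv R b) (gv R x))
    (.loop (tv R 0) (.seq c (.seq (.const (tv R 0) 1)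
      (.seq (.arith .add (gv R x) (gv R x) (tv R 0))
        (.arith .sub (tv R 0) (gv R b) (gv R x)))))))

/-- The cost `T i` may depend on the round: in `readout`, round `i` pays for the length of the
`i`-th output fraction. The loop increments the counter itself, so the body has to leave it alone
and establish the invariant for the memory after the increment. -/
theorem Wp.forLoop {R : ℕ} {low : ℕ → ℤ} {X : ℕ} {σ : Memory} {x b : ℕ} {c : Program} (n : ℕ)
    (I : ℕ → Memory → Prop) (T : ℕ → ℕ) (hX : 2 ≤ X) (hn : len (n : ℤ) ≤ X) (hxb : b ≠ x)
    (hb : σ.var b = n) (h0 : I 0 (σ.setVar x 0))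
    (hstep : ∀ i < n, ∀ τ : Memory, τ.var x = i → τ.var b = n → I i τ →
      Wp R low c (T i) τ fun τ' => τ'.var x = i ∧ τ'.var b = n ∧ I (i + 1) (τ'.setVar x (i + 1))) :
    Wp R low (forLoop R x b c) (∑ i ∈ Finset.range n, (T i + 8 * X) + 8 * X) σ
      fun τ => τ.var x = n ∧ τ.var b = n ∧ I n τ := by
  have hlen : ∀ i ≤ n, len (i : ℤ) ≤ X := fun i hi =>
    (len_le_of_natAbs_le (by simpa using hi)).trans hn
  have hlen' : ∀ i ≤ n, len ((n : ℤ) - i) ≤ X := fun i hi =>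
    (len_le_of_natAbs_le (by omega)).trans hn
  have key : ∀ (j i : ℕ) (τ s : Memory), i + j = n → τ.var x = i → τ.var b = n → I i τ →
      Impl R low τ s → s.var (tv R 0) = n - i → ∃ s' t τ',
      Exec (.loop (tv R 0) (.seq c (.seq (.const (tv R 0) 1)
      (.seq (.arith .add (gv R x) (gv R x) (tv R 0))
        (.arith .sub (tv R 0) (gv R b) (gv R x)))))) s s' t ∧
      t ≤ ∑ i ∈ Finset.Ico i n, (T i + 8 * X) + 2 * X ∧ Impl R low τ' s' ∧
      τ'.var x = n ∧ τ'.var b = n ∧ I n τ' := by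
    intro j
    induction j with
    | zero =>
      intro i τ s hi h1 h2 h3 h4 h5
      obtain rfl : i = n := by omega
      refine ⟨s, _, τ, Exec.loop_neg (by rw [h5]; omega), ?_, h4, h1, h2, h3⟩
      have := hlen' i le_rfl
      rw [h5]; omega
    | succ j ih =>
      intro i τ s hi h1 h2 h3 h4 h5
      obtain ⟨s₁, t₁, τ₁, he₁, ht₁, hi₁, hx₁, hb₁, hI₁⟩ := hstep i (by omega) τ h1 h2 h3 s h4
      obtain ⟨s₂, t₂, τ₂, he₂, ht₂, hi₂, hx₂, hb₂, hI₂⟩ := ih (i + 1) (τ₁.setVar x (i + 1))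
        (((s₁.setVar (tv R 0) 1).setVar (gv R x) (i + 1)).setVar (tv R 0) (n - (i + 1))) (by omega)
        (by simp [setVar_var]) (by simp [setVar_var, hxb, hb₁]) hI₁
        (((hi₁.setVar_tv 0 _).setVar_gv x _).setVar_tv 0 _) (by simp [setVar_var])
      have hgt : ∀ x j, (gv R x = tv R j) = False := fun x j => eq_false (gv_ne_tv R x j)
      refine ⟨s₂, _, τ₂, Exec.loop_pos (t₂ := t₂) (by rw [h5]; omega) (Exec.seq he₁
        (Exec.seq (Exec.const (tv R 0) 1 _) (Exec.seq (Exec.arith .add (gv R x) (gv R x) (tv R 0) _)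
          (Exec.arith .sub (tv R 0) (gv R b) (gv R x) _)))) (by
          convert he₂ using 1
          simp [setVar_var, hgt, hi₁.1, hx₁, hb₁, hxb, gv_inj, Op.eval]), ?_, hi₂, hx₂, hb₂, hI₂⟩
      have e1 := hlen' i (by omega)
      have e2 := hlen i (by omega)
      have e3 := hlen (i + 1) (by omega)
      push_cast at e3
      rw [Finset.sum_eq_sum_Ico_succ_bot (by omega)]
      simp only [setVar_var, hgt, hi₁.1, hx₁, hb₁, hxb, gv_inj, Op.eval, len_one, h5, if_true,
        if_false]
      omega
  intro s hs
  have hgt : ∀ x j, (gv R x = tv R j) = False := fun x j => eq_false (gv_ne_tv R x j)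
  obtain ⟨s₂, t₂, τ₂, he₂, ht₂, hi₂, h⟩ := key n 0 (σ.setVar x 0)
    ((s.setVar (gv R x) 0).setVar (tv R 0) (n - 0)) (by omega) (by simp [setVar_var])
    (by simp [setVar_var, hxb, hb]) h0 ((hs.setVar_gv x 0).setVar_tv 0 _) (by simp [setVar_var])
  refine ⟨s₂, _, τ₂, Exec.seq (Exec.const _ 0 _) (Exec.seq (t₂ := t₂) (Exec.arith .sub _ _ _ _) (by
    convert he₂ using 1
    simp [setVar_var, hs.1, hb, hxb, gv_inj, Op.eval])), ?_, hi₂, h⟩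
  rw [← Finset.range_eq_Ico] at ht₂
  have := hlen n le_rfl
  simp only [setVar_var, hs.1, hb, hxb, gv_inj, len_zero, if_true, if_false]
  omega

/-- Tabulation: `a[e] := f` for `x = 0, …, b - 1`. -/
def tab (R a x b : ℕ) (e f : Ex) : Program := forLoop R x b (assignArr R a e f)

/-- The state after `i` steps of a tabulation of `v` from cell `base` on. -/
def tabState (σ : Memory) (a x base : ℕ) (v : ℕ → ℤ) (i : ℕ) : Memory where
  var := Function.update σ.var x i
  arr := Function.update σ.arr a
    fun t => if base ≤ t ∧ t < base + i then v (t - base) else σ.arr a t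

theorem tabState_arr_ne {σ : Memory} {a a' x base : ℕ} {v : ℕ → ℤ} {i : ℕ} (h : a' ≠ a) :
    (tabState σ a x base v i).arr a' = σ.arr a' := by
  simp [tabState, h]

theorem tabState_arr_self {σ : Memory} {a x base : ℕ} {v : ℕ → ℤ} {i t : ℕ} :
    (tabState σ a x base v i).arr a t =
      if base ≤ t ∧ t < base + i then v (t - base) else σ.arr a t := by
  simp [tabState]

theorem tabState_var {σ : Memory} {a x base : ℕ} {v : ℕ → ℤ} {i y : ℕ} :
    (tabState σ a x base v i).var y = if y = x then (i : ℤ) else σ.var y := by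
  simp [tabState, Function.update_apply]

theorem Bounded.tabState {X : ℕ} {σ : Memory} (h : Bounded X σ) {a x base : ℕ} {v : ℕ → ℤ} {i : ℕ}
    (hx : 10 ≤ x) (hi : len (i : ℤ) ≤ X) (hv : ∀ j < i, len (v j) ≤ X) :
    Bounded X (tabState σ a x base v i) := by
  refine ⟨h.two_le, fun y => ?_, fun a' t => ?_, fun y hy => ?_⟩
  · rw [tabState_var]; split_ifs
    exacts [hi, h.var y]
  · by_cases ha : a' = a
    · subst ha
      rw [tabState_arr_self]; split_ifs with ht
      exacts [hv _ (by omega), h.arr _ _]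
    · rw [tabState_arr_ne ha]; exact h.arr _ _
  · rw [tabState_var, if_neg (by omega)]; exact h.small y hy

/-- Index and entry are evaluated while the table is partially filled, hence the states `tabState σ
a x base v i` in `he` and `hf`. -/
theorem Wp.tab {R : ℕ} {low : ℕ → ℤ} {X : ℕ} {σ : Memory} (hσ : Bounded X σ) {a x b : ℕ}
    {e f : Ex} (n base : ℕ) (v : ℕ → ℤ) (hx : 10 ≤ x) (hxb : b ≠ x) (hb : σ.var b = n)
    (he : ∀ i < n, e.val (tabState σ a x base v i) = base + i)
    (hf : ∀ i < n, f.val (tabState σ a x base v i) = v i) (hv : ∀ i < n, len (v i) ≤ X) :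
    Wp R low (tab R a x b e f) (n * X ^ (e.deg + f.deg + 7) + X ^ 4) σ
      (· = tabState σ a x base v n) := by
  have hX := hσ.two_le
  have hn : len (n : ℤ) ≤ X := by rw [← hb]; exact hσ.var b
  have h := Wp.forLoop (R := R) (low := low) (x := x) (b := b) (c := RAM.assignArr R a e f) n
    (fun i τ => τ = tabState σ a x base v i) (fun _ => X ^ (e.deg + f.deg + 3)) hX hn hxb hb
    (by
      ext y t
      · simp [setVar_var, tabState_var]
      · by_cases hy : y = a
        · subst hy; simp [setVar_arr, tabState_arr_self]
        · simp [setVar_arr, tabState_arr_ne hy])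
    (fun i hi τ h1 h2 h3 => by
      subst h3
      have hB : Bounded X (tabState σ a x base v i) :=
        hσ.tabState hx ((len_le_of_natAbs_le (by simpa using hi.le)).trans hn)
          fun j hj => hv j (by omega)
      refine (Wp.assignArr hB a e f).mono le_rfl ?_
      rintro _ rfl
      refine ⟨h1, h2, ?_⟩
      rw [he i hi, hf i hi]
      ext y t
      · simp only [setVar_var, tabState_var, Memory.setArr]
        split_ifs <;> simp
      · by_cases hy : y = a
        · subst hy
          simp only [setVar_arr, Memory.setArr, Function.update_self, tabState_arr_self,
            Function.update_apply]
          by_cases ht : t = base + i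
          · rw [if_pos (by omega), if_pos (by omega), ht]; congr 1; omega
          · rw [if_neg (by omega)]
            by_cases h : base ≤ t ∧ t < base + i
            · rw [if_pos h, if_pos (by omega)]
            · rw [if_neg h, if_neg (by omega)]
        · simp [setVar_arr, Memory.setArr, tabState_arr_ne hy, hy])
  refine h.mono ?_ fun τ h => h.2.2
  have h1 := eight_mul_pow_le (a := 1) hX
  have h2 : 8 * X ^ (e.deg + f.deg + 4) ≤ X ^ (e.deg + f.deg + 7) := eight_mul_pow_le hX
  have h3 := pow_le_of_le hX (show e.deg + f.deg + 3 ≤ e.deg + f.deg + 4 by omega)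
  have h4 := pow_le_of_le hX (show 4 ≤ e.deg + f.deg + 4 by omega)
  rw [Finset.sum_const, Finset.card_range, smul_eq_mul]
  simp only [pow_one, Nat.reduceAdd] at h1
  gcongr
  omega

/-! ## Running a program inside another one -/

/-- A bound for the names of the variables and arrays of a program. -/
def Program.names : Program → ℕ
  | .const x _ => x + 1
  | .arith _ x y z => x + y + z + 1
  | .load x a y => x + a + y + 1
  | .store a x y => a + x + y + 1
  | .seq c d => c.names + d.names
  | .ite x c d => x + 1 + c.names + d.names
  | .loop x c => x + 1 + c.names

/-- Two memories agree on the variables and arrays with names below `R`. -/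
def AgreeBelow (R : ℕ) (s s' : Memory) : Prop :=
  (∀ x < R, s.var x = s'.var x) ∧ ∀ a < R, s.arr a = s'.arr a

theorem AgreeBelow.setVar {R : ℕ} {s s' : Memory} (h : AgreeBelow R s s') (x : ℕ) (v : ℤ) :
    AgreeBelow R (s.setVar x v) (s'.setVar x v) := by
  refine ⟨fun y hy => ?_, h.2⟩
  rw [setVar_var, setVar_var, h.1 y hy]

theorem AgreeBelow.setArr {R : ℕ} {s s' : Memory} (h : AgreeBelow R s s') {a : ℕ} (ha : a < R)
    (i : ℕ) (v : ℤ) : AgreeBelow R (s.setArr a i v) (s'.setArr a i v) := by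
  refine ⟨h.1, fun b hb => ?_⟩
  simp only [Memory.setArr, Function.update_apply, h.2 a ha]
  split_ifs
  exacts [rfl, h.2 b hb]

/-- Two memories agree on the variables and arrays with names from `R` on. -/
def AgreeAbove (R : ℕ) (s s' : Memory) : Prop :=
  (∀ x, R ≤ x → s.var x = s'.var x) ∧ ∀ a, R ≤ a → s.arr a = s'.arr a

theorem AgreeAbove.trans {R : ℕ} {s s' s'' : Memory} (h : AgreeAbove R s s')
    (h' : AgreeAbove R s' s'') : AgreeAbove R s s'' :=
  ⟨fun x hx => (h.1 x hx).trans (h'.1 x hx), fun a ha => (h.2 a ha).trans (h'.2 a ha)⟩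

theorem AgreeAbove.refl {R : ℕ} {s : Memory} : AgreeAbove R s s :=
  ⟨fun _ _ => rfl, fun _ _ => rfl⟩

theorem agreeAbove_setVar {R : ℕ} {s : Memory} {x : ℕ} (hx : x < R) (v : ℤ) :
    AgreeAbove R (s.setVar x v) s :=
  ⟨fun y hy => by rw [setVar_var, if_neg (by omega)], fun _ _ => rfl⟩

/-- A program touches only the names in its text. Hence an arbitrary program can be run, at
unchanged cost, as a subroutine of a program whose own variables and arrays have names from `R` on.
-/
theorem exec_of_agreeBelow {R : ℕ} {c : Program} {s s' : Memory} {t : ℕ} (h : Exec c s s' t) :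
    c.names ≤ R → ∀ r, AgreeBelow R s r →
      ∃ r', Exec c r r' t ∧ AgreeBelow R s' r' ∧ AgreeAbove R r' r := by
  induction h with
  | const x c s =>
    intro hR r hr
    simp only [Program.names] at hR
    exact ⟨_, .const _ _ _, hr.setVar _ _, agreeAbove_setVar (by omega) _⟩
  | arith o x y z s =>
    intro hR r hr
    simp only [Program.names] at hR
    rw [hr.1 y (by omega), hr.1 z (by omega)]
    exact ⟨_, .arith _ _ _ _ _, hr.setVar _ _, agreeAbove_setVar (by omega) _⟩
  | load x a y s =>
    intro hR r hr
    simp only [Program.names] at hR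
    rw [hr.1 y (by omega), hr.2 a (by omega)]
    exact ⟨_, .load _ _ _ _, hr.setVar _ _, agreeAbove_setVar (by omega) _⟩
  | store a x y s =>
    intro hR r hr
    simp only [Program.names] at hR
    rw [hr.1 x (by omega), hr.1 y (by omega)]
    refine ⟨_, .store _ _ _ _, hr.setArr (by omega) _ _, fun _ _ => rfl, fun b hb => ?_⟩
    simp only [Memory.setArr]
    rw [Function.update_of_ne (by omega)]
  | seq h₁ h₂ ih₁ ih₂ =>
    intro hR r hr
    simp only [Program.names] at hR
    obtain ⟨r₁, he₁, hb₁, ha₁⟩ := ih₁ (by omega) r hr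
    obtain ⟨r₂, he₂, hb₂, ha₂⟩ := ih₂ (by omega) r₁ hb₁
    exact ⟨r₂, he₁.seq he₂, hb₂, ha₂.trans ha₁⟩
  | ite_pos hx h ih =>
    intro hR r hr
    simp only [Program.names] at hR
    obtain ⟨r₁, he₁, hb₁, ha₁⟩ := ih (by omega) r hr
    rw [hr.1 _ (by omega)] at hx ⊢
    exact ⟨r₁, he₁.ite_pos hx, hb₁, ha₁⟩
  | ite_neg hx h ih =>
    intro hR r hr
    simp only [Program.names] at hR
    obtain ⟨r₁, he₁, hb₁, ha₁⟩ := ih (by omega) r hr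
    rw [hr.1 _ (by omega)] at hx ⊢
    exact ⟨r₁, he₁.ite_neg hx, hb₁, ha₁⟩
  | loop_pos hx h₁ h₂ ih₁ ih₂ =>
    intro hR r hr
    have hR' := hR
    simp only [Program.names] at hR
    obtain ⟨r₁, he₁, hb₁, ha₁⟩ := ih₁ (by omega) r hr
    obtain ⟨r₂, he₂, hb₂, ha₂⟩ := ih₂ hR' r₁ hb₁
    rw [hr.1 _ (by omega)] at hx ⊢
    exact ⟨r₂, he₁.loop_pos hx he₂, hb₂, ha₂.trans ha₁⟩
  | loop_neg hx =>
    intro hR r hr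
    simp only [Program.names] at hR
    rw [hr.1 _ (by omega)] at hx ⊢
    exact ⟨r, .loop_neg hx, hr, .refl⟩

/-- The bit lengths of the contents of array cells grow in total by at most the cost of the run. -/
theorem sum_len_le_of_exec {c : Program} {s s' : Memory} {t : ℕ} (h : Exec c s s' t) (a : ℕ)
    (J : Finset ℕ) : ∑ j ∈ J, len (s'.arr a j) ≤ ∑ j ∈ J, len (s.arr a j) + t := by
  induction h with
  | const x c s => exact Nat.le_add_right _ _
  | arith o x y z s => exact Nat.le_add_right _ _
  | load x a y s => exact Nat.le_add_right _ _
  | store b x y s =>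
    -- A store changes a single cell, and the length of the new content is part of its cost.
    have : ∀ j ∈ J, len ((s.setArr b (s.var x).toNat (s.var y)).arr a j) ≤
        len (s.arr a j) + if j = (s.var x).toNat then len (s.var y) else 0 := by
      intro j _
      simp only [Memory.setArr, Function.update_apply]
      by_cases hab : a = b
      · subst hab
        simp only [if_true, Function.update_apply]
        split_ifs <;> omega
      · simp [hab]
    refine (Finset.sum_le_sum this).trans ?_
    rw [Finset.sum_add_distrib, Finset.sum_ite_eq']
    split_ifs <;> omega
  | seq h₁ h₂ ih₁ ih₂ => omega
  | ite_pos hx h ih => omega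
  | ite_neg hx h ih => omega
  | loop_pos hx h₁ h₂ ih₁ ih₂ => omega
  | loop_neg hx => omega

end RAM

/-! ## Sparsification of set families -/

namespace Sparsification

open Finset

/-- The members of size `c` of the family `F` that contain `J`. -/
def flower (F : Finset (Finset ℕ)) (c : ℕ) (J : Finset ℕ) : Finset (Finset ℕ) :=
  F.filter fun Z => #Z = c ∧ J ⊆ Z

/-- The set `H` is the heart of a large flower with members of size `c`. -/
def Heavy (γ : ℕ) (F : Finset (Finset ℕ)) (c : ℕ) (H : Finset ℕ) : Prop :=
  1 ≤ #H ∧ #H < c ∧ γ ^ (c - #H) ≤ #(flower F c H)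

/-- The inclusion-minimal members of a family. -/
def minimals (F : Finset (Finset ℕ)) : Finset (Finset ℕ) :=
  F.filter fun Z => ∀ Y ∈ F, Y ⊆ Z → Y = Z

/-- The petals of the flower with heart `H`. -/
def petals (F : Finset (Finset ℕ)) (c : ℕ) (H : Finset ℕ) : Finset (Finset ℕ) :=
  (flower F c H).image (· \ H)

/-- The flower with heart `H` has the smallest member size `c`, and among these the largest
heart. -/
structure IsBest (γ : ℕ) (F : Finset (Finset ℕ)) (c : ℕ) (H : Finset ℕ) : Prop where
  heavy : Heavy γ F c H
  not_heavy_of_lt : ∀ c' < c, ∀ H', ¬ Heavy γ F c' H'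
  not_heavy_of_card_lt : ∀ H', #H < #H' → ¬ Heavy γ F c H'

/-- The invariant of the sparsification: an antichain of sets of size at most `k`, in which the
levels below `κ` have small degrees. -/
structure Inv (γ k V : ℕ) (F : Finset (Finset ℕ)) (κ : ℕ) : Prop where
  antichain : ∀ Z ∈ F, ∀ Y ∈ F, Y ⊆ Z → Y = Z
  subset : ∀ Z ∈ F, Z ⊆ range V
  card_le : ∀ Z ∈ F, #Z ≤ k
  le : κ ≤ k
  degree : ∀ c < κ, ∀ J : Finset ℕ, 1 ≤ #J → #J < c → #(flower F c J) ≤ 2 * γ ^ (c - #J)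

theorem Inv.mem {γ k V κ : ℕ} {F : Finset (Finset ℕ)} (h : Inv γ k V F κ) :
    ∀ Z ∈ F, Z ⊆ range V ∧ #Z ≤ k :=
  fun Z hZ => ⟨h.subset Z hZ, h.card_le Z hZ⟩

/-- The potential: a weighted count of the members of the levels below `κ`. -/
def potential (γ k : ℕ) (F : Finset (Finset ℕ)) (κ : ℕ) : ℕ :=
  ∑ c ∈ Ico 1 κ, (4 * γ) ^ (k - c) * #(flower F c ∅)

theorem exists_minimals_subset {F : Finset (Finset ℕ)} {Z : Finset ℕ} (hZ : Z ∈ F) :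
    ∃ Y ∈ minimals F, Y ⊆ Z := by
  obtain ⟨Y, hY, hmin⟩ := exists_min_image (F.filter (· ⊆ Z)) card ⟨Z, by simp [hZ]⟩
  rw [mem_filter] at hY
  refine ⟨Y, mem_filter.2 ⟨hY.1, fun W hW hWY => ?_⟩, hY.2⟩
  exact eq_of_subset_of_card_le hWY (hmin W (mem_filter.2 ⟨hW, hWY.trans hY.2⟩))

theorem minimals_antichain (F : Finset (Finset ℕ)) :
    ∀ Z ∈ minimals F, ∀ Y ∈ minimals F, Y ⊆ Z → Y = Z := by
  intro Z hZ Y hY h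
  exact (mem_filter.1 hZ).2 Y (mem_filter.1 hY).1 h

theorem minimals_subset (F : Finset (Finset ℕ)) : minimals F ⊆ F := filter_subset _ _

/-- The sets `X` of size `i` in `N` are new: none contains a member of `F`. -/
structure IsNew (F N : Finset (Finset ℕ)) (i : ℕ) : Prop where
  card : ∀ X ∈ N, #X = i
  not_subset : ∀ X ∈ N, ∀ Y ∈ F, ¬ Y ⊆ X

/-- The new sets have equal size and contain no old member, so all of them stay minimal; only old
members above a new set are lost. -/
theorem mem_minimals_union {F N : Finset (Finset ℕ)} {i : ℕ}
    (hF : ∀ Z ∈ F, ∀ Y ∈ F, Y ⊆ Z → Y = Z) (hN : IsNew F N i) {Z : Finset ℕ} :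
    Z ∈ minimals (F ∪ N) ↔ (Z ∈ F ∧ ∀ X ∈ N, ¬ X ⊆ Z) ∨ Z ∈ N := by
  simp only [minimals, mem_filter, mem_union]
  constructor
  · rintro ⟨h | h, hmin⟩
    · refine or_iff_not_imp_right.2 fun hZN => ⟨h, fun X hX hXZ => hZN ?_⟩
      rwa [← hmin X (Or.inr hX) hXZ]
    · exact Or.inr h
  · rintro (⟨hZ, h⟩ | hZ)
    · refine ⟨Or.inl hZ, ?_⟩
      rintro Y (hY | hY) hYZ
      · exact hF Z hZ Y hY hYZ
      · exact absurd hYZ (h Y hY)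
    · refine ⟨Or.inr hZ, ?_⟩
      rintro Y (hY | hY) hYZ
      · exact absurd hYZ (hN.not_subset Z hZ Y hY)
      · exact eq_of_subset_of_card_le hYZ (by rw [hN.card Z hZ, hN.card Y hY])

theorem star_minimals_union_subset {F N : Finset (Finset ℕ)} {i : ℕ}
    (hF : ∀ Z ∈ F, ∀ Y ∈ F, Y ⊆ Z → Y = Z) (hN : IsNew F N i) (c : ℕ) (J : Finset ℕ) :
    flower (minimals (F ∪ N)) c J ⊆
      flower F c J ∪ if c = i then N.filter (J ⊆ ·) else ∅ := by
  intro Z hZ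
  rw [flower, mem_filter, mem_minimals_union hF hN] at hZ
  obtain ⟨⟨hZ, -⟩ | hZ, hc, hJ⟩ := hZ
  · exact mem_union_left _ (mem_filter.2 ⟨hZ, hc, hJ⟩)
  · rw [if_pos (by rw [← hc, hN.card Z hZ])]
    exact mem_union_right _ (mem_filter.2 ⟨hZ, hJ⟩)

/-- A set of size below `i` cannot contain a new set, so these levels lose nothing. The next two
lemmas treat level `i`, where all of `N` is gained, and an upper estimate for losses at any level.
-/
theorem card_star_le_of_lt {F N : Finset (Finset ℕ)} {i : ℕ}
    (hF : ∀ Z ∈ F, ∀ Y ∈ F, Y ⊆ Z → Y = Z) (hN : IsNew F N i) {c : ℕ} (hc : c < i) :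
    #(flower F c ∅) ≤ #(flower (minimals (F ∪ N)) c ∅) := by
  refine card_le_card fun Z hZ => ?_
  rw [flower, mem_filter] at hZ ⊢
  refine ⟨(mem_minimals_union hF hN).2 (Or.inl ⟨hZ.1, fun X hX hXZ => ?_⟩), hZ.2⟩
  have := card_le_card hXZ
  rw [hN.card X hX, hZ.2.1] at this
  omega

theorem card_star_add_card_le {F N : Finset (Finset ℕ)} {i : ℕ}
    (hF : ∀ Z ∈ F, ∀ Y ∈ F, Y ⊆ Z → Y = Z) (hN : IsNew F N i) :
    #(flower F i ∅) + #N ≤ #(flower (minimals (F ∪ N)) i ∅) := by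
  rw [← card_union_of_disjoint]
  · refine card_le_card fun Z hZ => ?_
    rw [flower, mem_filter]
    rcases mem_union.1 hZ with hZ | hZ
    · rw [flower, mem_filter] at hZ
      refine ⟨(mem_minimals_union hF hN).2 (Or.inl ⟨hZ.1, fun X hX hXZ => ?_⟩), hZ.2⟩
      have := eq_of_subset_of_card_le hXZ (by rw [hN.card X hX, hZ.2.1])
      exact hN.not_subset X hX Z hZ.1 this.ge
    · exact ⟨(mem_minimals_union hF hN).2 (Or.inr hZ), hN.card Z hZ, empty_subset _⟩
  · rw [disjoint_left]
    intro Z hZ hZN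
    exact hN.not_subset Z hZN Z (mem_filter.1 hZ).1 Subset.rfl

theorem card_star_le_add {F N : Finset (Finset ℕ)} {i : ℕ}
    (hF : ∀ Z ∈ F, ∀ Y ∈ F, Y ⊆ Z → Y = Z) (hN : IsNew F N i) {c d : ℕ}
    (hd : ∀ X ∈ N, #(flower F c X) ≤ d) :
    #(flower F c ∅) ≤ #(flower (minimals (F ∪ N)) c ∅) + #N * d := by
  have h : flower F c ∅ ⊆ flower (minimals (F ∪ N)) c ∅ ∪ N.biUnion (flower F c) := by
    intro Z hZ
    rw [flower, mem_filter] at hZ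
    by_cases h : ∃ X ∈ N, X ⊆ Z
    · obtain ⟨X, hX, hXZ⟩ := h
      exact mem_union_right _ (mem_biUnion.2 ⟨X, hX, mem_filter.2 ⟨hZ.1, hZ.2.1, hXZ⟩⟩)
    · push Not at h
      exact mem_union_left _ (mem_filter.2 ⟨(mem_minimals_union hF hN).2 (Or.inl ⟨hZ.1, h⟩), hZ.2⟩)
  refine (card_le_card h).trans ((card_union_le _ _).trans ?_)
  gcongr
  exact card_biUnion_le_card_mul _ _ _ hd

/-- A geometric series of ratio `1 / 4`: the summand at `c` is `2 * (4 γ) ^ (k - i) / 4 ^ (c - i)`,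
and the sum is at most two thirds of `(4 γ) ^ (k - i)`. The second summand on the left is the exact
remainder, which makes the identity inductive without division. -/
theorem sum_weight {γ k i κ : ℕ} (hi : i < κ) (hκ : κ ≤ k + 1) :
    3 * ∑ c ∈ Ico (i + 1) κ, (4 * γ) ^ (k - c) * (2 * γ ^ (c - i)) +
      2 * ((4 * γ) ^ (k - (κ - 1)) * γ ^ (κ - 1 - i)) = 2 * (4 * γ) ^ (k - i) := by
  induction κ, hi using Nat.le_induction with
  | base => simp
  | succ κ hκi ih =>
    rw [sum_Ico_succ_top (by omega), ← ih (by omega)]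
    have h1 : κ + 1 - 1 = κ := rfl
    have h2 : k - (κ - 1) = k - κ + 1 := by omega
    have h3 : κ - i = κ - 1 - i + 1 := by omega
    rw [h1, h2, h3]
    ring

/-- A new set of size `i` weighs `(4 γ) ^ (k - i)`. By the degree bounds it removes at most `2 γ ^
(c - i)` members of each higher level `c`, which by `sum_weight` weigh at most two thirds of that.
One third remains as net gain. -/
theorem potential_add_le {γ k V κ i : ℕ} {F N : Finset (Finset ℕ)} (hF : Inv γ k V F κ)
    (hN : IsNew F N i) (hi : 1 ≤ i) (hiκ : i < κ) :
    3 * potential γ k F κ + #N * (4 * γ) ^ (k - i) ≤ 3 * potential γ k (minimals (F ∪ N)) κ := by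
  have hκ := hF.le
  have hw := sum_weight (γ := γ) hiκ (show κ ≤ k + 1 by omega)
  have hsplit : ∀ f : ℕ → ℕ, ∑ c ∈ Ico 1 κ, f c =
      ∑ c ∈ Ico 1 i, f c + (f i + ∑ c ∈ Ico (i + 1) κ, f c) := by
    intro f
    rw [← sum_eq_sum_Ico_succ_bot hiκ, sum_Ico_consecutive _ hi hiκ.le]
  simp only [potential, hsplit]
  have h1 : ∑ c ∈ Ico 1 i, (4 * γ) ^ (k - c) * #(flower F c ∅) ≤
      ∑ c ∈ Ico 1 i, (4 * γ) ^ (k - c) * #(flower (minimals (F ∪ N)) c ∅) := by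
    refine sum_le_sum fun c hc => ?_
    exact Nat.mul_le_mul_left _ (card_star_le_of_lt hF.antichain hN (mem_Ico.1 hc).2)
  have h2 : (4 * γ) ^ (k - i) * #(flower F i ∅) + #N * (4 * γ) ^ (k - i) ≤
      (4 * γ) ^ (k - i) * #(flower (minimals (F ∪ N)) i ∅) := by
    rw [mul_comm #N, ← mul_add]
    gcongr
    exact card_star_add_card_le hF.antichain hN
  have h3 : ∑ c ∈ Ico (i + 1) κ, (4 * γ) ^ (k - c) * #(flower F c ∅) ≤
      ∑ c ∈ Ico (i + 1) κ, (4 * γ) ^ (k - c) * #(flower (minimals (F ∪ N)) c ∅) +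
      #N * ∑ c ∈ Ico (i + 1) κ, (4 * γ) ^ (k - c) * (2 * γ ^ (c - i)) := by
    rw [mul_sum, ← sum_add_distrib]
    refine sum_le_sum fun c hc => ?_
    rw [mem_Ico] at hc
    have := card_star_le_add hF.antichain hN (c := c) (d := 2 * γ ^ (c - i)) (by
      intro X hX
      have := hF.degree c hc.2 X (by rw [hN.card X hX]; exact hi) (by rw [hN.card X hX]; omega)
      rwa [hN.card X hX] at this)
    calc _ ≤ (4 * γ) ^ (k - c) * (#(flower (minimals (F ∪ N)) c ∅) + #N * (2 * γ ^ (c - i))) := by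
          gcongr
      _ = _ := by ring
  have h4 := Nat.mul_le_mul_left #N (Nat.le.intro hw)
  have h5 : #N * (2 * (4 * γ) ^ (k - i)) = 2 * (#N * (4 * γ) ^ (k - i)) := by ring
  have h6 : ∀ S, #N * (3 * S) = 3 * (#N * S) := fun S => by ring
  rw [h5, h6] at h4
  omega

theorem card_star_singleton_le {γ k V κ c : ℕ} {F : Finset (Finset ℕ)} (hF : Inv γ k V F κ)
    (h1 : 1 ≤ c) (hc : c < κ) (v : ℕ) : #(flower F c {v}) ≤ 2 * γ ^ (c - 1) := by
  rcases h1.eq_or_lt with rfl | h1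
  · have : flower F 1 {v} ⊆ {{v}} := by
      intro Z hZ
      rw [flower, mem_filter] at hZ
      exact mem_singleton.2 (eq_of_subset_of_card_le hZ.2.2 (by simp [hZ.2.1])).symm
    exact (card_le_card this).trans (by simp)
  · simpa using hF.degree c hc {v} (by simp) (by simpa using h1)

theorem star_subset_biUnion {V c : ℕ} {F : Finset (Finset ℕ)} (hF : ∀ Z ∈ F, Z ⊆ range V)
    (h1 : 1 ≤ c) : flower F c ∅ ⊆ (range V).biUnion fun v => flower F c {v} := by
  intro Z hZ
  rw [flower, mem_filter] at hZ
  obtain ⟨v, hv⟩ := card_pos.1 (show 0 < #Z by omega)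
  exact mem_biUnion.2 ⟨v, hF Z hZ.1 hv, mem_filter.2 ⟨hZ.1, hZ.2.1, by simpa using hv⟩⟩

/-- Level `c` has at most `V * 2 γ ^ (c - 1)` members, counted by their elements, each of weight `(4
γ) ^ (k - c)`. The total power of `γ` is thus `k - 1`, not `k`. This saved factor bounds the number
of petal steps, each worth `γ ^ k`, by `O(V * k * 4 ^ k / γ)`. -/
theorem potential_le {γ k V κ : ℕ} {F : Finset (Finset ℕ)} (hF : Inv γ k V F κ) :
    γ * potential γ k F κ ≤ 2 * V * k * 4 ^ k * γ ^ k := by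
  have hκ := hF.le
  have : ∀ c ∈ Ico 1 κ, γ * ((4 * γ) ^ (k - c) * #(flower F c ∅)) ≤ 2 * V * 4 ^ k * γ ^ k := by
    intro c hc
    rw [mem_Ico] at hc
    have h := (card_le_card (star_subset_biUnion hF.subset hc.1)).trans
      (card_biUnion_le_card_mul _ _ _ fun v _ => card_star_singleton_le hF hc.1 hc.2 v)
    rw [card_range] at h
    calc γ * ((4 * γ) ^ (k - c) * #(flower F c ∅))
        ≤ γ * ((4 * γ) ^ (k - c) * (V * (2 * γ ^ (c - 1)))) := by gcongr
      _ = 2 * V * 4 ^ (k - c) * γ ^ (1 + (k - c) + (c - 1)) := by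
        rw [mul_pow, pow_add, pow_add]; ring
      _ = 2 * V * 4 ^ (k - c) * γ ^ k := by congr 2; omega
      _ ≤ _ := by gcongr <;> omega
  rw [potential, mul_sum]
  refine (sum_le_card_nsmul _ _ _ this).trans ?_
  rw [Nat.card_Ico, smul_eq_mul]
  calc (κ - 1) * (2 * V * 4 ^ k * γ ^ k) ≤ k * (2 * V * 4 ^ k * γ ^ k) := by gcongr; omega
    _ = _ := by ring

/-- If not even one-element hearts are heavy, every element lies in at most `γ ^ k` members of each
size, so the family is linear in `V`. The `+ 1` is for a possible empty member. -/
theorem card_le_of_not_heavy {γ k V κ : ℕ} {F : Finset (Finset ℕ)} (hF : Inv γ k V F κ)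
    (hγ : 1 ≤ γ) (h : ∀ c H, ¬ Heavy γ F c H) : #F ≤ V * (k * γ ^ k) + 1 := by
  have hsub : F ⊆ ((range V).biUnion fun v => (Icc 1 k).biUnion fun c => flower F c {v}) ∪ {∅} := by
    intro Z hZ
    rcases Z.eq_empty_or_nonempty with rfl | ⟨v, hv⟩
    · simp
    · refine mem_union_left _ (mem_biUnion.2 ⟨v, hF.subset Z hZ hv, mem_biUnion.2 ⟨#Z, ?_, ?_⟩⟩)
      · exact mem_Icc.2 ⟨card_pos.2 ⟨v, hv⟩, hF.card_le Z hZ⟩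
      · exact mem_filter.2 ⟨hZ, rfl, by simpa using hv⟩
  have hdeg : ∀ v, ∀ c ∈ Icc 1 k, #(flower F c {v}) ≤ γ ^ k := by
    intro v c hc
    rw [mem_Icc] at hc
    rcases hc.1.eq_or_lt with rfl | h1
    · have : flower F 1 {v} ⊆ {{v}} := by
        intro Z hZ
        rw [flower, mem_filter] at hZ
        exact mem_singleton.2 (eq_of_subset_of_card_le hZ.2.2 (by simp [hZ.2.1])).symm
      exact (card_le_card this).trans (by simpa using Nat.one_le_pow _ _ hγ)
    · have := h c {v}
      simp only [Heavy, card_singleton, le_refl, h1, true_and, not_le] at this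
      exact this.le.trans (Nat.pow_le_pow_right hγ (by omega))
  refine (card_le_card hsub).trans ((card_union_le _ _).trans ?_)
  gcongr
  · refine (card_biUnion_le_card_mul _ _ _ fun v _ =>
      card_biUnion_le_card_mul _ _ _ (hdeg v)).trans ?_
    simp
  · simp

/-- Every member contains an element satisfying `x`. -/
def Hit (x : ℕ → Prop) (F : Finset (Finset ℕ)) : Prop := ∀ Z ∈ F, ∃ v ∈ Z, x v

theorem hit_minimals {x : ℕ → Prop} {F : Finset (Finset ℕ)} : Hit x (minimals F) ↔ Hit x F := by
  refine ⟨fun h Z hZ => ?_, fun h Z hZ => h Z (minimals_subset F hZ)⟩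
  obtain ⟨Y, hY, hYZ⟩ := exists_minimals_subset hZ
  obtain ⟨v, hv, hx⟩ := h Y hY
  exact ⟨v, hYZ hv, hx⟩

theorem hit_union {x : ℕ → Prop} {F N : Finset (Finset ℕ)} :
    Hit x (F ∪ N) ↔ Hit x F ∧ Hit x N := by
  simp only [Hit, mem_union, or_imp, forall_and]

/-- Completeness of the branching: an assignment that does not hit the heart hits every member
outside it. -/
theorem hit_petals {x : ℕ → Prop} {F : Finset (Finset ℕ)} {c : ℕ} {H : Finset ℕ} (hF : Hit x F)
    (hH : ∀ v ∈ H, ¬ x v) : Hit x (petals F c H) := by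
  intro Y hY
  obtain ⟨Z, hZ, rfl⟩ := mem_image.1 hY
  obtain ⟨v, hv, hx⟩ := hF Z (mem_filter.1 hZ).1
  exact ⟨v, mem_sdiff.2 ⟨hv, fun h => hH v h hx⟩, hx⟩

/-- Since `c` is the least size of a heavy flower, all levels below `c` satisfy the degree bound at
this moment, and the threshold can be raised to `c`. -/
theorem Inv.of_isBest {γ k V κ c : ℕ} {F : Finset (Finset ℕ)} {H : Finset ℕ}
    (hF : Inv γ k V F κ) (hγ : 1 ≤ γ) (hH : IsBest γ F c H) : Inv γ k V F (max κ c) := by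
  refine ⟨hF.antichain, hF.subset, hF.card_le, max_le hF.le ?_, fun c' hc' J h1 hJ => ?_⟩
  · have h := hH.heavy.2.2
    obtain ⟨Z, hZ⟩ := card_pos.1 ((Nat.one_le_pow _ _ hγ).trans h)
    rw [flower, mem_filter] at hZ
    rw [← hZ.2.1]
    exact hF.card_le Z hZ.1
  · by_cases h : c' < κ
    · exact hF.degree c' h J h1 hJ
    · have := hH.not_heavy_of_lt c' (by omega) J
      simp only [Heavy, h1, hJ, true_and, not_le] at this
      omega

theorem potential_mono {γ k κ κ' : ℕ} {F : Finset (Finset ℕ)} (h : κ ≤ κ') :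
    potential γ k F κ ≤ potential γ k F κ' :=
  sum_le_sum_of_subset (Ico_subset_Ico_right h)

/-- Only level `i < c` receives sets. There the old members contribute less than `γ ^ (i - #J)`,
because no flower below level `c` is heavy now, and the new ones at most as much. So the factor `2`
in `Inv.degree` does not accumulate from step to step. -/
theorem Inv.union {γ k V κ c i : ℕ} {F N : Finset (Finset ℕ)} {H : Finset ℕ}
    (hF : Inv γ k V F κ) (hγ : 1 ≤ γ) (hH : IsBest γ F c H) (hN : IsNew F N i) (hic : i < c)
    (hV : ∀ X ∈ N, X ⊆ range V)
    (hdeg : ∀ J : Finset ℕ, 1 ≤ #J → #J < i → #(N.filter (J ⊆ ·)) ≤ γ ^ (i - #J)) :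
    Inv γ k V (minimals (F ∪ N)) (max κ c) := by
  have hF' := hF.of_isBest hγ hH
  have hck : c ≤ k := (le_max_right _ _).trans hF'.le
  refine ⟨minimals_antichain _, fun Z hZ => ?_, fun Z hZ => ?_, hF'.le, fun c' hc' J h1 hJ => ?_⟩
  · rcases mem_union.1 (minimals_subset _ hZ) with h | h
    exacts [hF.subset Z h, hV Z h]
  · rcases mem_union.1 (minimals_subset _ hZ) with h | h
    exacts [hF.card_le Z h, by rw [hN.card Z h]; omega]
  · refine (card_le_card (star_minimals_union_subset hF.antichain hN c' J)).trans
      ((card_union_le _ _).trans ?_)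
    split_ifs with hci
    · subst hci
      have h2 := hH.not_heavy_of_lt c' hic J
      simp only [Heavy, h1, hJ, true_and, not_le] at h2
      have h3 := hdeg J h1 hJ
      omega
    · simpa using hF'.degree c' hc' J h1 hJ

theorem isNew_of_ssubset {F N : Finset (Finset ℕ)} {i : ℕ}
    (hF : ∀ Z ∈ F, ∀ Y ∈ F, Y ⊆ Z → Y = Z) (hc : ∀ X ∈ N, #X = i)
    (h : ∀ X ∈ N, ∃ Z ∈ F, X ⊂ Z) : IsNew F N i := by
  refine ⟨hc, fun X hX Y hY hYX => ?_⟩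
  obtain ⟨Z, hZ, hXZ⟩ := h X hX
  exact (hYX.trans_ssubset hXZ).ne (hF Z hZ Y hY (hYX.trans hXZ.1))

/-- Adding the heart of a best flower. -/
theorem Inv.heart {γ k V κ c : ℕ} {F : Finset (Finset ℕ)} {H : Finset ℕ}
    (hF : Inv γ k V F κ) (hγ : 1 ≤ γ) (hH : IsBest γ F c H) :
    Inv γ k V (minimals (F ∪ {H})) (max κ c) ∧
      potential γ k F κ + 1 ≤ potential γ k (minimals (F ∪ {H})) (max κ c) := by
  have hF' := hF.of_isBest hγ hH
  have hck : c ≤ k := (le_max_right _ _).trans hF'.le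
  obtain ⟨h1, h2, h3⟩ := hH.heavy
  obtain ⟨Z, hZ⟩ := card_pos.1 ((Nat.one_le_pow _ _ hγ).trans h3)
  rw [flower, mem_filter] at hZ
  have hHZ : H ⊂ Z := by
    refine hZ.2.2.ssubset_of_ne fun h => ?_
    rw [h, hZ.2.1] at h2
    exact h2.false
  have hN : IsNew F {H} #H := isNew_of_ssubset hF.antichain (by simp)
    (by simpa using ⟨Z, hZ.1, hHZ⟩)
  refine ⟨hF.union hγ hH hN h2 (by simpa using hHZ.1.trans (hF.subset Z hZ.1)) ?_, ?_⟩
  · intro J _ _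
    refine (card_filter_le _ _).trans ?_
    simpa using Nat.one_le_pow _ _ hγ
  · have h4 := potential_add_le hF' hN h1 (h2.trans_le (le_max_right _ _))
    -- As `#H < k`, the heart weighs at least `4 γ`, and a third of this exceeds `1`.
    have h5 : (4 * γ) ^ 1 ≤ (4 * γ) ^ (k - #H) := Nat.pow_le_pow_right (by omega) (by omega)
    have h6 : potential γ k F κ ≤ potential γ k F (max κ c) := potential_mono (le_max_left _ _)
    rw [card_singleton, one_mul] at h4
    rw [pow_one] at h5
    omega

theorem card_petals (F : Finset (Finset ℕ)) (c : ℕ) (H : Finset ℕ) :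
    #(petals F c H) = #(flower F c H) := by
  refine card_image_of_injOn fun Z hZ Y hY h => ?_
  simp only [flower, coe_filter, Set.mem_ofPred_eq] at hZ hY
  rw [← sdiff_union_of_subset hZ.2.2, ← sdiff_union_of_subset hY.2.2]
  exact congrArg (· ∪ H) h

/-- Adding the petals of a best flower. -/
theorem Inv.petals {γ k V κ c : ℕ} {F : Finset (Finset ℕ)} {H : Finset ℕ}
    (hF : Inv γ k V F κ) (hγ : 1 ≤ γ) (hH : IsBest γ F c H) :
    Inv γ k V (minimals (F ∪ petals F c H)) (max κ c) ∧
      potential γ k F κ + γ ^ k ≤ potential γ k (minimals (F ∪ petals F c H)) (max κ c) := by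
  have hF' := hF.of_isBest hγ hH
  have hck : c ≤ k := (le_max_right _ _).trans hF'.le
  obtain ⟨h1, h2, h3⟩ := hH.heavy
  have hmem : ∀ X ∈ Sparsification.petals F c H, ∃ Z ∈ F, #Z = c ∧ H ⊆ Z ∧ X = Z \ H := by
    intro X hX
    obtain ⟨Z, hZ, rfl⟩ := mem_image.1 hX
    rw [flower, mem_filter] at hZ
    exact ⟨Z, hZ.1, hZ.2.1, hZ.2.2, rfl⟩
  have hN : IsNew F (Sparsification.petals F c H) (c - #H) := by
    refine isNew_of_ssubset hF.antichain (fun X hX => ?_) (fun X hX => ?_)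
    · obtain ⟨Z, hZ, hc, hHZ, rfl⟩ := hmem X hX
      rw [card_sdiff_of_subset hHZ, hc]
    · obtain ⟨Z, hZ, hc, hHZ, rfl⟩ := hmem X hX
      exact ⟨Z, hZ, sdiff_ssubset hHZ (card_pos.1 h1)⟩
  refine ⟨hF.union hγ hH hN (by omega) ?_ ?_, ?_⟩
  · intro X hX
    obtain ⟨Z, hZ, hc, hHZ, rfl⟩ := hmem X hX
    exact sdiff_subset.trans (hF.subset Z hZ)
  · intro J hJ1 hJ
    -- If `J` is disjoint from `H`, petals above `J` come from members above `H ∪ J`, a larger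
    -- heart, which is not heavy by the choice of `H`. If `J` meets `H`, no petal contains it.
    by_cases hd : Disjoint J H
    · have hcard : #(H ∪ J) = #H + #J := card_union_of_disjoint hd.symm
      have h4 := hH.not_heavy_of_card_lt (H ∪ J) (by omega)
      simp only [Heavy, hcard, not_and, not_le] at h4
      have h5 := h4 (by omega) (by omega)
      have h6 : (Sparsification.petals F c H).filter (J ⊆ ·) ⊆
          (flower F c (H ∪ J)).image (· \ H) := by
        intro X hX
        rw [mem_filter] at hX
        obtain ⟨Z, hZ, hc, hHZ, rfl⟩ := hmem X hX.1
        exact mem_image.2 ⟨Z, mem_filter.2 ⟨hZ, hc, union_subset hHZ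
          (hX.2.trans sdiff_subset)⟩, rfl⟩
      have h7 := (card_le_card h6).trans card_image_le
      rw [show c - #H - #J = c - (#H + #J) by omega]
      omega
    · rw [filter_eq_empty_iff.2]
      · simp
      · intro X hX hJX
        obtain ⟨Z, hZ, hc, hHZ, rfl⟩ := hmem X hX
        exact hd (disjoint_of_subset_left hJX sdiff_disjoint)
  · have h4 := potential_add_le hF' hN (by omega) (lt_of_lt_of_le (by omega) (le_max_right _ _))
    rw [card_petals] at h4
    have h5 : γ ^ (c - #H) * (4 * γ) ^ (k - (c - #H)) ≤
        #(flower F c H) * (4 * γ) ^ (k - (c - #H)) := Nat.mul_le_mul_right _ h3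
    -- At least `γ ^ (c - #H)` petals of size `c - #H < k`: a total weight of at least `4 γ ^ k`, of
    -- which a third is gained.
    have h6 : γ ^ (c - #H) * (4 * γ) ^ (k - (c - #H)) = 4 ^ (k - (c - #H)) * γ ^ k := by
      rw [mul_pow, mul_left_comm, ← pow_add]
      congr 2; omega
    have h7 : 4 ^ 1 * γ ^ k ≤ 4 ^ (k - (c - #H)) * γ ^ k := by
      gcongr <;> omega
    have h8 : potential γ k F κ ≤ potential γ k F (max κ c) := potential_mono (le_max_left _ _)
    omega

/-! ### The branching process, driven by a number -/

/-- The update of the code: the digit `0` stands for petals and is removed; the digit `1` stands for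
a heart and is removed; larger digits stand for a heart and are decreased by `2`. -/
def nextCode (β n : ℕ) : ℕ := if n % β ≤ 1 then n / β else n - 2

/-- One step of the sparsification. -/
def step (β : ℕ) (pick : Finset (Finset ℕ) → Option (ℕ × Finset ℕ))
    (p : Finset (Finset ℕ) × ℕ) : Finset (Finset ℕ) × ℕ :=
  match pick p.1 with
  | none => p
  | some (c, H) =>
    (minimals (p.1 ∪ if p.2 % β = 0 then petals p.1 c H else {H}), nextCode β p.2)

/-- The function `pick` selects a best flower if there is a heavy one. -/
def IsPick (γ k V : ℕ) (pick : Finset (Finset ℕ) → Option (ℕ × Finset ℕ)) : Prop :=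
  ∀ F : Finset (Finset ℕ), (∀ Z ∈ F, Z ⊆ range V ∧ #Z ≤ k) →
    (pick F = none → ∀ c H, ¬ Heavy γ F c H) ∧ ∀ c H, pick F = some (c, H) → IsBest γ F c H

theorem step_of_none {β : ℕ} {pick : Finset (Finset ℕ) → Option (ℕ × Finset ℕ)}
    {p : Finset (Finset ℕ) × ℕ} (h : pick p.1 = none) : step β pick p = p := by
  simp [step, h]

theorem step_of_some {β : ℕ} {pick : Finset (Finset ℕ) → Option (ℕ × Finset ℕ)}
    {p : Finset (Finset ℕ) × ℕ} {c : ℕ} {H : Finset ℕ} (h : pick p.1 = some (c, H)) :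
    step β pick p =
      (minimals (p.1 ∪ if p.2 % β = 0 then petals p.1 c H else {H}), nextCode β p.2) := by
  simp [step, h]

theorem hit_of_hit_step {β : ℕ} {pick : Finset (Finset ℕ) → Option (ℕ × Finset ℕ)}
    {p : Finset (Finset ℕ) × ℕ} {x : ℕ → Prop} (h : Hit x (step β pick p).1) : Hit x p.1 := by
  cases hp : pick p.1 with
  | none => rwa [step_of_none hp] at h
  | some q =>
    obtain ⟨c, H⟩ := q
    rw [step_of_some hp, hit_minimals, hit_union] at h
    exact h.1

theorem hit_of_hit_iterate {β : ℕ} {pick : Finset (Finset ℕ) → Option (ℕ × Finset ℕ)}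
    {x : ℕ → Prop} (L : ℕ) : ∀ p : Finset (Finset ℕ) × ℕ,
    Hit x ((step β pick)^[L] p).1 → Hit x p.1 := by
  induction L with
  | zero => exact fun p h => h
  | succ L ih => exact fun p h => hit_of_hit_step (ih _ h)

theorem iterate_step_of_none {β : ℕ} {pick : Finset (Finset ℕ) → Option (ℕ × Finset ℕ)}
    {p : Finset (Finset ℕ) × ℕ} (h : pick p.1 = none) (L : ℕ) : (step β pick)^[L] p = p :=
  Function.iterate_fixed (step_of_none h) L

theorem Inv.step {γ k V κ β : ℕ} {pick : Finset (Finset ℕ) → Option (ℕ × Finset ℕ)}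
    (hγ : 1 ≤ γ) (hpick : IsPick γ k V pick) {p : Finset (Finset ℕ) × ℕ} (hF : Inv γ k V p.1 κ)
    (h : pick p.1 ≠ none) : ∃ κ', Inv γ k V (step β pick p).1 κ' ∧
      potential γ k p.1 κ + 1 ≤ potential γ k (Sparsification.step β pick p).1 κ' := by
  obtain ⟨⟨c, H⟩, hp⟩ := Option.ne_none_iff_exists'.1 h
  have hb := (hpick p.1 hF.mem).2 c H hp
  rw [step_of_some hp]
  split_ifs
  · obtain ⟨h1, h2⟩ := hF.petals hγ hb
    have := Nat.one_le_pow k _ hγ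
    exact ⟨_, h1, by simp only; omega⟩
  · exact ⟨_, hF.heart hγ hb⟩

/-- Every step before termination raises the potential, which never exceeds `B`. So the number of
steps is bounded whatever the code is, including codes that describe no sensible branch. -/
theorem exists_inv_iterate {γ k V β B : ℕ} {pick : Finset (Finset ℕ) → Option (ℕ × Finset ℕ)}
    (hγ : 1 ≤ γ) (hpick : IsPick γ k V pick)
    (hB : ∀ F κ, Inv γ k V F κ → potential γ k F κ ≤ B) (L : ℕ) :
    ∀ (p : Finset (Finset ℕ) × ℕ) (κ : ℕ), Inv γ k V p.1 κ →
      ∃ κ', Inv γ k V ((step β pick)^[L] p).1 κ' ∧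
        (B < potential γ k p.1 κ + L → pick ((step β pick)^[L] p).1 = none) := by
  induction L with
  | zero =>
    intro p κ hF
    exact ⟨κ, hF, fun h => absurd (hB _ _ hF) (by omega)⟩
  | succ L ih =>
    intro p κ hF
    by_cases h : pick p.1 = none
    · rw [iterate_step_of_none h]
      exact ⟨κ, hF, fun _ => h⟩
    · obtain ⟨κ₁, h1, h2⟩ := hF.step (β := β) hγ hpick h
      obtain ⟨κ₂, h3, h4⟩ := ih _ κ₁ h1
      exact ⟨κ₂, h3, fun h => h4 (by omega)⟩

/-- Every satisfying assignment survives the branching process for a suitable small code. -/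
theorem exists_code {γ k V B : ℕ} {pick : Finset (Finset ℕ) → Option (ℕ × Finset ℕ)}
    (hγ : 1 ≤ γ) (hpick : IsPick γ k V pick)
    (hB : ∀ F κ, Inv γ k V F κ → potential γ k F κ ≤ B) (x : ℕ → Prop) (n : ℕ) :
    ∀ (F : Finset (Finset ℕ)) (κ : ℕ), Inv γ k V F κ → Hit x F → B ≤ potential γ k F κ + n →
      ∃ s D, s < (2 * γ ^ k) ^ (D + 1) ∧
        D * γ ^ k + (s % (2 * γ ^ k)) / 2 + potential γ k F κ ≤ B ∧
        ∀ L, Hit x ((step (2 * γ ^ k) pick)^[L] (F, s)).1 := by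
  -- The code is built from the end of the branch backwards. In the accounting, each of the `D`
  -- completed digits is worth `γ ^ k` units of potential, and half the lowest digit counts the
  -- pending heart steps; the potential gained by the steps pays for both.
  set β := 2 * γ ^ k with hβ
  have hγk := Nat.one_le_pow k _ hγ
  induction n with
  | zero =>
    intro F κ hF hx hn
    have hnone : pick F = none := by
      by_contra h
      obtain ⟨κ', h1, h2⟩ := Inv.step (β := β) (p := (F, 0)) hγ hpick hF h
      have := hB _ _ h1
      simp only at h2
      omega
    refine ⟨0, 0, by simp; omega, by simpa using hB F κ hF, fun L => ?_⟩
    rwa [iterate_step_of_none (p := (F, 0)) hnone]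
  | succ n ih =>
    intro F κ hF hx hn
    cases hp : pick F with
    | none =>
      refine ⟨0, 0, by simp; omega, by simpa using hB F κ hF, fun L => ?_⟩
      rwa [iterate_step_of_none (p := (F, 0)) hp]
    | some q =>
      obtain ⟨c, H⟩ := q
      have hb := (hpick F hF.mem).2 c H hp
      by_cases hH : ∃ v ∈ H, x v
      · obtain ⟨h1, h2⟩ := hF.heart hγ hb
        obtain ⟨s, D, hs, hD, hL⟩ := ih (minimals (F ∪ {H})) _ h1
          (hit_minimals.2 (hit_union.2 ⟨hx, by simpa [Hit] using hH⟩)) (by omega)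
        have key : ∀ s', s' % β ≠ 0 → nextCode β s' = s →
            ∀ L, Hit x ((step β pick)^[L] (F, s')).1 := by
          intro s' h0 hs' L
          cases L with
          | zero => exact hx
          | succ L =>
            rw [Function.iterate_succ_apply, step_of_some (p := (F, s')) hp]
            simp only [h0, if_false, hs']
            exact hL L
        -- A heart step is recorded in the lowest digit while there is room. Steps of `2` preserve
        -- parity: an even digit runs down to `0` and ends with petals, an odd one runs down to `1`
        -- and ends with a heart.
        by_cases hc : s % β + 2 < β
        · have hmod : (s + 2) % β = s % β + 2 := by
            rw [Nat.add_mod, Nat.mod_eq_of_lt (show 2 < β by omega), Nat.mod_eq_of_lt hc]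
          refine ⟨s + 2, D, ?_, ?_, key _ (by omega) ?_⟩
          · have h5 := Nat.div_add_mod s β
            have h6 : s / β < β ^ D := Nat.div_lt_of_lt_mul (by rwa [pow_succ, mul_comm] at hs)
            have h7 : β * (s / β + 1) ≤ β * β ^ D := Nat.mul_le_mul_left _ h6
            rw [mul_add, mul_one] at h7
            rw [pow_succ, mul_comm]
            omega
          · rw [hmod]; omega
          · rw [nextCode, if_neg (by omega)]; omega
        · have h3 : s % β < β := Nat.mod_lt _ (by omega)
          -- The full digit already accounts for `γ ^ k - 1` heart steps; the present one completes
          -- the `γ ^ k` units that pay for a new digit.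
          refine ⟨1 + β * s, D + 1, ?_, ?_, key _ ?_ ?_⟩
          · rw [pow_succ β (D + 1), mul_comm _ β]
            have h7 : β * (s + 1) ≤ β * β ^ (D + 1) := Nat.mul_le_mul_left _ hs
            rw [mul_add, mul_one] at h7
            omega
          · rw [Nat.add_mul_mod_self_left, Nat.mod_eq_of_lt (by omega), add_mul]; omega
          · rw [Nat.add_mul_mod_self_left, Nat.mod_eq_of_lt (by omega)]; omega
          · rw [nextCode, Nat.add_mul_mod_self_left, Nat.mod_eq_of_lt (by omega), if_pos le_rfl,
              Nat.add_mul_div_left _ _ (by omega), Nat.div_eq_of_lt (by omega), zero_add]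
      · obtain ⟨h1, h2⟩ := hF.petals hγ hb
        push Not at hH
        obtain ⟨s, D, hs, hD, hL⟩ := ih (minimals (F ∪ petals F c H)) _ h1
          (hit_minimals.2 (hit_union.2 ⟨hx, hit_petals hx hH⟩)) (by omega)
        refine ⟨β * s, D + 1, ?_, ?_, fun L => ?_⟩
        · rw [pow_succ β (D + 1), mul_comm _ β]
          exact Nat.mul_lt_mul_of_pos_left hs (by omega)
        · rw [Nat.mul_mod_right, add_mul]; omega
        · cases L with
          | zero => exact hx
          | succ L =>
            rw [Function.iterate_succ_apply, step_of_some (p := (F, β * s)) hp]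
            simp only [Nat.mul_mod_right, if_true, nextCode, zero_le,
              Nat.mul_div_cancel_left _ (show 0 < β by omega)]
            exact hL L

end Sparsification

namespace RAM

open Finset

/-! ## Derived expressions -/

namespace Ex

/-- The truth value of `e < f`. -/
def lt (e f : Ex) : Ex := .cond (.bin .sub f e) (.c 1) (.c 0)
/-- Negation of a truth value. -/
def not (e : Ex) : Ex := .cond e (.c 0) (.c 1)
/-- Conjunction of truth values. -/
def and (e f : Ex) : Ex := .cond e f (.c 0)
/-- Disjunction of truth values. -/
def or (e f : Ex) : Ex := .cond e (.c 1) f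
/-- Implication of truth values. -/
def imp (e f : Ex) : Ex := .cond e f (.c 1)
/-- The truth value of `e = f`. -/
def eq (e f : Ex) : Ex := .not (.or (.lt e f) (.lt f e))
/-- The remainder. -/
def mod (e f : Ex) : Ex := .bin .sub e (.bin .mul f (.bin .div e f))
/-- Bounded sum. -/
def sum (x : ℕ) (b : Fin 10) (f : Ex) : Ex := .fold .add x b (.c 0) f
/-- Bounded power: `f` to the number of `i` below the bound with `i < e`. -/
def pow (x : ℕ) (b : Fin 10) (f e : Ex) : Ex := .fold .mul x b (.c 1) (.cond (.lt (.l x) e) f (.c 1))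
/-- Bounded existential quantifier. -/
def ex (x : ℕ) (b : Fin 10) (f : Ex) : Ex := .lt (.c 0) (.sum x b f)
/-- Bounded universal quantifier. -/
def all (x : ℕ) (b : Fin 10) (f : Ex) : Ex := .not (.ex x b (.not f))

end Ex

/-- The expression `e` has the truth value of `P`. -/
def Tr (G : ℕ → ℤ) (A : ℕ → ℕ → ℤ) (ρ : ℕ → ℤ) (e : Ex) (P : Prop) : Prop :=
  (P → e.eval G A ρ = 1) ∧ (¬ P → e.eval G A ρ = 0)

section Eval

variable {G : ℕ → ℤ} {A : ℕ → ℕ → ℤ} {ρ : ℕ → ℤ} {e f : Ex} {P Q : Prop}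

theorem Tr.iff (h : Tr G A ρ e P) (hPQ : P ↔ Q) : Tr G A ρ e Q := by rwa [← propext hPQ]

theorem Tr.pos_iff (h : Tr G A ρ e P) : 0 < e.eval G A ρ ↔ P := by
  by_cases hP : P
  · simp [hP, h.1 hP]
  · simp [hP, h.2 hP]

theorem Tr.eval_eq (h : Tr G A ρ e P) [Decidable P] : e.eval G A ρ = if P then 1 else 0 := by
  split_ifs with hP
  exacts [h.1 hP, h.2 hP]

theorem Tr.lt {x y : ℤ} (he : e.eval G A ρ = x) (hf : f.eval G A ρ = y) :
    Tr G A ρ (.lt e f) (x < y) := by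
  constructor <;> intro h <;> simp [Ex.lt, Ex.eval, Op.eval, he, hf] <;> omega

theorem Tr.not (he : Tr G A ρ e P) : Tr G A ρ (.not e) (¬ P) := by
  constructor <;> intro h <;> simp [Ex.not, Ex.eval, he.pos_iff, h]

/-- The second operand is evaluated lazily, so its correctness may presuppose the first; in
`Tr.entry`, for instance, a table entry is decoded only once it is known to be positive. -/
theorem Tr.and (he : Tr G A ρ e P) (hf : P → Tr G A ρ f Q) : Tr G A ρ (.and e f) (P ∧ Q) := by
  by_cases hP : P
  · simpa [Tr, Ex.and, Ex.eval, he.pos_iff, hP] using hf hP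
  · simp [Tr, Ex.and, Ex.eval, he.pos_iff, hP]

theorem Tr.or (he : Tr G A ρ e P) (hf : ¬ P → Tr G A ρ f Q) : Tr G A ρ (.or e f) (P ∨ Q) := by
  by_cases hP : P
  · simp [Tr, Ex.or, Ex.eval, he.pos_iff, hP]
  · simpa [Tr, Ex.or, Ex.eval, he.pos_iff, hP] using hf hP

theorem Tr.imp (he : Tr G A ρ e P) (hf : P → Tr G A ρ f Q) : Tr G A ρ (.imp e f) (P → Q) := by
  by_cases hP : P
  · simpa [Tr, Ex.imp, Ex.eval, he.pos_iff, hP] using hf hP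
  · simp [Tr, Ex.imp, Ex.eval, he.pos_iff, hP]

theorem Tr.eq {x y : ℤ} (he : e.eval G A ρ = x) (hf : f.eval G A ρ = y) :
    Tr G A ρ (.eq e f) (x = y) :=
  ((Tr.lt he hf).or fun _ => Tr.lt hf he).not.iff (by omega)

theorem Tr.eq_iff (he : Tr G A ρ e P) (hf : Tr G A ρ f Q) : Tr G A ρ (.eq e f) (P ↔ Q) := by
  classical
  refine (Tr.eq he.eval_eq hf.eval_eq).iff ?_
  by_cases hP : P <;> by_cases hQ : Q <;> simp [hP, hQ]

theorem Tr.cond {e₃ : Ex} {R : Prop} (he : Tr G A ρ e P) (hf : P → Tr G A ρ f R)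
    (hg : ¬ P → Tr G A ρ e₃ R) : Tr G A ρ (.cond e f e₃) R := by
  by_cases hP : P
  · simpa [Tr, Ex.eval, he.pos_iff, hP] using hf hP
  · simpa [Tr, Ex.eval, he.pos_iff, hP] using hg hP

theorem eval_mod {x y : ℕ} (he : e.eval G A ρ = x) (hf : f.eval G A ρ = y) :
    (Ex.mod e f).eval G A ρ = (x % y : ℕ) := by
  simp only [Ex.mod, Ex.eval, Op.eval, he, hf, Int.natCast_mod, Int.emod_def]

theorem eval_div {x y : ℕ} (he : e.eval G A ρ = x) (hf : f.eval G A ρ = y) :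
    (Ex.bin .div e f).eval G A ρ = (x / y : ℕ) := by
  simp only [Ex.eval, Op.eval, he, hf, Int.natCast_div]

theorem eval_sum {x n : ℕ} {b : Fin 10} (hb : G b = n) :
    (Ex.sum x b f).eval G A ρ = ∑ i ∈ range n, f.eval G A (Function.update ρ x (i : ℤ)) := by
  simp only [Ex.sum, Ex.eval, Op.eval, hb, Int.toNat_natCast]
  clear hb
  induction n with
  | zero => rfl
  | succ n ih => rw [sum_range_succ, ← ih]

theorem eval_pow {x n : ℕ} {b : Fin 10} {v : ℤ} {j : ℕ} (hb : G b = n) (hj : j ≤ n)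
    (hf : ∀ i < n, f.eval G A (Function.update ρ x (i : ℤ)) = v)
    (he : ∀ i < n, e.eval G A (Function.update ρ x (i : ℤ)) = j) :
    (Ex.pow x b f e).eval G A ρ = v ^ j := by
  have key : ∀ m ≤ n, (Nat.rec 1 (fun i w => w * (Ex.cond (.lt (.l x) e) f (.c 1)).eval G A
      (Function.update ρ x (i : ℤ))) m : ℤ) = v ^ min m j := by
    intro m hm
    induction m with
    | zero => simp
    | succ m ih =>
      have h : Tr G A (Function.update ρ x (m : ℤ)) (.lt (.l x) e) ((m : ℤ) < j) :=
        Tr.lt (by simp [Ex.eval]) (he m (by omega))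
      simp only
      rw [ih (by omega), Ex.eval]
      simp only [h.pos_iff, hf m (by omega), Nat.cast_lt, Ex.eval]
      split_ifs with hmj
      · rw [← pow_succ]; congr 1; omega
      · rw [mul_one]; congr 1; omega
  have := key n le_rfl
  simp only [Ex.pow, Ex.eval, Op.eval, hb, Int.toNat_natCast] at this ⊢
  rw [this, min_eq_right hj]

theorem eval_sum_tr {x n : ℕ} {b : Fin 10} {p : ℕ → Prop} [DecidablePred p] (hb : G b = n)
    (hf : ∀ i < n, Tr G A (Function.update ρ x (i : ℤ)) f (p i)) :
    (Ex.sum x b f).eval G A ρ = #((range n).filter p) := by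
  rw [eval_sum hb, card_filter, Nat.cast_sum]
  refine sum_congr rfl fun i hi => ?_
  rw [(hf i (mem_range.1 hi)).eval_eq]
  push_cast
  rfl

theorem Tr.ex {x n : ℕ} {b : Fin 10} {p : ℕ → Prop} (hb : G b = n)
    (hf : ∀ i < n, Tr G A (Function.update ρ x (i : ℤ)) f (p i)) :
    Tr G A ρ (.ex x b f) (∃ i < n, p i) := by
  classical
  refine (Tr.lt (x := 0) rfl (eval_sum_tr hb hf)).iff ?_
  rw [Nat.cast_pos, card_pos]
  simp [Finset.Nonempty]

theorem Tr.all {x n : ℕ} {b : Fin 10} {p : ℕ → Prop} (hb : G b = n)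
    (hf : ∀ i < n, Tr G A (Function.update ρ x (i : ℤ)) f (p i)) :
    Tr G A ρ (.all x b f) (∀ i < n, p i) :=
  (Tr.ex hb fun i hi => (hf i hi).not).not.iff (by push Not; rfl)

end Eval

/-! ## Clauses as numbers -/

/-- The set of the first `k` digits of `t` in base `V`. -/
def keySet (V k t : ℕ) : Finset ℕ := (range k).image fun q => t / V ^ q % V

/-- The number `t` is the least one with its set of digits. -/
def Canon (V k t : ℕ) : Prop := ∀ t' < t, keySet V k t' ≠ keySet V k t

theorem keySet_subset {V k t : ℕ} (ht : t < V ^ k) : keySet V k t ⊆ range V := by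
  intro v hv
  obtain ⟨q, hq, rfl⟩ := mem_image.1 hv
  rw [mem_range] at hq ⊢
  refine Nat.mod_lt _ (Nat.pos_of_ne_zero fun h => ?_)
  simp [h, show k ≠ 0 by omega] at ht

theorem card_keySet_le (V k t : ℕ) : #(keySet V k t) ≤ k :=
  card_image_le.trans (card_range k).le

theorem exists_canon {V k t : ℕ} (ht : t < V ^ k) :
    ∃ t' < V ^ k, Canon V k t' ∧ keySet V k t' = keySet V k t := by
  classical
  have h : ∃ t', keySet V k t' = keySet V k t := ⟨t, rfl⟩
  refine ⟨Nat.find h, (Nat.find_min' h rfl).trans_lt ht, fun t' ht' => ?_, Nat.find_spec h⟩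
  rw [Nat.find_spec h]
  exact Nat.find_min h ht'

theorem Canon.inj {V k t t' : ℕ} (h : Canon V k t) (h' : Canon V k t')
    (he : keySet V k t = keySet V k t') : t = t' := by
  rcases lt_trichotomy t t' with hlt | rfl | hlt
  exacts [absurd he (h' t hlt), rfl, absurd he.symm (h t' hlt)]

/-- Besides coding clauses, this is used with `V = 2` to pack the truth values of an assignment into
one number. -/
theorem exists_keySet_map {V k : ℕ} (f : ℕ → ℕ) (hf : ∀ q < k, f q < V) :
    ∃ t < V ^ k, ∀ q < k, t / V ^ q % V = f q := by
  induction k with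
  | zero => exact ⟨0, by simp, by simp⟩
  | succ k ih =>
    obtain ⟨t, ht, h⟩ := ih fun q hq => hf q (by omega)
    refine ⟨t + V ^ k * f k, ?_, fun q hq => ?_⟩
    · have h1 : V ^ k * (f k + 1) ≤ V ^ k * V := Nat.mul_le_mul_left _ (hf k (by omega))
      rw [pow_succ]; rw [mul_add, mul_one] at h1; omega
    · have hV : 0 < V := (Nat.zero_le _).trans_lt (hf q hq)
      rcases Nat.lt_succ_iff_lt_or_eq.1 hq with hq | rfl
      · rw [← h q hq, show V ^ k = V ^ q * (V * V ^ (k - q - 1)) by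
          rw [← pow_succ', ← pow_add]; congr 1; omega, mul_assoc, Nat.add_mul_div_left _ _
          (by positivity), mul_assoc, Nat.add_mul_mod_self_left]
      · rw [Nat.add_mul_div_left _ _ (by positivity), Nat.div_eq_of_lt ht, zero_add,
          Nat.mod_eq_of_lt (hf q (by omega))]

theorem exists_keySet_eq_image {V k : ℕ} (f : ℕ → ℕ) (hf : ∀ q < k, f q < V) :
    ∃ t < V ^ k, keySet V k t = (range k).image f := by
  obtain ⟨t, ht, h⟩ := exists_keySet_map f hf
  exact ⟨t, ht, image_congr fun q hq => h q (by simpa using hq)⟩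

theorem exists_keySet_eq {V k : ℕ} {Z : Finset ℕ} (hZ : Z ⊆ range V) (hk : #Z ≤ k)
    (h1 : 1 ≤ #Z) : ∃ t < V ^ k, keySet V k t = Z := by
  obtain ⟨v₀, hv₀⟩ := card_pos.1 h1
  -- When `Z` has fewer than `k` elements, the surplus digits repeat `v₀`; for this `Z` must be
  -- nonempty.
  set f : ℕ → ℕ := fun q => if h : q < #Z then Z.equivFin.symm ⟨q, h⟩ else v₀ with hf
  have hfZ : ∀ q, f q ∈ Z := by
    intro q; simp only [hf]; split_ifs
    exacts [Subtype.coe_prop _, hv₀]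
  obtain ⟨t, ht, h⟩ := exists_keySet_eq_image (V := V) (k := k) f
    fun q _ => mem_range.1 (hZ (hfZ q))
  refine ⟨t, ht, h.trans (Subset.antisymm (image_subset_iff.2 fun q _ => hfZ q) fun v hv => ?_)⟩
  refine mem_image.2 ⟨Z.equivFin ⟨v, hv⟩, mem_range.2 ((Fin.is_lt _).trans_le hk), ?_⟩
  simp [hf]

/-- The bitmap `B` encodes the family `F` of sets of digits. -/
structure Encodes (V k : ℕ) (B : ℕ → ℤ) (F : Finset (Finset ℕ)) : Prop where
  eq_one_iff : ∀ t < V ^ k, B t = 1 ↔ Canon V k t ∧ keySet V k t ∈ F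
  zero_or_one : ∀ t < V ^ k, B t = 0 ∨ B t = 1
  exists_key : ∀ Z ∈ F, ∃ t < V ^ k, keySet V k t = Z

theorem Encodes.exists_canon {V k : ℕ} {B : ℕ → ℤ} {F : Finset (Finset ℕ)} (h : Encodes V k B F)
    {Z : Finset ℕ} (hZ : Z ∈ F) : ∃ t < V ^ k, B t = 1 ∧ keySet V k t = Z := by
  obtain ⟨t, ht, rfl⟩ := h.exists_key Z hZ
  obtain ⟨t', ht', hc, he⟩ := RAM.exists_canon ht
  exact ⟨t', ht', (h.eq_one_iff t' ht').2 ⟨hc, he ▸ hZ⟩, he⟩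

/-- On canonical numbers `keySet` is injective, so counting marked cells counts sets. -/
theorem Encodes.card_filter {V k : ℕ} {B : ℕ → ℤ} {F : Finset (Finset ℕ)} (h : Encodes V k B F)
    (p : Finset ℕ → Prop) [DecidablePred p] :
    #((range (V ^ k)).filter fun t => B t = 1 ∧ p (keySet V k t)) = #(F.filter p) := by
  rw [← card_image_of_injOn (f := keySet V k)]
  · congr 1
    ext Z
    simp only [mem_image, mem_filter, mem_range]
    constructor
    · rintro ⟨t, ⟨ht, hB, hp⟩, rfl⟩
      exact ⟨((h.eq_one_iff t ht).1 hB).2, hp⟩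
    · rintro ⟨hZ, hp⟩
      obtain ⟨t, ht, hB, rfl⟩ := h.exists_canon hZ
      exact ⟨t, ⟨ht, hB, hp⟩, rfl⟩
  · intro t ht t' ht' he
    simp only [coe_filter, mem_range, Set.mem_ofPred_eq] at ht ht'
    exact ((h.eq_one_iff t ht.1).1 ht.2.1).1.inj ((h.eq_one_iff t' ht'.1).1 ht'.2.1).1 he

end RAM

namespace RAM

open Finset Sparsification

/-! ## Expressions for sets of digits -/

/-- The expression for digit `q` of `t` in base `V`. -/
def digitE (t q : ℕ) : Ex := .mod (.bin .div (.l t) (.pow (t + q + 1) 0 (.g 1) (.l q))) (.g 1)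
/-- The expression for `v ∈ keySet t`. -/
def memE (v t : ℕ) : Ex := .ex (v + t + 1) 0 (.eq (digitE t (v + t + 1)) (.l v))
/-- The expression for `keySet t ⊆ keySet t'`. -/
def subE (t t' : ℕ) : Ex := .all (t + t' + 1) 1 (.imp (memE (t + t' + 1) t) (memE (t + t' + 1) t'))
/-- The expression for `keySet t = keySet t'`. -/
def eqSetE (t t' : ℕ) : Ex := .and (subE t t') (subE t' t)
/-- The expression for the cardinality of `keySet t`. -/
def sizeE (t : ℕ) : Ex := .sum (t + 1) 1 (memE (t + 1) t)
/-- The expression for `Canon t`. -/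
def canonE (t : ℕ) : Ex :=
  .all (t + 1) 2 (.imp (.lt (.l (t + 1)) (.l t)) (.not (eqSetE (t + 1) t)))
/-- The expression for `keySet t` being a minimal member of the family of candidates, and `t` the
canonical number of this set. -/
def minimalE (cand : ℕ → Ex) (t : ℕ) : Ex :=
  .and (canonE t) (.and (cand t)
    (.all (t + 1) 2 (.imp (cand (t + 1)) (.imp (subE (t + 1) t) (subE t (t + 1))))))

/-- The global variables `0`, `1`, `2` hold `k`, `V`, `V ^ k`. -/
structure Ctx (G : ℕ → ℤ) (k V : ℕ) : Prop where
  k_eq : G 0 = k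
  V_eq : G 1 = V
  U_eq : G 2 = (V ^ k : ℕ)

theorem eval_l {G : ℕ → ℤ} {A : ℕ → ℕ → ℤ} {ρ : ℕ → ℤ} {x : ℕ} {v : ℤ} (h : ρ x = v) :
    (Ex.l x).eval G A ρ = v := h

theorem eval_g {G : ℕ → ℤ} {A : ℕ → ℕ → ℤ} {ρ : ℕ → ℤ} {x : ℕ} {v : ℤ} (h : G x = v) :
    (Ex.g x).eval G A ρ = v := h

theorem eval_l_self {G : ℕ → ℤ} {A : ℕ → ℕ → ℤ} {ρ : ℕ → ℤ} {x : ℕ} {v : ℤ} :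
    (Ex.l x).eval G A (Function.update ρ x v) = v := Function.update_self ..

theorem update_eq_of_ne {ρ : ℕ → ℤ} {x y : ℕ} {a v : ℤ} (h : ρ x = a) (hxy : x ≠ y) :
    Function.update ρ y v x = a := by
  rw [Function.update_of_ne hxy, h]

section

variable {G : ℕ → ℤ} {A : ℕ → ℕ → ℤ} {ρ : ℕ → ℤ} {k V : ℕ}

theorem eval_digit (hc : Ctx G k V) {t q T Q : ℕ} (ht : ρ t = T) (hq : ρ q = Q) (hQ : Q ≤ k) :
    (digitE t q).eval G A ρ = (T / V ^ Q % V : ℕ) := by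
  refine eval_mod (eval_div (eval_l ht) ?_) (eval_g hc.V_eq)
  rw [eval_pow (n := k) (j := Q) (v := V) hc.k_eq hQ (fun i _ => eval_g hc.V_eq)
    fun i _ => eval_l (update_eq_of_ne hq (by omega))]
  push_cast
  rfl

theorem Tr.mem (hc : Ctx G k V) {v t T W : ℕ} (ht : ρ t = T) (hv : ρ v = W) :
    Tr G A ρ (memE v t) (W ∈ keySet V k T) := by
  refine (Tr.ex (n := k) (p := fun q => T / V ^ q % V = W) hc.k_eq fun q hq =>
    (Tr.eq (eval_digit hc (update_eq_of_ne ht (by omega)) (Function.update_self ..) hq.le)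
      (eval_l (update_eq_of_ne hv (by omega)))).iff Nat.cast_inj).iff ?_
  simp [keySet]

theorem Tr.sub (hc : Ctx G k V) {t t' T T' : ℕ} (ht : ρ t = T) (ht' : ρ t' = T')
    (hT : T < V ^ k) : Tr G A ρ (subE t t') (keySet V k T ⊆ keySet V k T') := by
  refine (Tr.all (n := V) (p := fun v => v ∈ keySet V k T → v ∈ keySet V k T') hc.V_eq fun v hv =>
    (Tr.mem hc (update_eq_of_ne ht (by omega)) (Function.update_self ..)).imp fun _ =>
      Tr.mem hc (update_eq_of_ne ht' (by omega)) (Function.update_self ..)).iff ?_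
  exact ⟨fun h v hv => h v (mem_range.1 (keySet_subset hT hv)) hv, fun h v _ hv => h hv⟩

theorem Tr.eqSet (hc : Ctx G k V) {t t' T T' : ℕ} (ht : ρ t = T) (ht' : ρ t' = T')
    (hT : T < V ^ k) (hT' : T' < V ^ k) :
    Tr G A ρ (eqSetE t t') (keySet V k T = keySet V k T') :=
  ((Tr.sub hc ht ht' hT).and fun _ => Tr.sub hc ht' ht hT').iff
    Subset.antisymm_iff.symm

theorem eval_size (hc : Ctx G k V) {t T : ℕ} (ht : ρ t = T) (hT : T < V ^ k) :
    (sizeE t).eval G A ρ = #(keySet V k T) := by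
  rw [sizeE, eval_sum_tr (n := V) (p := (· ∈ keySet V k T)) hc.V_eq fun v _ =>
    Tr.mem hc (update_eq_of_ne ht (by omega)) (Function.update_self ..),
    filter_mem_eq_inter, inter_eq_right.2 (keySet_subset hT)]

theorem Tr.canon (hc : Ctx G k V) {t T : ℕ} (ht : ρ t = T) (hT : T < V ^ k) :
    Tr G A ρ (canonE t) (Canon V k T) := by
  refine (Tr.all (n := V ^ k) (p := fun t' => t' < T → keySet V k t' ≠ keySet V k T) hc.U_eq
    fun t' ht' => ((Tr.lt eval_l_self (eval_l (update_eq_of_ne ht (by omega)))).iff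
      Nat.cast_lt).imp fun _ => (Tr.eqSet hc (Function.update_self ..)
        (update_eq_of_ne ht (by omega)) ht' hT).not).iff ?_
  exact ⟨fun h t' ht' => h t' (ht'.trans hT) ht', fun h t' _ ht' => h t' ht'⟩

/-- A bitmap recognizes a set only by its canonical number, so `h2` asks completeness of `C` for
canonical numbers alone. This suffices, since every competitor for minimality has a canonical
number. -/
theorem Tr.minimal (hc : Ctx G k V) {cand : ℕ → Ex} {C : ℕ → Prop} {F : Finset (Finset ℕ)}
    (hcand : ∀ (x : ℕ) (ρ : ℕ → ℤ) (T : ℕ), ρ x = T → T < V ^ k → Tr G A ρ (cand x) (C T))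
    (h1 : ∀ t < V ^ k, C t → keySet V k t ∈ F)
    (h2 : ∀ t < V ^ k, Canon V k t → keySet V k t ∈ F → C t)
    (h3 : ∀ Z ∈ F, ∃ t < V ^ k, keySet V k t = Z) {t T : ℕ} (ht : ρ t = T) (hT : T < V ^ k) :
    Tr G A ρ (minimalE cand t) (Canon V k T ∧ keySet V k T ∈ minimals F) := by
  refine ((Tr.canon hc ht hT).and fun _ => (hcand t ρ T ht hT).and fun _ => Tr.all (n := V ^ k)
    (p := fun t' => C t' → keySet V k t' ⊆ keySet V k T → keySet V k T ⊆ keySet V k t') hc.U_eq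
    fun t' ht' => (hcand _ _ t' (Function.update_self ..) ht').imp fun _ =>
      (Tr.sub hc (Function.update_self ..) (update_eq_of_ne ht (by omega)) ht').imp fun _ =>
        Tr.sub hc (update_eq_of_ne ht (by omega)) (Function.update_self ..) hT).iff ?_
  rw [minimals, mem_filter]
  refine and_congr_right fun hcan => ⟨fun ⟨hC, h⟩ => ⟨h1 T hT hC, fun Y hY hYT => ?_⟩,
    fun ⟨hF, h⟩ => ⟨h2 T hT hcan hF, fun t' ht' hC hs => (h _ (h1 t' ht' hC) hs).ge⟩⟩
  obtain ⟨t', ht', rfl⟩ := h3 Y hY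
  obtain ⟨t₁, ht₁, hcan₁, he⟩ := RAM.exists_canon ht'
  rw [← he] at hYT hY ⊢
  exact Subset.antisymm hYT (h t₁ ht₁ (h2 t₁ ht₁ hcan₁ hY) hYT)

/-! ## Expressions for the selection of a flower -/

/-- The expression for number `p` describing a heavy flower of the family with bitmap `a`: the
heart has number `p % U`, and the size `c` of the members and the size `h` of the heart satisfy
`p / U = c (k + 1) + (k - h)`. -/
def heavyE (k γ a p : ℕ) : Ex :=
  .bind (p + 1) (.mod (.l p) (.g 2)) (.bind (p + 2) (.bin .div (.l p) (.g 2))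
    (.bind (p + 3) (.bin .div (.l (p + 2)) (.c (k + 1))) (.bind (p + 4) (sizeE (p + 1))
      (.and (.eq (.bin .add (.l (p + 4)) (.mod (.l (p + 2)) (.c (k + 1)))) (.g 0))
        (.and (.lt (.c 0) (.l (p + 4))) (.and (.lt (.l (p + 4)) (.l (p + 3)))
          (.not (.lt (.sum (p + 5) 2 (.and (.arr a (.l (p + 5)))
              (.and (.eq (sizeE (p + 5)) (.l (p + 3))) (subE (p + 1) (p + 5)))))
            (.pow (p + 5) 0 (.c γ) (.bin .sub (.l (p + 3)) (.l (p + 4)))))))))))) 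

/-- The number `p` describes the heavy flower with member size `c` and heart `H`. -/
def HeavyKey (k γ V : ℕ) (F : Finset (Finset ℕ)) (p : ℕ) : Prop :=
  #(keySet V k (p % V ^ k)) + p / V ^ k % (k + 1) = k ∧
    Heavy γ F (p / V ^ k / (k + 1)) (keySet V k (p % V ^ k))

theorem Tr.bitmap {B : ℕ → ℤ} {F : Finset (Finset ℕ)} {a : ℕ} (hB : Encodes V k B F)
    (hA : A a = B) {t T : ℕ} (ht : ρ t = T) (hT : T < V ^ k) :
    Tr G A ρ (.arr a (.l t)) (B T = 1) := by
  have : (Ex.arr a (.l t)).eval G A ρ = B T := by simp [Ex.eval, ht, hA]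
  refine ⟨fun h => this.trans h, fun h => this.trans ?_⟩
  exact (hB.zero_or_one T hT).resolve_right h

theorem Tr.heavy (hc : Ctx G k V) {γ a p P : ℕ} {B : ℕ → ℤ} {F : Finset (Finset ℕ)}
    (hB : Encodes V k B F) (hA : A a = B) (hp : ρ p = P) (hP : P < (k + 1) * (k + 1) * V ^ k) :
    Tr G A ρ (heavyE k γ a p) (HeavyKey k γ V F P) := by
  have hU : 0 < V ^ k := Nat.pos_of_ne_zero fun h => by simp [h] at hP
  have hT : P % V ^ k < V ^ k := Nat.mod_lt _ hU
  have hck : P / V ^ k / (k + 1) ≤ k := by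
    rw [← Nat.lt_succ_iff, Nat.div_lt_iff_lt_mul (by omega), Nat.div_lt_iff_lt_mul hU]
    exact hP
  have e1 : (Ex.mod (.l p) (.g 2)).eval G A ρ = (P % V ^ k : ℕ) := eval_mod (eval_l hp) (eval_g hc.U_eq)
  have e2 : ∀ z, (Ex.bin .div (.l p) (.g 2)).eval G A (Function.update ρ (p + 1) z) =
    (P / V ^ k : ℕ) := fun z => eval_div (eval_l (update_eq_of_ne hp (by omega))) (eval_g hc.U_eq)
  have hk1 : ∀ ρ : ℕ → ℤ, (Ex.c (k + 1)).eval G A ρ = (k + 1 : ℕ) := by simp [Ex.eval]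
  unfold heavyE Tr
  rw [Ex.eval, e1, Ex.eval, e2, Ex.eval, eval_div (x := P / V ^ k) (by simp [Ex.eval]) (hk1 _),
    Ex.eval, eval_size hc (T := P % V ^ k) (by
      rw [Function.update_of_ne (by omega), Function.update_of_ne (by omega),
        Function.update_self]) hT]
  set ρ' : ℕ → ℤ := Function.update (Function.update (Function.update (Function.update ρ (p + 1)
    ((P % V ^ k : ℕ) : ℤ)) (p + 2) ((P / V ^ k : ℕ) : ℤ)) (p + 3)
    ((P / V ^ k / (k + 1) : ℕ) : ℤ)) (p + 4) (#(keySet V k (P % V ^ k)) : ℤ) with hρ'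
  have r1 : ρ' (p + 1) = (P % V ^ k : ℕ) := by simp [hρ']
  have r2 : ρ' (p + 2) = (P / V ^ k : ℕ) := by simp [hρ']
  have r3 : ρ' (p + 3) = (P / V ^ k / (k + 1) : ℕ) := by simp [hρ']
  have r4 : ρ' (p + 4) = (#(keySet V k (P % V ^ k)) : ℕ) := by simp [hρ']
  clear_value ρ'
  classical
  refine Tr.iff (Tr.and (P := #(keySet V k (P % V ^ k)) + P / V ^ k % (k + 1) = k) ?_ fun hk =>
    Tr.and ((Tr.lt (x := 0) rfl (eval_l r4)).iff Nat.cast_pos) fun h1 =>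
      Tr.and ((Tr.lt (eval_l r4) (eval_l r3)).iff Nat.cast_lt) fun h2 => (Tr.lt
        (eval_sum_tr (n := V ^ k) (p := fun t => B t = 1 ∧ #(keySet V k t) = P / V ^ k / (k + 1) ∧
          keySet V k (P % V ^ k) ⊆ keySet V k t) hc.U_eq fun t ht => ?_)
        (eval_pow (n := k) (v := γ) (j := P / V ^ k / (k + 1) - #(keySet V k (P % V ^ k)))
          hc.k_eq (by omega) (fun _ _ => rfl) fun i _ => ?_)).not) ?_
  · refine (Tr.eq (x := (#(keySet V k (P % V ^ k)) + P / V ^ k % (k + 1) : ℕ)) ?_ (eval_g hc.k_eq)).iff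
      Nat.cast_inj
    rw [Ex.eval, eval_mod (x := P / V ^ k) (eval_l r2) (hk1 _)]
    simp [Ex.eval, r4, Op.eval]
  · exact (Tr.bitmap hB hA (Function.update_self ..) ht).and fun _ =>
      ((Tr.eq (eval_size hc (Function.update_self ..) ht)
        (eval_l (update_eq_of_ne r3 (by omega)))).iff Nat.cast_inj).and fun _ =>
      Tr.sub hc (update_eq_of_ne r1 (by omega)) (Function.update_self ..) hT
  · simp only [Ex.eval, Op.eval, Function.update_of_ne (show p + 3 ≠ p + 5 by omega),
      Function.update_of_ne (show p + 4 ≠ p + 5 by omega), r3, r4]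
    omega
  · rw [hB.card_filter (fun Z => #Z = P / V ^ k / (k + 1) ∧ keySet V k (P % V ^ k) ⊆ Z)]
    simp only [HeavyKey, Heavy, flower, not_lt]
    norm_cast

/-- The expression for the least number of a heavy flower, or the number of all numbers if there is
none. -/
def pickE (k γ a : ℕ) : Ex :=
  .sum 0 3 (.all 1 3 (.imp (.not (.lt (.l 0) (.l 1))) (.not (heavyE k γ a 1))))

/-- The sum counts the `p` such that no number up to `p` is heavy, and this count is the first heavy
number itself, or the total number if there is none. -/
theorem exists_eval_pick (hc : Ctx G k V) {γ a : ℕ} {B : ℕ → ℤ} {F : Finset (Finset ℕ)}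
    (hB : Encodes V k B F) (hA : A a = B) (hPP : G 3 = ((k + 1) * (k + 1) * V ^ k : ℕ)) :
    ∃ P : ℕ, (pickE k γ a).eval G A ρ = P ∧ P ≤ (k + 1) * (k + 1) * V ^ k ∧
      (∀ p < P, ¬ HeavyKey k γ V F p) ∧
      (P < (k + 1) * (k + 1) * V ^ k → HeavyKey k γ V F P) := by
  classical
  set N := (k + 1) * (k + 1) * V ^ k with hN
  have h := eval_sum_tr (A := A) (ρ := ρ) (x := 0) (b := 3) (f := .all 1 3
    (.imp (.not (.lt (.l 0) (.l 1))) (.not (heavyE k γ a 1)))) (n := N)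
    (p := fun p => ∀ p' < N, ¬ p < p' → ¬ HeavyKey k γ V F p') hPP fun p hp =>
    Tr.all (n := N) hPP fun p' hp' => ((Tr.lt (x := p) (y := p')
      (by simp [Ex.eval]) (by simp [Ex.eval])).iff Nat.cast_lt).not.imp
      fun _ => (Tr.heavy hc hB hA (Function.update_self ..) hp').not
  by_cases hex : ∃ p, p < N ∧ HeavyKey k γ V F p
  · refine ⟨Nat.find hex, h.trans ?_, (Nat.find_spec hex).1.le, fun p hp hk =>
      Nat.find_min hex hp ⟨hp.trans (Nat.find_spec hex).1, hk⟩, fun _ => (Nat.find_spec hex).2⟩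
    congr 1
    rw [← card_range (Nat.find hex)]
    congr 1
    ext p
    simp only [mem_filter, mem_range, not_lt]
    constructor
    · rintro ⟨hp, hall⟩
      by_contra hlt
      exact hall _ (Nat.find_spec hex).1 (by omega) (Nat.find_spec hex).2
    · intro hp
      refine ⟨hp.trans (Nat.find_spec hex).1, fun p' hp' hle hk => ?_⟩
      exact Nat.find_min hex (hle.trans_lt hp) ⟨hp', hk⟩
  · push Not at hex
    refine ⟨N, h.trans ?_, le_rfl, hex, fun h => absurd h (lt_irrefl _)⟩
    congr 1
    conv_rhs => rw [← card_range N]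
    congr 1
    exact filter_true_of_mem fun p _ p' hp' _ => hex p' hp'

/-- The flower selected by the program. -/
noncomputable def pick (k γ V : ℕ) (F : Finset (Finset ℕ)) : Option (ℕ × Finset ℕ) :=
  open Classical in
  if h : ∃ p, p < (k + 1) * (k + 1) * V ^ k ∧ HeavyKey k γ V F p then
    some (Nat.find h / V ^ k / (k + 1), keySet V k (Nat.find h % V ^ k))
  else none

theorem exists_heavyKey {γ c : ℕ} {F : Finset (Finset ℕ)} {H : Finset ℕ} (hγ : 1 ≤ γ)
    (hF : ∀ Z ∈ F, Z ⊆ range V ∧ #Z ≤ k) (h : Heavy γ F c H) :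
    ∃ p < (k + 1) * (k + 1) * V ^ k, HeavyKey k γ V F p ∧
      p / V ^ k = c * (k + 1) + (k - #H) ∧ keySet V k (p % V ^ k) = H := by
  obtain ⟨Z, hZ⟩ := card_pos.1 ((Nat.one_le_pow _ _ hγ).trans h.2.2)
  rw [flower, mem_filter] at hZ
  have hck : c ≤ k := by rw [← hZ.2.1]; exact (hF Z hZ.1).2
  have hHk : #H < k := h.2.1.trans_le hck
  obtain ⟨t, ht, htH⟩ := exists_keySet_eq (k := k) (hZ.2.2.trans (hF Z hZ.1).1) hHk.le h.1
  have hU : 0 < V ^ k := by omega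
  have h1 : (t + V ^ k * (c * (k + 1) + (k - #H))) / V ^ k = c * (k + 1) + (k - #H) := by
    rw [Nat.add_mul_div_left _ _ hU, Nat.div_eq_of_lt ht, zero_add]
  have h2 : (t + V ^ k * (c * (k + 1) + (k - #H))) % V ^ k = t := by
    rw [Nat.add_mul_mod_self_left, Nat.mod_eq_of_lt ht]
  have h3 : c * (k + 1) + (k - #H) = (k - #H) + (k + 1) * c := by ring
  refine ⟨t + V ^ k * (c * (k + 1) + (k - #H)), ?_, ⟨?_, ?_⟩, h1, by rw [h2, htH]⟩
  · have h4 : c * (k + 1) + (k - #H) + 1 ≤ (k + 1) * (k + 1) := by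
      have := Nat.mul_le_mul_right (k + 1) hck
      have h5 : (k + 1) * (k + 1) = k * (k + 1) + (k + 1) := by ring
      omega
    have := Nat.mul_le_mul_left (V ^ k) h4
    rw [mul_add, mul_one] at this
    rw [mul_comm _ (V ^ k)]
    omega
  · rw [h1, h2, htH, h3, Nat.add_mul_mod_self_left, Nat.mod_eq_of_lt (by omega)]; omega
  · rwa [h1, h2, htH, h3, Nat.add_mul_div_left _ _ (by omega), Nat.div_eq_of_lt (by omega),
      zero_add]

/-- The quotient `c * (k + 1) + (k - #H)` of a key orders flowers by increasing `c` and then by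
decreasing heart, so the least key is a best flower. -/
theorem isBest_of_first {γ p : ℕ} {F : Finset (Finset ℕ)} (hγ : 1 ≤ γ)
    (hF : ∀ Z ∈ F, Z ⊆ range V ∧ #Z ≤ k) (h : HeavyKey k γ V F p)
    (hp : ∀ p' < p, ¬ HeavyKey k γ V F p') :
    IsBest γ F (p / V ^ k / (k + 1)) (keySet V k (p % V ^ k)) := by
  have hd := Nat.div_add_mod (p / V ^ k) (k + 1)
  have h1 := h.1
  have key : ∀ c' H', Heavy γ F c' H' → p / V ^ k ≤ c' * (k + 1) + (k - #H') := by
    intro c' H' hH'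
    obtain ⟨p', -, hp', he, -⟩ := exists_heavyKey hγ hF hH'
    rw [← he]
    exact Nat.div_le_div_right (not_lt.1 fun hlt => hp p' hlt hp')
  refine ⟨h.2, fun c' hc' H' hH' => ?_, fun H' hcard hH' => ?_⟩
  · have h2 := key c' H' hH'
    have h3 := Nat.mul_le_mul_left (k + 1) (show c' + 1 ≤ _ from hc')
    rw [mul_add, mul_one, mul_comm (k + 1) c'] at h3
    omega
  · have h2 := key _ H' hH'
    rw [mul_comm (k + 1)] at hd
    have h3 := hH'.2.1
    obtain ⟨Z, hZ⟩ := card_pos.1 ((Nat.one_le_pow _ _ hγ).trans hH'.2.2)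
    rw [flower, mem_filter] at hZ
    have h4 := (hF Z hZ.1).2
    omega

theorem isPick_pick {γ : ℕ} (hγ : 1 ≤ γ) {F : Finset (Finset ℕ)}
    (hF : ∀ Z ∈ F, Z ⊆ range V ∧ #Z ≤ k) :
    (pick k γ V F = none → ∀ c H, ¬ Heavy γ F c H) ∧
      ∀ c H, pick k γ V F = some (c, H) → IsBest γ F c H := by
  classical
  constructor
  · intro h c H hH
    obtain ⟨p, hp, hk, -, -⟩ := exists_heavyKey hγ hF hH
    rw [pick, dif_pos ⟨p, hp, hk⟩] at h
    exact absurd h (by simp)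
  · intro c H h
    rw [pick] at h
    split_ifs at h with hex
    obtain ⟨rfl, rfl⟩ := Prod.mk.inj (Option.some.inj h)
    refine isBest_of_first hγ hF (Nat.find_spec hex).2 fun p' hp' hk => ?_
    exact Nat.find_min hex hp' ⟨hp'.trans (Nat.find_spec hex).1, hk⟩

end

end RAM

namespace RAM

open Finset Sparsification

/-! ## Expressions for a step of the sparsification -/

/-- The expression for `keySet t` being one of the sets that are added in the step that is described
by the global variables `19` (the flower) and `20` (petals or heart). -/
def newE (k a t : ℕ) : Ex :=
  .bind (t + 1) (.mod (.g 19) (.g 2)) (.bind (t + 2)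
    (.bin .div (.bin .div (.g 19) (.g 2)) (.c (k + 1))) (.cond (.g 20)
      (.ex (t + 3) 2 (.and (.arr a (.l (t + 3))) (.and (.eq (sizeE (t + 3)) (.l (t + 2)))
        (.and (subE (t + 1) (t + 3)) (.all (t + 4) 1 (.eq (memE (t + 4) t)
          (.and (memE (t + 4) (t + 3)) (.not (memE (t + 4) (t + 1))))))))))
      (eqSetE t (t + 1))))

/-- The expression for the new bitmap at the cell in the global variable `21`. -/
def stepE (k a : ℕ) : Ex :=
  .bind 0 (.g 21) (.cond (.lt (.g 19) (.g 3))
    (minimalE (fun t => .or (.arr a (.l t)) (newE k a t)) 0) (.arr a (.l 0)))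

/-- The expression for the number of literal `l` of clause `c`. -/
def litE (c l : ℕ) : Ex :=
  .bind (c + l + 1) (.arr 0 (.bin .add (.bin .mul (.l c) (.g 0)) (.l l)))
    (.cond (.l (c + l + 1)) (.bin .sub (.bin .mul (.c 2) (.l (c + l + 1))) (.c 1))
      (.bin .sub (.bin .mul (.c (-2)) (.l (c + l + 1))) (.c 2)))

/-- The expression for `keySet t` being the set of literals of a clause of the input. -/
def clauseE (t : ℕ) : Ex :=
  .ex (t + 1) 4 (.all (t + 2) 1 (.eq (memE (t + 2) t)
    (.ex (t + 3) 0 (.eq (litE (t + 1) (t + 3)) (.l (t + 2))))))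

/-- The expression for the initial bitmap at the cell in the global variable `21`. -/
def initE : Ex := .bind 0 (.g 21) (minimalE clauseE 0)

/-- The expression for entry number `g 21` of the list of the numbers `t + 1` with `t` in the
bitmap. -/
def listE (a : ℕ) : Ex :=
  .sum 0 2 (.cond (.and (.arr a (.l 0))
    (.eq (.sum 1 2 (.and (.lt (.l 1) (.l 0)) (.arr a (.l 1)))) (.g 21)))
    (.bin .add (.l 0) (.c 1)) (.c 0))

section

variable {G : ℕ → ℤ} {A : ℕ → ℕ → ℤ} {ρ : ℕ → ℤ} {k V : ℕ}

theorem pick_eq_some {γ P : ℕ} {F : Finset (Finset ℕ)} (h : ∀ p < P, ¬ HeavyKey k γ V F p)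
    (hP : P < (k + 1) * (k + 1) * V ^ k) (hk : HeavyKey k γ V F P) :
    pick k γ V F = some (P / V ^ k / (k + 1), keySet V k (P % V ^ k)) := by
  classical
  have hex : ∃ p, p < (k + 1) * (k + 1) * V ^ k ∧ HeavyKey k γ V F p := ⟨P, hP, hk⟩
  have : Nat.find hex = P := (Nat.find_eq_iff hex).2 ⟨⟨hP, hk⟩, fun p hp h' => h p hp h'.2⟩
  rw [pick, dif_pos hex, this]

theorem pick_eq_none {γ P : ℕ} {F : Finset (Finset ℕ)} (h : ∀ p < P, ¬ HeavyKey k γ V F p)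
    (hP : ¬ P < (k + 1) * (k + 1) * V ^ k) : pick k γ V F = none := by
  rw [pick, dif_neg]
  rintro ⟨p, hp, hk⟩
  exact h p (by omega) hk

theorem Tr.newE (hc : Ctx G k V) {a t T P : ℕ} {b : Prop} [Decidable b] {B : ℕ → ℤ}
    {F : Finset (Finset ℕ)} (hB : Encodes V k B F) (hA : A a = B) (h19 : G 19 = P)
    (h20 : G 20 = if b then 1 else 0) (ht : ρ t = T) (hT : T < V ^ k) :
    Tr G A ρ (newE k a t) (keySet V k T ∈ if b then
      petals F (P / V ^ k / (k + 1)) (keySet V k (P % V ^ k)) else {keySet V k (P % V ^ k)}) := by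
  have hP : P % V ^ k < V ^ k := Nat.mod_lt _ (by omega)
  have hk1 : ∀ ρ : ℕ → ℤ, (Ex.c (k + 1)).eval G A ρ = (k + 1 : ℕ) := by simp [Ex.eval]
  unfold RAM.newE Tr
  rw [Ex.eval, eval_mod (eval_g h19) (eval_g hc.U_eq), Ex.eval,
    eval_div (eval_div (eval_g h19) (eval_g hc.U_eq)) (hk1 _)]
  set ρ' : ℕ → ℤ := Function.update (Function.update ρ (t + 1) ((P % V ^ k : ℕ) : ℤ)) (t + 2)
    ((P / V ^ k / (k + 1) : ℕ) : ℤ) with hρ'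
  have r0 : ρ' t = T := by simp [hρ', ht]
  have r1 : ρ' (t + 1) = (P % V ^ k : ℕ) := by simp [hρ']
  have r2 : ρ' (t + 2) = (P / V ^ k / (k + 1) : ℕ) := by simp [hρ']
  clear_value ρ'
  have h20' : Tr G A ρ' (.g 20) b := by
    by_cases hb : b <;> simp [Tr, Ex.eval, h20, hb]
  refine Tr.cond h20' (fun hb => ?_) fun hb => ?_
  · rw [if_pos hb]
    refine (Tr.ex (n := V ^ k) (p := fun z => B z = 1 ∧ #(keySet V k z) = P / V ^ k / (k + 1) ∧
      keySet V k (P % V ^ k) ⊆ keySet V k z ∧ ∀ v < V, (v ∈ keySet V k T ↔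
        v ∈ keySet V k z ∧ v ∉ keySet V k (P % V ^ k))) hc.U_eq fun z hz =>
      (Tr.bitmap hB hA (Function.update_self ..) hz).and fun _ =>
      ((Tr.eq (eval_size hc (Function.update_self ..) hz)
        (eval_l (update_eq_of_ne r2 (by omega)))).iff Nat.cast_inj).and fun _ =>
      (Tr.sub hc (update_eq_of_ne r1 (by omega)) (Function.update_self ..) hP).and fun _ =>
      Tr.all (n := V) hc.V_eq fun v hv => Tr.eq_iff
        (Tr.mem hc (update_eq_of_ne (update_eq_of_ne r0 (by omega)) (by omega))
          (Function.update_self ..))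
        ((Tr.mem hc (update_eq_of_ne (Function.update_self ..) (by omega))
          (Function.update_self ..)).and fun _ =>
          (Tr.mem hc (update_eq_of_ne (update_eq_of_ne r1 (by omega)) (by omega))
          (Function.update_self ..)).not)).iff ?_
    have hext : ∀ z < V ^ k, (∀ v < V, (v ∈ keySet V k T ↔
        v ∈ keySet V k z ∧ v ∉ keySet V k (P % V ^ k))) ↔
        keySet V k z \ keySet V k (P % V ^ k) = keySet V k T := by
      intro z hz
      constructor
      · intro h
        ext v
        rw [mem_sdiff]
        by_cases hv : v < V
        · exact (h v hv).symm
        · exact ⟨fun h' => absurd (mem_range.1 (keySet_subset hz h'.1)) hv,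
            fun h' => absurd (mem_range.1 (keySet_subset hT h')) hv⟩
      · intro h v _
        rw [← h, mem_sdiff]
    simp only [petals, flower, mem_image, mem_filter]
    constructor
    · rintro ⟨z, hz, hBz, hcz, hs, hd⟩
      exact ⟨_, ⟨((hB.eq_one_iff z hz).1 hBz).2, hcz, hs⟩, (hext z hz).1 hd⟩
    · rintro ⟨Z, ⟨hZ, hcz, hs⟩, hd⟩
      obtain ⟨z, hz, hBz, rfl⟩ := hB.exists_canon hZ
      exact ⟨z, hz, hBz, hcz, hs, (hext z hz).2 hd⟩
  · rw [if_neg hb, mem_singleton]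
    exact Tr.eqSet hc r0 r1 hT hP

open Classical in
/-- The bitmap of a family. -/
noncomputable def bitmap (V k : ℕ) (F : Finset (Finset ℕ)) (t : ℕ) : ℤ :=
  if Canon V k t ∧ keySet V k t ∈ F then 1 else 0

theorem encodes_of_eq_bitmap {F : Finset (Finset ℕ)} {B : ℕ → ℤ}
    (hF : ∀ Z ∈ F, ∃ t < V ^ k, keySet V k t = Z) (h : ∀ t < V ^ k, B t = bitmap V k F t) :
    Encodes V k B F := by
  refine ⟨fun t ht => ?_, fun t ht => ?_, hF⟩
  · rw [h t ht, bitmap]; split_ifs <;> simp_all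
  · rw [h t ht, bitmap]; split_ifs <;> simp

theorem Encodes.tr {F : Finset (Finset ℕ)} {B : ℕ → ℤ} (h : Encodes V k B F) {t : ℕ}
    (ht : t < V ^ k) : (Canon V k t ∧ keySet V k t ∈ F → B t = 1) ∧
      (¬ (Canon V k t ∧ keySet V k t ∈ F) → B t = 0) := by
  rw [← h.eq_one_iff t ht]
  exact ⟨id, (h.zero_or_one t ht).resolve_right⟩

theorem Tr.step (hc : Ctx G k V) {a P β γ n : ℕ} {B : ℕ → ℤ}
    {F : Finset (Finset ℕ)} (hB : Encodes V k B F) (hγ : 1 ≤ γ)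
    (h3 : G 3 = ((k + 1) * (k + 1) * V ^ k : ℕ)) (h19 : G 19 = P)
    (h20 : G 20 = if n % β = 0 then 1 else 0) (hP : ∀ p < P, ¬ HeavyKey k γ V F p)
    (hP' : P < (k + 1) * (k + 1) * V ^ k → HeavyKey k γ V F P) :
    (∀ Z ∈ (step β (pick k γ V) (F, n)).1, ∃ t < V ^ k, keySet V k t = Z) ∧
    ∀ t < V ^ k, ∀ (A : ℕ → ℕ → ℤ) (ρ : ℕ → ℤ), A a = B →
      Tr (Function.update G 21 (t : ℤ)) A ρ (stepE k a)
        (Canon V k t ∧ keySet V k t ∈ (step β (pick k γ V) (F, n)).1) := by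
  have hF : ∀ Z ∈ F, Z ⊆ range V ∧ #Z ≤ k := by
    intro Z hZ
    obtain ⟨t, ht, rfl⟩ := hB.exists_key Z hZ
    exact ⟨keySet_subset ht, card_keySet_le V k t⟩
  by_cases hlt : P < (k + 1) * (k + 1) * V ^ k
  · have hp := pick_eq_some hP hlt (hP' hlt)
    rw [step_of_some (p := (F, n)) hp]
    have hbest := isBest_of_first hγ hF (hP' hlt) hP
    set c := P / V ^ k / (k + 1) with hcdef
    set H := keySet V k (P % V ^ k) with hHdef
    have hN : ∀ Z ∈ F ∪ (if n % β = 0 then petals F c H else {H}),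
        ∃ t < V ^ k, keySet V k t = Z := by
      intro Z hZ
      rcases mem_union.1 hZ with hZ | hZ
      · exact hB.exists_key Z hZ
      · split_ifs at hZ
        · obtain ⟨Y, hY, rfl⟩ := mem_image.1 hZ
          rw [flower, mem_filter] at hY
          refine exists_keySet_eq (sdiff_subset.trans (hF Y hY.1).1)
            ((card_le_card sdiff_subset).trans (hF Y hY.1).2) ?_
          rw [card_sdiff_of_subset hY.2.2, hY.2.1]
          have := hbest.heavy.2.1
          omega
        · have hU : 0 < V ^ k := Nat.pos_of_ne_zero fun h => by simp [h] at hlt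
          exact ⟨P % V ^ k, Nat.mod_lt _ hU, (mem_singleton.1 hZ).symm⟩
    refine ⟨fun Z hZ => hN Z (minimals_subset _ hZ), fun t ht A ρ hA => ?_⟩
    have hc' : Ctx (Function.update G 21 (t : ℤ)) k V :=
      ⟨by simpa using hc.k_eq, by simpa using hc.V_eq, by simpa using hc.U_eq⟩
    simp only [Tr, stepE, Ex.eval, Function.update_self]
    have hpos : 0 < (Ex.lt (.g 19) (.g 3)).eval (Function.update G 21 (t : ℤ)) A
        (Function.update ρ 0 (t : ℤ)) := by
      refine (Tr.pos_iff (Tr.lt (x := P) (y := ((k + 1) * (k + 1) * V ^ k : ℕ)) ?_ ?_)).2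
        (by exact_mod_cast hlt)
      · simpa [Ex.eval] using h19
      · simpa [Ex.eval] using h3
    rw [if_pos hpos]
    exact Tr.minimal hc' (C := fun t => B t = 1 ∨ keySet V k t ∈ if n % β = 0 then
        petals F c H else {H}) (fun x ρ T hx hT => (Tr.bitmap hB hA hx hT).or fun _ =>
          Tr.newE hc' hB hA (by simpa using h19) (by simpa using h20) hx hT)
        (fun t ht h => mem_union.2 (h.imp_left fun h => ((hB.eq_one_iff t ht).1 h).2))
        (fun t ht hcan h => (mem_union.1 h).imp_left fun h => (hB.eq_one_iff t ht).2 ⟨hcan, h⟩)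
        hN (Function.update_self ..) ht
  · have hp := pick_eq_none hP hlt
    rw [step_of_none (p := (F, n)) hp]
    refine ⟨hB.exists_key, fun t ht A ρ hA => ?_⟩
    simp only [Tr, stepE, Ex.eval, Function.update_self]
    rw [if_neg]
    · simpa [hA] using hB.tr ht
    · rw [(Tr.pos_iff (Tr.lt (x := P) (y := ((k + 1) * (k + 1) * V ^ k : ℕ)) ?_ ?_))]
      · exact_mod_cast hlt
      · simpa [Ex.eval] using h19
      · simpa [Ex.eval] using h3

theorem Tr.init (hc : Ctx G k V) {M : ℕ} {lit : ℕ → ℕ → ℕ} {B : ℕ → ℤ} (hM : G 4 = M)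
    (hlit : ∀ c < M, ∀ l < k, lit c l < V)
    (hB : ∀ c < M, ∀ l < k, B (c * k + l) = if lit c l % 2 = 1 then
      ((lit c l / 2 : ℕ) : ℤ) + 1 else -(((lit c l / 2 : ℕ) : ℤ) + 1)) :
    (∀ Z ∈ minimals ((range M).image fun c => (range k).image (lit c)),
      ∃ t < V ^ k, keySet V k t = Z) ∧
    ∀ t < V ^ k, ∀ (A : ℕ → ℕ → ℤ) (ρ : ℕ → ℤ), A 0 = B →
      Tr (Function.update G 21 (t : ℤ)) A ρ initE (Canon V k t ∧
        keySet V k t ∈ minimals ((range M).image fun c => (range k).image (lit c))) := by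
  have hN : ∀ Z ∈ (range M).image fun c => (range k).image (lit c),
      ∃ t < V ^ k, keySet V k t = Z := by
    intro Z hZ
    obtain ⟨c, hc, rfl⟩ := mem_image.1 hZ
    exact exists_keySet_eq_image _ (hlit c (mem_range.1 hc))
  refine ⟨fun Z hZ => hN Z (minimals_subset _ hZ), fun t ht A ρ hA => ?_⟩
  have hc' : Ctx (Function.update G 21 (t : ℤ)) k V :=
    ⟨by simpa using hc.k_eq, by simpa using hc.V_eq, by simpa using hc.U_eq⟩
  simp only [Tr, initE, Ex.eval, Function.update_self]
  refine Tr.minimal hc' (C := fun t => keySet V k t ∈ (range M).image fun c =>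
    (range k).image (lit c)) (fun x ρ T hx hT => ?_) (fun _ _ h => h) (fun _ _ _ h => h) hN
    (Function.update_self ..) ht
  refine (Tr.ex (n := M) (p := fun c => ∀ v < V, (v ∈ keySet V k T ↔ ∃ l < k, lit c l = v))
    (by simpa using hM) fun c hcM => Tr.all (n := V) hc'.V_eq fun v hv => Tr.eq_iff
      (Tr.mem hc' (update_eq_of_ne (update_eq_of_ne hx (by omega)) (by omega))
        (Function.update_self ..)) (Tr.ex (n := k) hc'.k_eq fun l hl => (Tr.eq
          (x := (lit c l : ℕ)) ?_
          (eval_l (update_eq_of_ne (Function.update_self ..) (by omega)))).iff Nat.cast_inj)).iff ?_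
  · have h0 : (Function.update G 21 (t : ℤ)) 0 = k := hc'.k_eq
    have h1 : ((c : ℤ) * k + l).toNat = c * k + l := by norm_cast
    have h2 := hB c hcM l hl
    rw [← hA] at h2
    have h3 := Nat.div_add_mod (lit c l) 2
    -- An input literal `z = v + 1` becomes `2 z - 1 = 2 v + 1`, and `z = -(v + 1)` becomes `-2 z -
    -- 2 = 2 v`.
    simp only [litE, Ex.eval, Op.eval, Function.update_self, h0,
      Function.update_of_ne (show x + 1 ≠ x + 3 by omega),
      Function.update_of_ne (show x + 1 ≠ x + 2 by omega), h1, h2]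
    split_ifs <;> push_cast <;> omega
  · rw [mem_image]
    constructor
    · rintro ⟨c, hcM, h⟩
      refine ⟨c, mem_range.2 hcM, ?_⟩
      ext v
      rw [mem_image]
      by_cases hv : v < V
      · rw [h v hv]; simp
      · constructor
        · rintro ⟨l, hl, rfl⟩
          exact absurd (hlit c hcM l (mem_range.1 hl)) hv
        · intro h'
          exact absurd (mem_range.1 (keySet_subset hT h')) hv
    · rintro ⟨c, hcM, h⟩
      refine ⟨c, mem_range.1 hcM, fun v _ => ?_⟩
      rw [← h]; simp

/-- The numbers `y l`, `l < cap`, list the members of the family `F`: they are `0` or `t + 1` with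
`keySet t ∈ F`, and every member occurs. -/
structure Lists (V k cap : ℕ) (y : ℕ → ℤ) (F : Finset (Finset ℕ)) : Prop where
  zero_or : ∀ l < cap, y l = 0 ∨ ∃ t < V ^ k, keySet V k t ∈ F ∧ y l = t + 1
  exists_index : ∀ Z ∈ F, ∃ l < cap, ∃ t < V ^ k, keySet V k t = Z ∧ y l = t + 1

open Classical in
/-- Entry number `l` of the list of the numbers `t + 1` with `t` in the bitmap. -/
noncomputable def listVal (V k : ℕ) (B : ℕ → ℤ) (l : ℕ) : ℤ :=
  ∑ t ∈ range (V ^ k), if B t = 1 ∧ #((range (V ^ k)).filter fun t' => t' < t ∧ B t' = 1) = l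
    then (t : ℤ) + 1 else 0

theorem eval_list (hc : Ctx G k V) {a : ℕ} {B : ℕ → ℤ} {F : Finset (Finset ℕ)}
    (hB : Encodes V k B F) (hA : A a = B) (l : ℕ) :
    (listE a).eval (Function.update G 21 (l : ℤ)) A ρ = listVal V k B l := by
  classical
  rw [listE, eval_sum (n := V ^ k) (by simpa using hc.U_eq)]
  refine sum_congr rfl fun t ht => ?_
  rw [mem_range] at ht
  have h : Tr (Function.update G 21 (l : ℤ)) A (Function.update ρ 0 (t : ℤ))
      (.and (.arr a (.l 0)) (.eq (.sum 1 2 (.and (.lt (.l 1) (.l 0)) (.arr a (.l 1)))) (.g 21)))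
      (B t = 1 ∧ #((range (V ^ k)).filter fun t' => t' < t ∧ B t' = 1) = l) := by
    refine (Tr.bitmap hB hA (Function.update_self ..) ht).and fun _ => (Tr.eq (eval_sum_tr
      (p := fun t' => t' < t ∧ B t' = 1) (n := V ^ k) (by simpa using hc.U_eq) fun t' ht' =>
        ((Tr.lt (x := t') (y := t) (by simp [Ex.eval]) (by simp [Ex.eval])).iff
          Nat.cast_lt).and fun _ => Tr.bitmap hB hA (Function.update_self ..) ht')
      (eval_g (Function.update_self ..))).iff Nat.cast_inj
  rw [Ex.eval]
  simp only [h.pos_iff, Ex.eval, Op.eval, Function.update_self]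

/-- Marked numbers have distinct ranks below `#F ≤ cap`. So each sum has at most one nonzero term,
each member appears at its rank, and the remaining entries are zero padding. -/
theorem lists_of_encodes {cap : ℕ} {B y : ℕ → ℤ} {F : Finset (Finset ℕ)}
    (hB : Encodes V k B F) (hcap : #F ≤ cap) (hy : ∀ l < cap, y l = listVal V k B l) :
    Lists V k cap y F := by
  classical
  set rank : ℕ → ℕ := fun t => #((range (V ^ k)).filter fun t' => t' < t ∧ B t' = 1) with hrank
  have hval : ∀ l < cap, y l = ∑ t ∈ range (V ^ k),
      if B t = 1 ∧ rank t = l then (t : ℤ) + 1 else 0 := by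
    intro l hl
    rw [hy l hl, listVal]
  have hlt : ∀ t t', t < t' → t < V ^ k → B t = 1 → rank t < rank t' := by
    intro t t' htt' ht hBt
    refine card_lt_card ⟨fun z hz => ?_, fun hsub => ?_⟩
    · simp only [mem_filter, mem_range] at hz ⊢
      exact ⟨hz.1, hz.2.1.trans htt', hz.2.2⟩
    · have := hsub (mem_filter.2 ⟨mem_range.2 ht, htt', hBt⟩)
      simp at this
  have hval' : ∀ t < V ^ k, B t = 1 → ∀ l < cap, rank t = l → y l = t + 1 := by
    intro t ht hBt l hl hr
    rw [hval l hl, sum_eq_single t, if_pos ⟨hBt, hr⟩]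
    · intro t' ht' hne
      rw [if_neg]
      rintro ⟨hBt', hr'⟩
      rcases lt_or_gt_of_ne hne with h | h
      · have := hlt t' t h (mem_range.1 ht') hBt'; omega
      · have := hlt t t' h ht hBt; omega
    · intro h; exact absurd (mem_range.2 ht) h
  constructor
  · intro l hl
    by_cases h : ∃ t < V ^ k, B t = 1 ∧ rank t = l
    · obtain ⟨t, ht, hBt, hr⟩ := h
      exact Or.inr ⟨t, ht, ((hB.eq_one_iff t ht).1 hBt).2, hval' t ht hBt l hl hr⟩
    · left
      push Not at h
      rw [hval l hl]
      exact sum_eq_zero fun t ht => if_neg fun h' => h t (mem_range.1 ht) h'.1 h'.2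
  · intro Z hZ
    obtain ⟨t, ht, hBt, rfl⟩ := hB.exists_canon hZ
    have hr : rank t < cap := by
      have h1 := hB.card_filter fun _ => True
      simp only [and_true, filter_true] at h1
      refine lt_of_lt_of_le ?_ (h1.le.trans hcap)
      refine card_lt_card ⟨fun z hz => ?_, fun hsub => ?_⟩
      · simp only [mem_filter] at hz ⊢
        exact ⟨hz.1, hz.2.2⟩
      · have := hsub (mem_filter.2 ⟨mem_range.2 ht, hBt⟩)
        simp at this
    exact ⟨rank t, hr, t, ht, rfl, hval' t ht hBt _ hr rfl⟩

end

end RAM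

namespace RAM

open Finset Sparsification

/-! ## The sparsification program -/

theorem Wp.seq_pow {R : ℕ} {low : ℕ → ℤ} {c₁ c₂ : Program} {X a b : ℕ} {σ : Memory}
    {Q₁ Q : Memory → Prop} (hX : 2 ≤ X) (h₁ : Wp R low c₁ (X ^ a) σ Q₁)
    (h₂ : ∀ σ', Q₁ σ' → Wp R low c₂ (X ^ b) σ' Q) :
    Wp R low (.seq c₁ c₂) (X ^ (a + b + 1)) σ Q := by
  refine (h₁.seq h₂).mono ?_ fun _ h => h
  have h1 := pow_le_of_le hX (show a ≤ a + b by omega)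
  have h2 := pow_le_of_le hX (show b ≤ a + b by omega)
  have h3 : X ^ (a + b) * 2 ≤ X ^ (a + b) * X := Nat.mul_le_mul_left _ hX
  rw [pow_succ]
  omega

theorem Wp.tab_pow {R : ℕ} {low : ℕ → ℤ} {X : ℕ} {σ : Memory} (hσ : Bounded X σ) {a x b : ℕ}
    {e f : Ex} (n base : ℕ) (v : ℕ → ℤ) (hx : 10 ≤ x) (hxb : b ≠ x) (hb : σ.var b = n)
    (hnX : n ≤ X) (he : ∀ i < n, e.val (tabState σ a x base v i) = base + i)
    (hf : ∀ i < n, f.val (tabState σ a x base v i) = v i) (hv : ∀ i < n, len (v i) ≤ X) :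
    Wp R low (RAM.tab R a x b e f) (X ^ (e.deg + f.deg + 9)) σ (· = tabState σ a x base v n) := by
  refine (Wp.tab hσ n base v hx hxb hb he hf hv).mono ?_ fun _ h => h
  have h1 : n * X ^ (e.deg + f.deg + 7) ≤ X * X ^ (e.deg + f.deg + 7) := Nat.mul_le_mul_right _ hnX
  have h2 : X ^ (e.deg + f.deg + 8) = X * X ^ (e.deg + f.deg + 7) := by ring
  have h3 := pow_le_of_le hσ.two_le (show 4 ≤ e.deg + f.deg + 8 by omega)
  have h4 : X ^ (e.deg + f.deg + 8) * 2 ≤ X ^ (e.deg + f.deg + 8) * X :=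
    Nat.mul_le_mul_left _ hσ.two_le
  have h5 : X ^ (e.deg + f.deg + 9) = X ^ (e.deg + f.deg + 8) * X := by ring
  omega

/-- The global variables that are constant during the main part of the program. -/
def IsConst (x : ℕ) : Prop := x < 16 ∨ 22 ≤ x

/-- A state with bit lengths at most `X`, constants `κ`, and arrays `A₀` apart from the bitmap in use,
its copy, and the table of clause lists. -/
structure State (R X : ℕ) (κ : ℕ → ℤ) (A₀ : ℕ → ℕ → ℤ) (σ : Memory) : Prop where
  bounded : Bounded X σ
  const : ∀ x, IsConst x → σ.var x = κ x
  arr : ∀ a, a ≠ R + 1 → a ≠ R + 2 → a ≠ R + 3 → σ.arr a = A₀ a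

theorem State.setVar {R X : ℕ} {κ : ℕ → ℤ} {A₀ : ℕ → ℕ → ℤ} {σ : Memory} (h : State R X κ A₀ σ)
    {x : ℕ} {v : ℤ} (hx : ¬ IsConst x) (hv : len v ≤ X) : State R X κ A₀ (σ.setVar x v) := by
  refine ⟨h.bounded.setVar hv fun h => absurd (Or.inl (by omega)) hx, fun y hy => ?_, h.arr⟩
  rw [setVar_var, if_neg (by rintro rfl; exact hx hy), h.const y hy]

theorem State.tabState {R X : ℕ} {κ : ℕ → ℤ} {A₀ : ℕ → ℕ → ℤ} {σ : Memory} (h : State R X κ A₀ σ)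
    {a x base : ℕ} {v : ℕ → ℤ} {i : ℕ} (hx : ¬ IsConst x)
    (ha : a = R + 1 ∨ a = R + 2 ∨ a = R + 3) (hi : len (i : ℤ) ≤ X) (hv : ∀ j < i, len (v j) ≤ X) :
    State R X κ A₀ (tabState σ a x base v i) := by
  refine ⟨h.bounded.tabState ?_ hi hv, fun y hy => ?_, fun b h1 h2 h3 => ?_⟩
  · by_contra hlt; exact hx (Or.inl (by omega))
  · rw [tabState_var, if_neg (by rintro rfl; exact hx hy), h.const y hy]
  · rw [tabState_arr_ne (by rcases ha with rfl | rfl | rfl <;> assumption), h.arr b h1 h2 h3]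

theorem len_natCast_mono {m n : ℕ} (h : m ≤ n) : len (m : ℤ) ≤ len (n : ℤ) :=
  len_le_of_natAbs_le (by simpa using h)

theorem len_bitmap {V k : ℕ} {F : Finset (Finset ℕ)} {t X : ℕ} (hX : 2 ≤ X) :
    len (bitmap V k F t) ≤ X := by
  rw [bitmap]; split_ifs
  · rwa [len_one]
  · rw [len_zero]; omega

/-- The expression for the update of the code. -/
def codeE (β : ℕ) : Ex :=
  .cond (.lt (.g 19) (.g 3)) (.cond (.lt (.c 1) (.mod (.g 17) (.c β))) (.bin .sub (.g 17) (.c 2))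
    (.bin .div (.g 17) (.c β))) (.g 17)

/-- The program for one step of the sparsification. -/
def stepBody (k γ β R : ℕ) : Program :=
  .seq (assign R 19 (pickE k γ (R + 1))) (.seq (assign R 20 (.eq (.mod (.g 17) (.c β)) (.c 0)))
    (.seq (assign R 17 (codeE β)) (.seq (tab R (R + 2) 21 2 (.g 21) (stepE k (R + 1)))
      (tab R (R + 1) 21 2 (.g 21) (.arr (R + 2) (.g 21))))))

theorem eval_code {G : ℕ → ℤ} {A : ℕ → ℕ → ℤ} {ρ : ℕ → ℤ} {β n P N : ℕ} (h17 : G 17 = n)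
    (h19 : G 19 = P) (h3 : G 3 = N) :
    (codeE β).eval G A ρ = if P < N then (nextCode β n : ℤ) else n := by
  have h1 : Tr G A ρ (.lt (.g 19) (.g 3)) (P < N) :=
    (Tr.lt (eval_g h19) (eval_g h3)).iff Nat.cast_lt
  have h2 : Tr G A ρ (.lt (.c 1) (.mod (.g 17) (.c β))) (1 < n % β) :=
    (Tr.lt (x := (1 : ℕ)) rfl (eval_mod (eval_g h17) (show _ = (β : ℤ) from rfl))).iff Nat.cast_lt
  rw [codeE, Ex.eval]
  simp only [h1.pos_iff]
  split_ifs with h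
  · rw [Ex.eval]
    simp only [h2.pos_iff, nextCode]
    have : n % β ≤ n := Nat.mod_le _ _
    split_ifs
    · omega
    · simp only [Ex.eval, Op.eval, h17]; omega
    · exact eval_div (eval_g h17) rfl
    · omega
  · exact h17

theorem nextCode_le (β n : ℕ) : nextCode β n ≤ n := by
  rw [nextCode]; split_ifs
  exacts [Nat.div_le_self _ _, Nat.sub_le _ _]

theorem exists_wp_stepBody (k γ β R : ℕ) (hγ : 1 ≤ γ) : ∃ D, ∀ (X : ℕ) (κ : ℕ → ℤ)
    (A₀ : ℕ → ℕ → ℤ) (low : ℕ → ℤ) (V : ℕ) (σ : Memory) (F : Finset (Finset ℕ)) (n : ℕ),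
    Ctx κ k V → κ 3 = ((k + 1) * (k + 1) * V ^ k : ℕ) → State R X κ A₀ σ →
    Encodes V k (σ.arr (R + 1)) F → σ.var 17 = n →
    Wp R low (stepBody k γ β R) (X ^ D) σ fun σ' => State R X κ A₀ σ' ∧
      σ'.var 16 = σ.var 16 ∧ σ'.var 18 = σ.var 18 ∧ σ'.arr (R + 3) = σ.arr (R + 3) ∧
      Encodes V k (σ'.arr (R + 1)) (step β (pick k γ V) (F, n)).1 ∧
      σ'.var 17 = (step β (pick k γ V) (F, n)).2 := by
  -- The exponent is assembled from the degrees of the expressions in the program text, so it does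
  -- not depend on the formula.
  refine ⟨(pickE k γ (R + 1)).deg + 3 + ((Ex.eq (.mod (.g 17) (.c β)) (.c 0)).deg + 3 +
    ((codeE β).deg + 3 + ((Ex.g 21).deg + (stepE k (R + 1)).deg + 9 +
      ((Ex.g 21).deg + (Ex.arr (R + 2) (.g 21)).deg + 9) + 1) + 1) + 1) + 1, ?_⟩
  intro X κ A₀ low V σ F n hctx h3 hσ hB h17
  have hX := hσ.bounded.two_le
  have ctx : ∀ {τ : Memory}, State R X κ A₀ τ → Ctx τ.var k V := fun {τ} h =>
    ⟨(h.const 0 (Or.inl (by omega))).trans hctx.k_eq,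
      (h.const 1 (Or.inl (by omega))).trans hctx.V_eq,
      (h.const 2 (Or.inl (by omega))).trans hctx.U_eq⟩
  have v3 : ∀ {τ : Memory}, State R X κ A₀ τ → τ.var 3 = ((k + 1) * (k + 1) * V ^ k : ℕ) :=
    fun h => (h.const 3 (Or.inl (by omega))).trans h3
  have v2 : ∀ {τ : Memory}, State R X κ A₀ τ → τ.var 2 = (V ^ k : ℕ) := fun h => (ctx h).U_eq
  have hU : V ^ k ≤ X := by exact_mod_cast v2 hσ ▸ hσ.bounded.small 2 (by omega)
  have hlU : len ((V ^ k : ℕ) : ℤ) ≤ X := by rw [← v2 hσ]; exact hσ.bounded.var 2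
  obtain ⟨P, hP, hPle, hP1, hP2⟩ := exists_eval_pick (ρ := fun _ => 0) (γ := γ) (ctx hσ) hB rfl
    (v3 hσ)
  have hlP : len (P : ℤ) ≤ X :=
    (len_natCast_mono hPle).trans (by rw [← v3 hσ]; exact hσ.bounded.var 3)
  have hln : len (n : ℤ) ≤ X := by rw [← h17]; exact hσ.bounded.var 17
  refine Wp.seq_pow hX (Wp.assign hσ.bounded _ _) ?_
  rintro _ rfl
  rw [Ex.val, hP]
  have nc : ∀ x, 16 ≤ x → x < 22 → ¬ IsConst x := fun x h1 h2 h => by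
    rcases h with h | h <;> omega
  have hσ₁ := hσ.setVar (x := 19) (nc 19 (by omega) (by omega)) hlP
  set σ₁ := σ.setVar 19 P with hσ₁def
  have e20 : (Ex.eq (.mod (.g 17) (.c β)) (.c 0)).val σ₁ = if n % β = 0 then 1 else 0 :=
    Tr.eval_eq ((Tr.eq (x := (n % β : ℕ)) (y := (0 : ℕ))
      (eval_mod (eval_g (by simpa [hσ₁def, setVar_var] using h17)) rfl) rfl).iff Nat.cast_inj)
  refine Wp.seq_pow hX (Wp.assign hσ₁.bounded _ _) ?_
  rintro _ rfl
  rw [e20]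
  have hσ₂ := hσ₁.setVar (x := 20) (v := if n % β = 0 then 1 else 0) (nc 20 (by omega) (by omega))
    (by split_ifs
        · rwa [len_one]
        · rw [len_zero]; omega)
  set σ₂ := σ₁.setVar 20 (if n % β = 0 then 1 else 0) with hσ₂def
  have hn' : (codeE β).val σ₂ = ((step β (pick k γ V) (F, n)).2 : ℕ) := by
    rw [Ex.val, eval_code (n := n) (P := P) (N := (k + 1) * (k + 1) * V ^ k)
      (by simpa [hσ₂def, hσ₁def, setVar_var] using h17) (by simp [hσ₂def, hσ₁def, setVar_var])
      (v3 hσ₂)]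
    split_ifs with hlt
    · rw [step_of_some (p := (F, n)) (pick_eq_some hP1 hlt (hP2 hlt))]
    · rw [step_of_none (p := (F, n)) (pick_eq_none hP1 hlt)]
  have hle : (step β (pick k γ V) (F, n)).2 ≤ n := by
    by_cases hlt : P < (k + 1) * (k + 1) * V ^ k
    · rw [step_of_some (p := (F, n)) (pick_eq_some hP1 hlt (hP2 hlt))]
      exact nextCode_le _ _
    · rw [step_of_none (p := (F, n)) (pick_eq_none hP1 hlt)]
  set F' := (step β (pick k γ V) (F, n)).1 with hF'
  set n' := (step β (pick k γ V) (F, n)).2 with hn'def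
  refine Wp.seq_pow hX (Wp.assign hσ₂.bounded _ _) ?_
  rintro _ rfl
  rw [hn']
  have hσ₃ := hσ₂.setVar (x := 17) (v := n') (nc 17 (by omega) (by omega))
    ((len_natCast_mono hle).trans hln)
  set σ₃ := σ₂.setVar 17 n' with hσ₃def
  obtain ⟨hkey, htr⟩ := Tr.step (ctx hσ₃) (a := R + 1) (P := P) (β := β) (n := n) hB hγ (v3 hσ₃)
    (by simp [hσ₃def, hσ₂def, hσ₁def, setVar_var]) (by simp [hσ₃def, hσ₂def, setVar_var]) hP1 hP2
  -- Every new cell depends on the whole old bitmap in array `R + 1`, so the new one is built in `R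
  -- + 2` and copied back afterwards.
  refine Wp.seq_pow hX (Wp.tab_pow hσ₃.bounded (V ^ k) 0 (bitmap V k F') (by omega) (by omega)
    (v2 hσ₃) hU (fun i _ => by simp [Ex.val, Ex.eval, tabState_var]) (fun t ht => ?_)
    (fun _ _ => len_bitmap hX)) ?_
  · classical
    rw [bitmap]
    exact (htr t ht (RAM.tabState σ₃ (R + 2) 21 0 (bitmap V k F') t).arr _
      (tabState_arr_ne (by omega))).eval_eq
  rintro _ rfl
  have hσ₄ := hσ₃.tabState (x := 21) (a := R + 2) (base := 0) (v := bitmap V k F') (i := V ^ k)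
    (nc 21 (by omega) (by omega)) (by simp) hlU (fun _ _ => len_bitmap hX)
  set σ₄ := RAM.tabState σ₃ (R + 2) 21 0 (bitmap V k F') (V ^ k) with hσ₄def
  refine (Wp.tab_pow hσ₄.bounded (V ^ k) 0 (bitmap V k F') (by omega) (by omega)
    (v2 hσ₄) hU (fun i _ => by simp [Ex.val, Ex.eval, tabState_var]) (fun t ht => ?_)
    (fun _ _ => len_bitmap hX)).mono le_rfl ?_
  · simp only [Ex.val, Ex.eval, tabState_var, if_true, Int.toNat_natCast]
    rw [tabState_arr_ne (by omega), hσ₄def, tabState_arr_self, if_pos (by omega), Nat.sub_zero]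
  rintro _ rfl
  refine ⟨hσ₄.tabState (nc 21 (by omega) (by omega)) (by simp) hlU (fun _ _ => len_bitmap hX),
    ?_, ?_, ?_, ?_, ?_⟩
  · simp [hσ₄def, hσ₃def, hσ₂def, hσ₁def, setVar_var, tabState_var]
  · simp [hσ₄def, hσ₃def, hσ₂def, hσ₁def, setVar_var, tabState_var]
  · rw [tabState_arr_ne (by omega), hσ₄def, tabState_arr_ne (by omega)]; rfl
  · refine encodes_of_eq_bitmap hkey fun t ht => ?_
    rw [tabState_arr_self, if_pos (by omega), Nat.sub_zero]
  · simp [hσ₄def, hσ₃def, setVar_var, tabState_var]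

/-- The program for the list of the clauses of the sparse formula with code `g 16`. -/
def codeBody (k γ β R : ℕ) : Program :=
  .seq (assign R 17 (.g 16)) (.seq (tab R (R + 1) 21 2 (.g 21) (.arr R (.g 21)))
    (.seq (forLoop R 18 15 (stepBody k γ β R))
      (tab R (R + 3) 21 14 (.bin .add (.bin .mul (.g 16) (.g 14)) (.g 21)) (listE (R + 1)))))

theorem Wp.forLoop_pow {R : ℕ} {low : ℕ → ℤ} {X : ℕ} {σ : Memory} {x b : ℕ} {c : Program} {D : ℕ}
    (n : ℕ) (I : ℕ → Memory → Prop) (hX : 2 ≤ X) (hn : len (n : ℤ) ≤ X) (hxb : b ≠ x)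
    (hb : σ.var b = n) (h0 : I 0 (σ.setVar x 0))
    (hstep : ∀ i < n, ∀ τ : Memory, τ.var x = i → τ.var b = n → I i τ →
      Wp R low c (X ^ D) τ fun τ' => τ'.var x = i ∧ τ'.var b = n ∧
        I (i + 1) (τ'.setVar x (i + 1))) :
    Wp R low (RAM.forLoop R x b c) ((n + 1) * X ^ (D + 5)) σ
      fun τ => τ.var x = n ∧ τ.var b = n ∧ I n τ := by
  refine (Wp.forLoop n I (fun _ => X ^ D) hX hn hxb hb h0 hstep).mono ?_ fun _ h => h
  have h1 : 8 * X ^ 1 ≤ X ^ 4 := eight_mul_pow_le hX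
  have h2 := pow_le_of_le hX (show 4 ≤ D + 4 by omega)
  have h3 := pow_le_of_le hX (show D ≤ D + 4 by omega)
  have h4 : X ^ (D + 4) * 2 ≤ X ^ (D + 4) * X := Nat.mul_le_mul_left _ hX
  rw [pow_one] at h1
  rw [sum_const, card_range, smul_eq_mul, add_mul, one_mul, show D + 5 = D + 4 + 1 by ring,
    pow_succ]
  gcongr <;> omega

/-- Array `R` keeps the initial bitmap throughout, so every code restarts from the same family;
lists written for smaller codes survive. -/
theorem exists_wp_codeBody (k γ β R : ℕ) (hγ : 1 ≤ γ) : ∃ D, ∀ (X : ℕ) (κ : ℕ → ℤ)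
    (A₀ : ℕ → ℕ → ℤ) (low : ℕ → ℤ) (V L cap : ℕ) (σ : Memory) (F : Finset (Finset ℕ)) (s : ℕ),
    Ctx κ k V → κ 3 = ((k + 1) * (k + 1) * V ^ k : ℕ) → κ 14 = cap → κ 15 = L → L + 1 ≤ X →
    cap ≤ X → State R X κ A₀ σ → Encodes V k (A₀ R) F → σ.var 16 = s →
    #((step β (pick k γ V))^[L] (F, s)).1 ≤ cap →
    Wp R low (codeBody k γ β R) (X ^ D) σ fun σ' => State R X κ A₀ σ' ∧ σ'.var 16 = s ∧
      (∀ t < s * cap, σ'.arr (R + 3) t = σ.arr (R + 3) t) ∧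
      Lists V k cap (fun l => σ'.arr (R + 3) (s * cap + l))
        ((step β (pick k γ V))^[L] (F, s)).1 := by
  obtain ⟨D, hD⟩ := exists_wp_stepBody k γ β R hγ
  refine ⟨(Ex.g 16).deg + 3 + ((Ex.g 21).deg + (Ex.arr R (.g 21)).deg + 9 + (1 + (D + 5) +
    ((Ex.bin .add (.bin .mul (.g 16) (.g 14)) (.g 21)).deg + (listE (R + 1)).deg + 9) + 1) + 1)
      + 1, ?_⟩
  intro X κ A₀ low V L cap σ F s hctx h3 h14 h15 hLX hcX hσ hB h16 hcap
  have hX := hσ.bounded.two_le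
  have ctx : ∀ {τ : Memory}, State R X κ A₀ τ → Ctx τ.var k V := fun {τ} h =>
    ⟨(h.const 0 (Or.inl (by omega))).trans hctx.k_eq,
      (h.const 1 (Or.inl (by omega))).trans hctx.V_eq,
      (h.const 2 (Or.inl (by omega))).trans hctx.U_eq⟩
  have v14 : ∀ {τ : Memory}, State R X κ A₀ τ → τ.var 14 = cap :=
    fun h => (h.const 14 (Or.inl (by omega))).trans h14
  have v15 : ∀ {τ : Memory}, State R X κ A₀ τ → τ.var 15 = L :=
    fun h => (h.const 15 (Or.inl (by omega))).trans h15
  have v2 : ∀ {τ : Memory}, State R X κ A₀ τ → τ.var 2 = (V ^ k : ℕ) := fun h => (ctx h).U_eq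
  have hU : V ^ k ≤ X := by exact_mod_cast v2 hσ ▸ hσ.bounded.small 2 (by omega)
  have hlU : len ((V ^ k : ℕ) : ℤ) ≤ X := by rw [← v2 hσ]; exact hσ.bounded.var 2
  have hls : len (s : ℤ) ≤ X := by rw [← h16]; exact hσ.bounded.var 16
  have hlL : len (L : ℤ) ≤ X := by rw [← v15 hσ]; exact hσ.bounded.var 15
  have hlc : len (cap : ℤ) ≤ X := by rw [← v14 hσ]; exact hσ.bounded.var 14
  have nc : ∀ x, 16 ≤ x → x < 22 → ¬ IsConst x := fun x h1 h2 h => by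
    rcases h with h | h <;> omega
  refine Wp.seq_pow hX (Wp.assign hσ.bounded _ _) ?_
  rintro _ rfl
  rw [show (Ex.g 16).val σ = s from h16]
  have hσ₁ := hσ.setVar (x := 17) (v := s) (nc 17 (by omega) (by omega)) hls
  set σ₁ := σ.setVar 17 s with hσ₁def
  refine Wp.seq_pow hX (Wp.tab_pow hσ₁.bounded (V ^ k) 0 (A₀ R) (by omega) (by omega)
    (v2 hσ₁) hU (fun i _ => by simp [Ex.val, Ex.eval, tabState_var]) (fun t ht => ?_)
    (fun t ht => ?_)) ?_
  · simp only [Ex.val, Ex.eval, tabState_var, if_true, Int.toNat_natCast]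
    rw [tabState_arr_ne (by omega), hσ₁.arr R (by omega) (by omega) (by omega)]
  · rw [← hσ₁.arr R (by omega) (by omega) (by omega)]; exact hσ₁.bounded.arr _ _
  rintro _ rfl
  have hσ₂ := hσ₁.tabState (x := 21) (a := R + 1) (base := 0) (v := A₀ R) (i := V ^ k)
    (nc 21 (by omega) (by omega)) (by simp) hlU (fun t ht => by
      rw [← hσ₁.arr R (by omega) (by omega) (by omega)]; exact hσ₁.bounded.arr _ _)
  set σ₂ := RAM.tabState σ₁ (R + 1) 21 0 (A₀ R) (V ^ k) with hσ₂def
  have hB₂ : Encodes V k (σ₂.arr (R + 1)) F := by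
    have : ∀ t < V ^ k, σ₂.arr (R + 1) t = A₀ R t := fun t ht => by
      rw [hσ₂def, tabState_arr_self, if_pos (by omega), Nat.sub_zero]
    exact ⟨fun t ht => by rw [this t ht, hB.eq_one_iff t ht],
      fun t ht => by rw [this t ht]; exact hB.zero_or_one t ht, hB.exists_key⟩
  refine Wp.seq_pow hX (Q₁ := fun τ => State R X κ A₀ τ ∧ τ.var 16 = s ∧
    τ.arr (R + 3) = σ.arr (R + 3) ∧
    Encodes V k (τ.arr (R + 1)) ((step β (pick k γ V))^[L] (F, s)).1) (a := 1 + (D + 5)) ?_ ?_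
  · have h := Wp.forLoop_pow (R := R) (low := low) (X := X) (x := 18) (b := 15) (σ := σ₂)
      (c := stepBody k γ β R) (D := D) L
      (fun i τ => State R X κ A₀ τ ∧ τ.var 16 = s ∧ τ.arr (R + 3) = σ.arr (R + 3) ∧
        Encodes V k (τ.arr (R + 1)) ((step β (pick k γ V))^[i] (F, s)).1 ∧
        τ.var 17 = ((step β (pick k γ V))^[i] (F, s)).2) hX hlL (by omega) (v15 hσ₂)
      (by
        refine ⟨hσ₂.setVar (nc 18 (by omega) (by omega)) (by rw [len_zero]; omega), ?_, ?_, hB₂, ?_⟩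
        · simpa [hσ₂def, hσ₁def, setVar_var, tabState_var] using h16
        · rw [setVar_arr, hσ₂def, tabState_arr_ne (by omega)]; rfl
        · simp [hσ₂def, hσ₁def, setVar_var, tabState_var])
      (by
        rintro i hi τ hx - ⟨hτ, hτ16, hτ3, hτB, hτ17⟩
        refine (hD X κ A₀ low V τ _ _ hctx h3 hτ hτB hτ17).mono le_rfl ?_
        rintro τ' ⟨h1, h2, h4, h5, h6, h7⟩
        refine ⟨by rw [h4, hx], v15 h1, h1.setVar (nc 18 (by omega) (by omega)) ?_, ?_, ?_, ?_, ?_⟩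
        · exact_mod_cast (len_natCast_mono (show i + 1 ≤ L by omega)).trans hlL
        · rw [setVar_var, if_neg (by omega), h2, hτ16]
        · rw [setVar_arr, h5, hτ3]
        · rw [setVar_arr, Function.iterate_succ_apply']; exact h6
        · rw [setVar_var, if_neg (by omega), Function.iterate_succ_apply']; exact h7)
    refine h.mono ?_ fun τ h => ⟨h.2.2.1, h.2.2.2.1, h.2.2.2.2.1, h.2.2.2.2.2.1⟩
    rw [pow_add X 1 (D + 5), pow_one]
    gcongr
  · rintro τ ⟨hτ, hτ16, hτ3, hτB⟩
    -- The list property for a capacity above `l` shows that every entry is `0` or at most `V ^ k`,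
    -- whether or not `l < cap`.
    have hlist : ∀ l, len (listVal V k (τ.arr (R + 1)) l) ≤ X := by
      intro l
      rcases (lists_of_encodes hτB (le_max_left _ (l + 1)) fun _ _ => rfl).zero_or l
        (by omega) with h | ⟨t, ht, -, h⟩
      · rw [h, len_zero]; omega
      · rw [h]; exact_mod_cast (len_natCast_mono (show t + 1 ≤ V ^ k by omega)).trans hlU
    refine (Wp.tab_pow hτ.bounded cap (s * cap) (listVal V k (τ.arr (R + 1))) (by omega)
      (by omega) (v14 hτ) hcX (fun i _ => ?_) (fun l _ => ?_) (fun l _ => hlist l)).mono le_rfl ?_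
    · simp [Ex.val, Ex.eval, Op.eval, tabState_var, hτ16, v14 hτ]
    · exact eval_list (ctx hτ) hτB (tabState_arr_ne (by omega)) l
    rintro _ rfl
    refine ⟨hτ.tabState (nc 21 (by omega) (by omega)) (by simp) hlc (fun l _ => hlist l), ?_,
      fun t ht => ?_, lists_of_encodes hτB hcap fun l hl => ?_⟩
    · simpa [tabState_var] using hτ16
    · rw [tabState_arr_self, if_neg (by omega), hτ3]
    · rw [tabState_arr_self, if_pos (by omega)]; congr 1; omega

end RAM

namespace RAM

open Finset Sparsification

/-! ## The examples and the unit weights -/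

/-- The literal with number `v` holds under the bits of `u`, which are the values of the first `E₁`
variables. -/
def LeftHolds (E₁ u v : ℕ) : Prop := v / 2 < E₁ ∧ u / 2 ^ (v / 2) % 2 = v % 2

/-- The literal with number `v` holds under the bits of `u`, which are the values of the variables
from number `E₁` on. -/
def RightHolds (E₁ u v : ℕ) : Prop := ¬ v / 2 < E₁ ∧ u / 2 ^ (v / 2 - E₁) % 2 = v % 2

/-- The number `y` is that of a clause without a literal that holds. -/
def Violates (V k : ℕ) (holds : ℕ → Prop) (y : ℤ) : Prop :=
  0 < y ∧ ∀ v < V, v ∈ keySet V k (y - 1).toNat → ¬ holds v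

/-- The support of the example with number `i`. -/
def LeftCond (V k S cap E₁ : ℕ) (y : ℕ → ℤ) (i c : ℕ) : Prop :=
  (c < cap ∧ Violates V k (LeftHolds E₁ (i / S)) (y (i % S * cap + c))) ∨
    ¬ c < cap ∧ ¬ i % S / 2 ^ ((c - cap) / 2) % 2 = (c - cap) % 2

/-- The support of the weights of the unit with number `j`. -/
def RightCond (V k S cap E₁ : ℕ) (y : ℕ → ℤ) (j c : ℕ) : Prop :=
  (c < cap ∧ Violates V k (RightHolds E₁ (j / S)) (y (j % S * cap + c))) ∨
    ¬ c < cap ∧ j % S / 2 ^ ((c - cap) / 2) % 2 = (c - cap) % 2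

/-- The expression for bit `q` of `t`. -/
def bitE (t q : ℕ) : Ex := .mod (.bin .div (.l t) (.pow (t + q + 1) 8 (.c 2) (.l q))) (.c 2)

/-- The expression for `LeftHolds`. -/
def leftE (u v : ℕ) : Ex :=
  .bind (u + v + 1) (.bin .div (.l v) (.c 2)) (.and (.lt (.l (u + v + 1)) (.g 27))
    (.eq (bitE u (u + v + 1)) (.mod (.l v) (.c 2))))

/-- The expression for `RightHolds`. -/
def rightE (u v : ℕ) : Ex :=
  .bind (u + v + 1) (.bin .div (.l v) (.c 2)) (.and (.not (.lt (.l (u + v + 1)) (.g 27)))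
    (.bind (u + v + 2) (.bin .sub (.l (u + v + 1)) (.g 27))
      (.eq (bitE u (u + v + 2)) (.mod (.l v) (.c 2)))))

/-- The common form of the expressions for the entries of the examples and of the unit weights. -/
def entryE (R : ℕ) (holds agree : Ex) : Ex :=
  .bind 0 (.bin .div (.g 21) (.g 13)) (.bind 1 (.mod (.g 21) (.g 13))
    (.bind 2 (.mod (.l 0) (.g 10)) (.bind 3 (.bin .div (.l 0) (.g 10))
      (.or (.and (.lt (.l 1) (.g 14))
        (.bind 4 (.arr (R + 3) (.bin .add (.bin .mul (.l 2) (.g 14)) (.l 1)))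
          (.and (.lt (.c 0) (.l 4)) (.bind 5 (.bin .sub (.l 4) (.c 1))
            (.all 6 1 (.imp (memE 6 5) (.not holds)))))))
        (.and (.not (.lt (.l 1) (.g 14))) (.bind 4 (.bin .sub (.l 1) (.g 14))
          (.bind 5 (.bin .div (.l 4) (.c 2)) agree)))))))

/-- The expression for the entry number `g 21` of the matrix of the examples. -/
def xE (R : ℕ) : Ex := entryE R (leftE 3 6) (.not (.eq (bitE 2 5) (.mod (.l 4) (.c 2))))

/-- The expression for the entry number `g 21` of the matrix of the unit weights. -/
def wE (R : ℕ) : Ex := .bin .mul (.bin .sub (.c 0) (.g 25))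
  (entryE R (rightE 3 6) (.eq (bitE 2 5) (.mod (.l 4) (.c 2))))

section

variable {G : ℕ → ℤ} {A : ℕ → ℕ → ℤ} {ρ : ℕ → ℤ} {k V E E₁ : ℕ}

theorem eval_bit (h8 : G 8 = E) {t q T Q : ℕ} (ht : ρ t = T) (hq : ρ q = Q) (hQ : Q ≤ E) :
    (bitE t q).eval G A ρ = (T / 2 ^ Q % 2 : ℕ) := by
  refine eval_mod (eval_div (eval_l ht) ?_) rfl
  rw [eval_pow (n := E) (j := Q) (v := 2) h8 hQ (fun _ _ => rfl)
    fun i _ => eval_l (update_eq_of_ne hq (by omega))]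
  push_cast
  rfl

theorem Tr.left (h8 : G 8 = E) (h27 : G 27 = E₁) {u v U W : ℕ} (hu : ρ u = U) (hv : ρ v = W)
    (hW : W / 2 ≤ E) : Tr G A ρ (leftE u v) (LeftHolds E₁ U W) := by
  unfold leftE Tr
  rw [Ex.eval, eval_div (y := 2) (eval_l hv) rfl]
  exact ((Tr.lt (x := (W / 2 : ℕ)) eval_l_self (eval_g h27)).iff Nat.cast_lt).and
    fun _ => (Tr.eq (eval_bit h8 (update_eq_of_ne hu (by omega)) (Function.update_self ..) hW)
      (eval_mod (y := 2) (eval_l (update_eq_of_ne hv (by omega))) rfl)).iff Nat.cast_inj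

theorem Tr.right (h8 : G 8 = E) (h27 : G 27 = E₁) {u v U W : ℕ} (hu : ρ u = U) (hv : ρ v = W)
    (hW : W / 2 ≤ E) : Tr G A ρ (rightE u v) (RightHolds E₁ U W) := by
  unfold rightE Tr
  rw [Ex.eval, eval_div (y := 2) (eval_l hv) rfl]
  refine ((Tr.lt (x := (W / 2 : ℕ)) eval_l_self (eval_g h27)).iff
    Nat.cast_lt).not.and fun h => ?_
  have h1 : (Ex.bin .sub (.l (u + v + 1)) (.g 27)).eval G A
      (Function.update ρ (u + v + 1) ((W / 2 : ℕ) : ℤ)) = (W / 2 - E₁ : ℕ) := by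
    simp only [Ex.eval, Op.eval, Function.update_self, h27]; omega
  unfold Tr
  rw [Ex.eval, h1]
  exact (Tr.eq (eval_bit h8 (update_eq_of_ne (update_eq_of_ne hu (by omega)) (by omega))
    (Function.update_self ..) (by omega)) (eval_mod (y := 2)
      (eval_l (update_eq_of_ne (update_eq_of_ne hv (by omega)) (by omega))) rfl)).iff Nat.cast_inj

theorem Tr.entry (hc : Ctx G k V) {R S cap d t : ℕ} {y : ℕ → ℤ} {holds agree : Ex}
    {H B : ℕ → ℕ → Prop} (h10 : G 10 = S) (h13 : G 13 = d) (h14 : G 14 = cap)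
    (h21 : G 21 = t) (hA : A (R + 3) = y)
    (hy : t % d < cap → y (t / d % S * cap + t % d) = 0 ∨
      ∃ T, T < V ^ k ∧ y (t / d % S * cap + t % d) = T + 1)
    (hH : ∀ v < V, ∀ ρ' : ℕ → ℤ, ρ' 3 = (t / d / S : ℕ) → ρ' 6 = v →
      Tr G A ρ' holds (H (t / d / S) v))
    (hB : ¬ t % d < cap → ∀ ρ' : ℕ → ℤ, ρ' 2 = (t / d % S : ℕ) → ρ' 4 = (t % d - cap : ℕ) →
      ρ' 5 = ((t % d - cap) / 2 : ℕ) → Tr G A ρ' agree (B (t / d % S) (t % d - cap))) :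
    Tr G A ρ (entryE R holds agree)
      ((t % d < cap ∧ Violates V k (H (t / d / S)) (y (t / d % S * cap + t % d))) ∨
        ¬ t % d < cap ∧ B (t / d % S) (t % d - cap)) := by
  unfold entryE Tr
  rw [Ex.eval, eval_div (eval_g h21) (eval_g h13), Ex.eval, eval_mod (eval_g h21) (eval_g h13),
    Ex.eval, eval_mod (x := t / d) (eval_l (by simp)) (eval_g h10),
    Ex.eval, eval_div (x := t / d) (eval_l (by simp)) (eval_g h10)]
  set ρ' : ℕ → ℤ := Function.update (Function.update (Function.update (Function.update ρ 0
    ((t / d : ℕ) : ℤ)) 1 ((t % d : ℕ) : ℤ)) 2 ((t / d % S : ℕ) : ℤ)) 3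
    ((t / d / S : ℕ) : ℤ) with hρ'
  have r1 : ρ' 1 = (t % d : ℕ) := by simp [hρ']
  have r2 : ρ' 2 = (t / d % S : ℕ) := by simp [hρ']
  have r3 : ρ' 3 = (t / d / S : ℕ) := by simp [hρ']
  clear_value ρ'
  have hlt : Tr G A ρ' (.lt (.l 1) (.g 14)) (t % d < cap) :=
    (Tr.lt (eval_l r1) (eval_g h14)).iff Nat.cast_lt
  refine (hlt.and fun h => ?_).or fun _ => hlt.not.and fun h => ?_
  · have h4 : (Ex.arr (R + 3) (.bin .add (.bin .mul (.l 2) (.g 14)) (.l 1))).eval G A ρ' =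
        y (t / d % S * cap + t % d) := by
      simp only [Ex.eval, Op.eval, r1, r2, h14, hA]
      norm_cast
    unfold Tr
    rw [Ex.eval, h4]
    refine (Tr.lt (x := 0) rfl eval_l_self).and fun hpos => ?_
    obtain ⟨T, hT, hyT⟩ := (hy h).resolve_left hpos.ne'
    have h5 : (Ex.bin .sub (.l 4) (.c 1)).eval G A
        (Function.update ρ' 4 (y (t / d % S * cap + t % d))) = T := by
      simp only [Ex.eval, Op.eval, Function.update_self, hyT]; omega
    unfold Tr
    rw [Ex.eval, h5, hyT, show ((T : ℤ) + 1 - 1).toNat = T by omega]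
    exact Tr.all (n := V) hc.V_eq fun v hv =>
      (Tr.mem hc (by simp) (Function.update_self ..)).imp fun _ =>
        (hH v hv _ (by simp [r3]) (Function.update_self ..)).not
  · have h4 : (Ex.bin .sub (.l 1) (.g 14)).eval G A ρ' = (t % d - cap : ℕ) := by
      simp only [Ex.eval, Op.eval, r1, h14]; omega
    unfold Tr
    rw [Ex.eval, h4, Ex.eval, eval_div (x := t % d - cap) (y := 2) (eval_l (by simp)) rfl]
    exact hB h _ (by simp [r2]) (by simp) (by simp)

theorem Tr.x (hc : Ctx G k V) {R S cap d t : ℕ} {y : ℕ → ℤ} (h8 : G 8 = E) (h10 : G 10 = S)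
    (h13 : G 13 = d) (h14 : G 14 = cap) (h21 : G 21 = t) (h27 : G 27 = E₁) (hA : A (R + 3) = y)
    (hy : t % d < cap → y (t / d % S * cap + t % d) = 0 ∨
      ∃ T, T < V ^ k ∧ y (t / d % S * cap + t % d) = T + 1)
    (hV : V ≤ 2 * E) (hd : (t % d - cap) / 2 ≤ E) :
    Tr G A ρ (xE R) (LeftCond V k S cap E₁ y (t / d) (t % d)) := by
  refine Tr.entry (H := LeftHolds E₁) (B := fun s c => ¬ s / 2 ^ (c / 2) % 2 = c % 2) hc h10 h13
    h14 h21 hA hy (fun v hv ρ' h3 h6 => Tr.left h8 h27 h3 h6 (by omega))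
    fun _ ρ' h2 h4 h5 => ((Tr.eq (eval_bit h8 h2 h5 hd) (eval_mod (eval_l h4) rfl)).iff ?_).not
  exact Nat.cast_inj

theorem Tr.w (hc : Ctx G k V) {R S cap d t : ℕ} {y : ℕ → ℤ} (h8 : G 8 = E) (h10 : G 10 = S)
    (h13 : G 13 = d) (h14 : G 14 = cap) (h21 : G 21 = t) (h27 : G 27 = E₁) (hA : A (R + 3) = y)
    (hy : t % d < cap → y (t / d % S * cap + t % d) = 0 ∨
      ∃ T, T < V ^ k ∧ y (t / d % S * cap + t % d) = T + 1)
    (hV : V ≤ 2 * E) (hd : (t % d - cap) / 2 ≤ E) :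
    Tr G A ρ (entryE R (rightE 3 6) (.eq (bitE 2 5) (.mod (.l 4) (.c 2))))
      (RightCond V k S cap E₁ y (t / d) (t % d)) := by
  refine Tr.entry (H := RightHolds E₁) (B := fun s c => s / 2 ^ (c / 2) % 2 = c % 2) hc h10 h13
    h14 h21 hA hy (fun v hv ρ' h3 h6 => Tr.right h8 h27 h3 h6 (by omega))
    fun _ ρ' h2 h4 h5 => (Tr.eq (eval_bit h8 h2 h5 hd) (eval_mod (eval_l h4) rfl)).iff ?_
  exact Nat.cast_inj

end

end RAM

namespace RAM

open Finset Sparsification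

/-! ## The preparation of the instance -/

theorem Wp.get {R : ℕ} {low : ℕ → ℤ} {σ : Memory} {x y X : ℕ} (hx : x < R) (hX : 2 ≤ X)
    (h : len (low x) ≤ X) :
    Wp R low (copy (gv R y) x) (X ^ 4) σ (· = σ.setVar y (low x)) := by
  intro s hs
  obtain ⟨s', he, ha, hv, hf⟩ := exec_copy s (x := gv R y) (y := x) (by simp only [gv]; omega)
  refine ⟨s', _, _, he, ?_, ⟨fun z => ?_, by rw [ha, hs.2.1]; rfl, fun z hz => ?_⟩, rfl⟩
  · rw [hs.2.2 x hx]
    have h1 := eight_mul_pow_le (a := 1) hX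
    rw [pow_one] at h1
    exact le_trans (by omega) h1
  · rw [setVar_var]
    split_ifs with hz
    · rw [hz, hv, hs.2.2 x hx]
    · rw [hf _ (by rwa [Ne, gv_inj]), hs.1]
  · rw [hf z (by simp only [gv]; omega), hs.2.2 z hz]

/-- A sequence of assignments. -/
def assigns (R : ℕ) : List (ℕ × Ex) → Program
  | [] => .const (tv R 0) 0
  | p :: l => .seq (assign R p.1 p.2) (assigns R l)

/-- The exponent of a polynomial bound for the cost of a sequence of assignments. -/
def assignsDeg : List (ℕ × Ex) → ℕ
  | [] => 1
  | p :: l => p.2.deg + 3 + assignsDeg l + 1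

/-- The sequence of assignments assigns the values `κ`. -/
def Assigns (κ : ℕ → ℤ) : List (ℕ × Ex) → Memory → Prop
  | [], _ => True
  | p :: l, σ => p.2.val σ = κ p.1 ∧ Assigns κ l (σ.setVar p.1 (κ p.1))

theorem Wp.assigns {R : ℕ} {low : ℕ → ℤ} {X : ℕ} {κ : ℕ → ℤ} (hκ : ∀ x, len (κ x) ≤ X)
    (hs : ∀ x < 10, κ x ≤ X) {l : List (ℕ × Ex)} {σ : Memory} (hσ : Bounded X σ)
    (h : Assigns κ l σ) : Wp R low (assigns R l) (X ^ assignsDeg l) σ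
      (· = l.foldl (fun τ p => τ.setVar p.1 (κ p.1)) σ) := by
  induction l generalizing σ with
  | nil =>
    intro s hs
    refine ⟨_, _, σ, Exec.const _ _ _, ?_, hs.setVar_tv _ _, rfl⟩
    simpa [len_zero, assignsDeg] using hσ.two_le
  | cons p l ih =>
    refine Wp.seq_pow hσ.two_le (Wp.assign hσ _ _) ?_
    rintro _ rfl
    rw [h.1]
    exact ih (hσ.setVar (hκ _) (hs _)) h.2

/-- In use `Y` is `n + m`: the factor allows for loops over the exponentially many codes, examples
and units, while `X` bounds lengths and polynomial quantities. -/
theorem Wp.seq_mul {R : ℕ} {low : ℕ → ℤ} {c₁ c₂ : Program} {X Y a b : ℕ} {σ : Memory}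
    {Q₁ Q : Memory → Prop} (hX : 2 ≤ X) (h₁ : Wp R low c₁ (Y * X ^ a) σ Q₁)
    (h₂ : ∀ σ', Q₁ σ' → Wp R low c₂ (Y * X ^ b) σ' Q) :
    Wp R low (.seq c₁ c₂) (Y * X ^ (a + b + 1)) σ Q := by
  refine (h₁.seq h₂).mono ?_ fun _ h => h
  have h1 := pow_le_of_le hX (show a ≤ a + b by omega)
  have h2 := pow_le_of_le hX (show b ≤ a + b by omega)
  have h3 : X ^ (a + b) * 2 ≤ X ^ (a + b) * X := Nat.mul_le_mul_left _ hX
  rw [← mul_add, pow_succ]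
  gcongr
  omega

theorem Wp.of_pow {R : ℕ} {low : ℕ → ℤ} {c : Program} {X Y a : ℕ} {σ : Memory}
    {Q : Memory → Prop} (h : Wp R low c (X ^ a) σ Q) (hY : 1 ≤ Y) :
    Wp R low c (Y * X ^ a) σ Q :=
  h.mono (Nat.le_mul_of_pos_left _ hY) fun _ h => h

theorem Wp.tab_mul {R : ℕ} {low : ℕ → ℤ} {X Y : ℕ} {σ : Memory} (hσ : Bounded X σ) {a x b : ℕ}
    {e f : Ex} (n base : ℕ) (v : ℕ → ℤ) (hx : 10 ≤ x) (hxb : b ≠ x) (hb : σ.var b = n)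
    (hY : 1 ≤ Y) (hnX : n ≤ Y * X) (he : ∀ i < n, e.val (tabState σ a x base v i) = base + i)
    (hf : ∀ i < n, f.val (tabState σ a x base v i) = v i) (hv : ∀ i < n, len (v i) ≤ X) :
    Wp R low (RAM.tab R a x b e f) (Y * X ^ (e.deg + f.deg + 9)) σ
      (· = tabState σ a x base v n) := by
  refine (Wp.tab hσ n base v hx hxb hb he hf hv).mono ?_ fun _ h => h
  have h1 : n * X ^ (e.deg + f.deg + 7) ≤ Y * X * X ^ (e.deg + f.deg + 7) :=
    Nat.mul_le_mul_right _ hnX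
  have h2 : Y * X ^ (e.deg + f.deg + 8) = Y * X * X ^ (e.deg + f.deg + 7) := by ring
  have h3 := pow_le_of_le hσ.two_le (show 4 ≤ e.deg + f.deg + 8 by omega)
  have h4 : Y * X ^ (e.deg + f.deg + 8) * 2 ≤ Y * X ^ (e.deg + f.deg + 8) * X :=
    Nat.mul_le_mul_left _ hσ.two_le
  have h5 : Y * X ^ (e.deg + f.deg + 9) = Y * X ^ (e.deg + f.deg + 8) * X := by ring
  have h6 : X ^ (e.deg + f.deg + 8) ≤ Y * X ^ (e.deg + f.deg + 8) := Nat.le_mul_of_pos_left _ hY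
  omega

/-- The constants of the reduction. -/
structure Consts where
  k : ℕ
  γ : ℕ
  b : ℕ
  p : ℕ
  q : ℕ
  Z : ℕ
  h : ℕ
  r₀ : ℕ
  cap₁ : ℕ
  L₁ : ℕ

namespace Consts

variable (K : Consts) (N M : ℕ)

/-- The number of digits of the codes. -/
def a : ℕ := N / K.Z + 1
/-- The number of digits of the indices. -/
def r : ℕ := K.h * K.a N + K.r₀
/-- A bound for the numbers of bits. -/
def E : ℕ := K.b * (K.p + K.q) * K.r N
/-- The number of codes. -/
def S : ℕ := 2 ^ (K.b * K.a N)
/-- The number of units. -/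
def n : ℕ := 2 ^ (K.b * K.q * K.r N)
/-- The number of examples. -/
def m : ℕ := 2 ^ (K.b * K.p * K.r N)
/-- The length of the lists of clauses. -/
def cap : ℕ := K.cap₁ * K.a N
/-- The number of steps of the sparsification. -/
def L : ℕ := K.L₁ * K.a N + 1
/-- The dimension. -/
def d : ℕ := K.cap N + 2 * (K.b * K.a N)
/-- The absolute value of the weights. -/
def W : ℕ := K.b * K.p * K.r N + 5
/-- The number of the variables that are assigned by the examples. -/
def E₁ : ℕ := K.b * K.p * K.r N - K.b * K.a N

/-- The values of the constant global variables. -/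
def glob : ℕ → ℕ
  | 0 => K.k
  | 1 => 2 * N
  | 2 => (2 * N) ^ K.k
  | 3 => (K.k + 1) * (K.k + 1) * (2 * N) ^ K.k
  | 4 => M
  | 5 => N
  | 6 => K.a N
  | 7 => K.r N
  | 8 => K.E N
  | 10 => K.S N
  | 11 => K.n N
  | 12 => K.m N
  | 13 => K.d N
  | 14 => K.cap N
  | 15 => K.L N
  | 22 => K.m N * K.d N
  | 23 => K.n N * K.d N
  | 24 => M * K.k
  | 25 => K.W N
  | 27 => K.E₁ N
  | 28 => K.b * K.a N
  | _ => 0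

/-- The initialization of the constant global variables. -/
def init : List (ℕ × Ex) :=
  [(0, .c K.k), (1, .bin .mul (.c 2) (.g 5)), (2, .pow 0 0 (.g 1) (.g 0)),
    (3, .bin .mul (.c ((K.k + 1) * (K.k + 1))) (.g 2)),
    (6, .bin .add (.bin .div (.g 5) (.c K.Z)) (.c 1)),
    (7, .bin .add (.bin .mul (.c K.h) (.g 6)) (.c K.r₀)),
    (8, .bin .mul (.c (K.b * (K.p + K.q))) (.g 7)), (28, .bin .mul (.c K.b) (.g 6)),
    (10, .pow 0 8 (.c 2) (.g 28)), (11, .pow 0 8 (.c 2) (.bin .mul (.c (K.b * K.q)) (.g 7))),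
    (12, .pow 0 8 (.c 2) (.bin .mul (.c (K.b * K.p)) (.g 7))), (14, .bin .mul (.c K.cap₁) (.g 6)),
    (13, .bin .add (.g 14) (.bin .mul (.c 2) (.g 28))),
    (15, .bin .add (.bin .mul (.c K.L₁) (.g 6)) (.c 1)), (22, .bin .mul (.g 12) (.g 13)),
    (23, .bin .mul (.g 11) (.g 13)), (24, .bin .mul (.g 4) (.g 0)),
    (25, .bin .add (.bin .mul (.c (K.b * K.p)) (.g 7)) (.c 5)),
    (27, .bin .sub (.bin .mul (.c (K.b * K.p)) (.g 7)) (.g 28))]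

/-- The constants are sensible. -/
structure Good : Prop where
  γ_pos : 1 ≤ K.γ
  p_pos : 1 ≤ K.p
  q_pos : 1 ≤ K.q
  h_pos : 1 ≤ K.h
  cap₁_pos : 1 ≤ K.cap₁

variable {K}

theorem Good.a_le_r (h : K.Good) : K.a N ≤ K.r N :=
  (Nat.le_mul_of_pos_left _ h.h_pos).trans (Nat.le_add_right _ _)

theorem Good.ba_le_p (h : K.Good) : K.b * K.a N ≤ K.b * K.p * K.r N := by
  rw [mul_assoc]
  exact Nat.mul_le_mul_left _ ((h.a_le_r N).trans (Nat.le_mul_of_pos_left _ h.p_pos))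

theorem Good.ba_le_q (h : K.Good) : K.b * K.a N ≤ K.b * K.q * K.r N := by
  rw [mul_assoc]
  exact Nat.mul_le_mul_left _ ((h.a_le_r N).trans (Nat.le_mul_of_pos_left _ h.q_pos))

theorem p_le_E : K.b * K.p * K.r N ≤ K.E N :=
  Nat.mul_le_mul_right _ (Nat.mul_le_mul_left _ (Nat.le_add_right _ _))

theorem q_le_E : K.b * K.q * K.r N ≤ K.E N :=
  Nat.mul_le_mul_right _ (Nat.mul_le_mul_left _ (Nat.le_add_left _ _))

theorem val_pow {τ : Memory} {b : Fin 10} {v : ℤ} {B j : ℕ} {f e : Ex} (hb : τ.var b = B)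
    (hj : j ≤ B) (hf : ∀ ρ, f.eval τ.var τ.arr ρ = v) (he : ∀ ρ, e.eval τ.var τ.arr ρ = j) :
    (Ex.pow 0 b f e).val τ = v ^ j :=
  eval_pow hb hj (fun _ _ => hf _) fun _ _ => he _

theorem Good.assigns (h : K.Good) (A : ℕ → ℕ → ℤ) :
    Assigns (fun x => (K.glob N M x : ℤ)) K.init
      (((⟨fun _ => 0, A⟩ : Memory).setVar 5 N).setVar 4 M) := by
  -- The powers of two are folds bounded by variable `8`, which holds `E`, so their exponents must
  -- not exceed `E`.
  have hE := (h.ba_le_p N).trans (p_le_E N)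
  have h27 : ((K.E₁ N : ℕ) : ℤ) = K.b * K.p * K.r N - K.b * K.a N := by
    rw [E₁, Nat.cast_sub (h.ba_le_p N)]; push_cast; rfl
  refine ⟨rfl, ?_, ?_, ?_, ?_, ?_, ?_, ?_, ?_, ?_, ?_, ?_, ?_, ?_, ?_, ?_, ?_, ?_, ?_, trivial⟩
  case refine_2 =>
    exact (val_pow (B := K.k) (j := K.k) (v := (2 * N : ℕ)) (by simp [setVar_var, glob]) le_rfl
      (by simp [Ex.eval, setVar_var, glob]) (by simp [Ex.eval, setVar_var, glob])).trans
      (by simp [glob])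
  case refine_8 =>
    exact (val_pow (B := K.E N) (j := K.b * K.a N) (v := 2) (by simp [setVar_var, glob]) hE
      (by simp [Ex.eval]) (by simp [Ex.eval, setVar_var, glob])).trans (by simp [glob, S])
  case refine_9 =>
    exact (val_pow (B := K.E N) (j := K.b * K.q * K.r N) (v := 2) (by simp [setVar_var, glob])
      (q_le_E N) (by simp [Ex.eval]) (by simp [Ex.eval, Op.eval, setVar_var, glob])).trans
      (by simp [glob, n])
  case refine_10 =>
    exact (val_pow (B := K.E N) (j := K.b * K.p * K.r N) (v := 2) (by simp [setVar_var, glob])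
      (p_le_E N) (by simp [Ex.eval]) (by simp [Ex.eval, Op.eval, setVar_var, glob])).trans
      (by simp [glob, m])
  all_goals
    simp [Ex.val, Ex.eval, Op.eval, setVar_var, glob, a, r, E, cap, d, L, W, h27]

/-- The state after the initialization. -/
def initState (K : Consts) (N M : ℕ) (A : ℕ → ℕ → ℤ) : Memory :=
  K.init.foldl (fun τ p => τ.setVar p.1 (K.glob N M p.1 : ℤ))
    (((⟨fun _ => 0, A⟩ : Memory).setVar 5 N).setVar 4 M)

theorem foldl_setVar_var (κ : ℕ → ℤ) (l : List (ℕ × Ex)) (σ : Memory) (x : ℕ) :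
    (l.foldl (fun τ p => τ.setVar p.1 (κ p.1)) σ).var x =
      if x ∈ l.map Prod.fst then κ x else σ.var x := by
  induction l generalizing σ with
  | nil => simp
  | cons p l ih =>
    simp only [List.foldl_cons, ih, setVar_var, List.map_cons, List.mem_cons]
    by_cases h1 : x ∈ l.map Prod.fst
    · simp [h1]
    · by_cases h2 : x = p.1 <;> simp [h1, h2]

theorem initState_var (A : ℕ → ℕ → ℤ) (x : ℕ) : (initState K N M A).var x = K.glob N M x := by
  have hl : K.init.map Prod.fst =
      [0, 1, 2, 3, 6, 7, 8, 28, 10, 11, 12, 14, 13, 15, 22, 23, 24, 25, 27] := rfl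
  rw [initState, foldl_setVar_var (fun x => (K.glob N M x : ℤ)), hl]
  split_ifs with h
  · rfl
  · simp only [List.mem_cons, List.not_mem_nil, or_false, not_or] at h
    rw [setVar_var, setVar_var]
    split_ifs with h4 h5
    · rw [h4, glob]
    · rw [h5, glob]
    · rw [glob] <;> simp_all

end Consts

end RAM

/-- The number of the literal `l` of clause `c`: the literals of variable `v` are `2 v + 1`
(positive) and `2 v`. -/
def KCNF.code {k : ℕ} (φ : KCNF k) (c l : ℕ) : ℕ :=
  if h : c < φ.numClauses ∧ l < k then
    2 * (φ.lit ⟨c, h.1⟩ ⟨l, h.2⟩).1 + if (φ.lit ⟨c, h.1⟩ ⟨l, h.2⟩).2 then 1 else 0 else 0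

/-- The minimal clauses. -/
def KCNF.family {k : ℕ} (φ : KCNF k) : Finset (Finset ℕ) :=
  Sparsification.minimals
    ((Finset.range φ.numClauses).image fun c => (Finset.range k).image (φ.code c))

theorem KCNF.code_lt {k : ℕ} (φ : KCNF k) {c l : ℕ} (hc : c < φ.numClauses) (hl : l < k) :
    φ.code c l < 2 * φ.numVars := by
  rw [code, dif_pos ⟨hc, hl⟩]
  have := (φ.lit ⟨c, hc⟩ ⟨l, hl⟩).1.isLt
  split_ifs <;> omega

theorem KCNF.input_arr_zero {k : ℕ} (φ : KCNF k) {c l : ℕ} (hc : c < φ.numClauses) (hl : l < k) :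
    φ.input.arr 0 (c * k + l) = if φ.code c l % 2 = 1 then ((φ.code c l / 2 : ℕ) : ℤ) + 1
      else -(((φ.code c l / 2 : ℕ) : ℤ) + 1) := by
  have h1 : (c * k + l) / k = c := by
    rw [mul_comm, Nat.mul_add_div (by omega), Nat.div_eq_of_lt hl, add_zero]
  have h2 : (c * k + l) % k = l := by
    rw [mul_comm, Nat.mul_add_mod, Nat.mod_eq_of_lt hl]
  have h3 : (c * k + l) / k < φ.numClauses ∧ (c * k + l) % k < k := by rw [h1, h2]; exact ⟨hc, hl⟩
  rw [input, code, dif_pos ⟨hc, hl⟩]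
  simp only [if_true, RAM.ofMat]
  rw [dif_pos h3]
  simp only [h1, h2]
  split_ifs <;> omega

theorem KCNF.input_arr_of_mul_le {k : ℕ} (φ : KCNF k) {t : ℕ} (ht : φ.numClauses * k ≤ t) :
    φ.input.arr 0 t = 0 := by
  simp only [input, if_true, RAM.ofMat]
  refine dif_neg fun h => ?_
  have hk : 0 < k := (Nat.zero_le _).trans_lt h.2
  exact absurd ((Nat.div_lt_iff_lt_mul hk).1 h.1) (by omega)

namespace RAM

open Finset Sparsification

theorem len_input_le {k : ℕ} (φ : KCNF k) (a t : ℕ) :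
    len (φ.input.arr a t) ≤ len (φ.numVars : ℤ) := by
  simp only [KCNF.input]
  split_ifs with ha
  · rw [ofMat]
    split_ifs with h h'
    all_goals refine len_le_of_natAbs_le ?_
    · have := (φ.lit ⟨t / k, h.1⟩ ⟨t % k, h.2⟩).1.isLt; omega
    · have := (φ.lit ⟨t / k, h.1⟩ ⟨t % k, h.2⟩).1.isLt; omega
    · simp
  · exact len_le_of_natAbs_le (by simp)

theorem Lists.congr {V k cap : ℕ} {y y' : ℕ → ℤ} {F : Finset (Finset ℕ)} (h : Lists V k cap y F)
    (hy : ∀ l < cap, y' l = y l) : Lists V k cap y' F :=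
  ⟨fun l hl => by rw [hy l hl]; exact h.zero_or l hl, fun Z hZ => by
    obtain ⟨l, hl, t, ht, h1, h2⟩ := h.exists_index Z hZ
    exact ⟨l, hl, t, ht, h1, by rw [hy l hl, h2]⟩⟩

namespace Consts

/-- `X` bounds the bit lengths and the small values. -/
structure Fits (K : Consts) (N M X : ℕ) : Prop where
  two_le : 2 ≤ X
  len_glob : ∀ x, len (K.glob N M x : ℤ) ≤ X
  small : ∀ x < 10, K.glob N M x ≤ X
  L_le : K.L N + 1 ≤ X
  cap_le : K.cap N ≤ X
  d_le : K.d N ≤ X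
  input_le : M * K.k ≤ X

/-- The family of clauses of the sparse formula with code `s`. -/
noncomputable def family (K : Consts) (φ : KCNF K.k) (s : ℕ) : Finset (Finset ℕ) :=
  ((step (2 ^ K.b) (pick K.k K.γ (2 * φ.numVars)))^[K.L φ.numVars] (φ.family, s)).1

/-- The program for the preparation of the instance. -/
def prep (K : Consts) (R : ℕ) : Program :=
  .seq (copy (gv R 5) 0) (.seq (copy (gv R 4) 1) (.seq (RAM.assigns R K.init)
    (.seq (tab R R 21 2 (.g 21) initE) (.seq (forLoop R 16 10 (codeBody K.k K.γ (2 ^ K.b) R))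
      (.seq (tab R 0 21 24 (.g 21) (.c 0)) (.seq (tab R 0 21 22 (.g 21) (xE R))
        (.seq (tab R 1 21 23 (.g 21) (wE R)) (tab R 2 21 12 (.g 21) (.c 1)))))))))

open Classical in
/-- The prepared instance, given the table `y` of the lists of clauses. -/
noncomputable def inst (K : Consts) (N : ℕ) (y : ℕ → ℤ) : GradInstance where
  n := K.n N
  m := K.m N
  d := K.d N
  x := fun i c => if LeftCond (2 * N) K.k (K.S N) (K.cap N) (K.E₁ N) y i c then 1 else 0
  y := fun _ => 1
  w := fun j c => if RightCond (2 * N) K.k (K.S N) (K.cap N) (K.E₁ N) y j c then -(K.W N : ℤ) else 0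
  α := fun _ => 0

theorem S_pos (K : Consts) (N : ℕ) : 0 < K.S N := by rw [S]; positivity

theorem Good.d_pos {K : Consts} (hK : K.Good) (N : ℕ) : 0 < K.d N := by
  have : 0 < K.cap N := Nat.mul_pos hK.cap₁_pos (Nat.succ_pos _)
  rw [d]; omega

theorem ofMat_eq {m d : ℕ} (hd : 0 < d) (f : ℕ → ℕ → ℤ) (t : ℕ) :
    ofMat (m := m) (d := d) (fun i c => f i c) t = if t < m * d then f (t / d) (t % d) else 0 := by
  rw [ofMat]
  by_cases h : t < m * d
  · rw [if_pos h, dif_pos ⟨(Nat.div_lt_iff_lt_mul hd).2 h, Nat.mod_lt _ hd⟩]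
  · rw [if_neg h, dif_neg fun h' => h ((Nat.div_lt_iff_lt_mul hd).1 h'.1)]

theorem exists_wp_prep (K : Consts) (hK : K.Good) (R : ℕ) (hR : 6 ≤ R) : ∃ D, ∀ (φ : KCNF K.k)
    (X : ℕ), K.Fits φ.numVars φ.numClauses X → φ.numVars ≤ K.E φ.numVars →
    (∀ s < K.S φ.numVars, #(K.family φ s) ≤ K.cap φ.numVars) →
    Wp R φ.input.var (K.prep R) ((K.n φ.numVars + K.m φ.numVars) * X ^ D)
      ⟨fun _ => 0, φ.input.arr⟩ fun σ' => ∃ y : ℕ → ℤ,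
        (∀ s < K.S φ.numVars, Lists (2 * φ.numVars) K.k (K.cap φ.numVars)
          (fun l => y (s * K.cap φ.numVars + l)) (K.family φ s)) ∧
        (∀ a < R, σ'.arr a = (K.inst φ.numVars y).input.arr a) ∧
        σ'.var 26 = 0 ∧ σ'.var 11 = K.n φ.numVars ∧ σ'.var 12 = K.m φ.numVars ∧
        σ'.var 13 = K.d φ.numVars := by
  obtain ⟨D, hD⟩ := exists_wp_codeBody K.k K.γ (2 ^ K.b) R hK.γ_pos
  refine ⟨4 + (4 + (assignsDeg K.init + ((Ex.g 21).deg + initE.deg + 9 + (D + 6 +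
    ((Ex.g 21).deg + (Ex.c 0).deg + 9 + ((Ex.g 21).deg + (xE R).deg + 9 +
    ((Ex.g 21).deg + (wE R).deg + 9 + ((Ex.g 21).deg + (Ex.c 1).deg + 9) + 1) + 1) + 1) + 1) + 1)
      + 1) + 1) + 1, ?_⟩
  intro φ X hX hNE hcap
  set N := φ.numVars with hN
  set M := φ.numClauses with hM
  set κ : ℕ → ℤ := fun x => (K.glob N M x : ℤ) with hκ
  have hX2 := hX.two_le
  have hY : 1 ≤ K.n N + K.m N := by
    have : 0 < K.n N := by rw [n]; positivity
    omega
  have hctx : Ctx κ K.k (2 * N) := ⟨rfl, rfl, rfl⟩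
  have hlκ : ∀ x, len (κ x) ≤ X := hX.len_glob
  have hsm : ∀ x < 10, κ x ≤ X := fun x hx => Nat.cast_le.2 (hX.small x hx)
  have hl : ∀ a t, len (φ.input.arr a t) ≤ X := fun a t => (len_input_le φ a t).trans (hlκ 5)
  have h0 : Bounded X ⟨fun _ => 0, φ.input.arr⟩ :=
    ⟨hX2, fun _ => by rw [len_zero]; omega, hl, fun _ _ => by simp⟩
  refine Wp.seq_mul hX2 ((Wp.get (x := 0) (by omega) hX2 (hlκ 5)).of_pow hY) ?_
  rintro _ rfl
  refine Wp.seq_mul hX2 ((Wp.get (x := 1) (by omega) hX2 (hlκ 4)).of_pow hY) ?_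
  rintro _ rfl
  have h2 := (h0.setVar (hlκ 5) (hsm 5)).setVar (hlκ 4) (hsm 4)
  refine Wp.seq_mul hX2 ((Wp.assigns hlκ hsm h2 (hK.assigns N M _)).of_pow hY) ?_
  rintro _ rfl
  change Wp R _ _ _ (initState K N M φ.input.arr) _
  have hv₃ : (initState K N M φ.input.arr).var = κ := funext fun x => initState_var N M _ x
  have ha₃ : (initState K N M φ.input.arr).arr = φ.input.arr := rfl
  set σ₃ := initState K N M φ.input.arr
  have hσ₃ : Bounded X σ₃ := ⟨hX2, fun x => by rw [hv₃]; exact hlκ x, by rwa [ha₃],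
    fun x hx => by rw [hv₃]; exact hsm x hx⟩
  -- the bitmap of the minimal clauses
  obtain ⟨hkey, htr⟩ := Tr.init (G := κ) hctx (M := M) (lit := φ.code) (B := φ.input.arr 0) rfl
    (fun c hc l hl => φ.code_lt hc hl) fun c hc l hl => φ.input_arr_zero hc hl
  refine Wp.seq_mul hX2 (Wp.tab_mul hσ₃ ((2 * N) ^ K.k) 0 (bitmap (2 * N) K.k φ.family) (by omega)
    (by omega) (by rw [hv₃]; rfl) hY ((hX.small 2 (by omega)).trans (Nat.le_mul_of_pos_left _ hY))
    (fun i _ => by simp [Ex.val, Ex.eval, tabState_var]) (fun t ht => ?_)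
    (fun _ _ => len_bitmap hX2)) ?_
  · classical
    rw [bitmap]
    have := (htr t ht (RAM.tabState σ₃ R 21 0 (bitmap (2 * N) K.k φ.family) t).arr (fun _ => 0)
      (tabState_arr_ne (by omega))).eval_eq
    rw [← hv₃] at this
    exact this
  rintro _ rfl
  have hσ₄ := hσ₃.tabState (a := R) (x := 21) (base := 0) (v := bitmap (2 * N) K.k φ.family)
    (i := (2 * N) ^ K.k) (by omega) (hlκ 2) fun _ _ => len_bitmap hX2
  set σ₄ := RAM.tabState σ₃ R 21 0 (bitmap (2 * N) K.k φ.family) ((2 * N) ^ K.k) with hσ₄def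
  have hB : Encodes (2 * N) K.k (σ₄.arr R) φ.family := encodes_of_eq_bitmap hkey fun t ht => by
    rw [hσ₄def, tabState_arr_self, if_pos (by omega), Nat.sub_zero]
  have nc : ∀ x, 16 ≤ x → x < 22 → ¬ IsConst x := fun x h1 h2 h => by
    rcases h with h | h <;> omega
  have hst : State R X κ σ₄.arr σ₄ := ⟨hσ₄, fun x hx => by
    rw [hσ₄def, tabState_var, if_neg (by rintro rfl; exact nc 21 (by omega) (by omega) hx), hv₃],
    fun _ _ _ _ => rfl⟩
  -- the lists of clauses
  refine Wp.seq_mul hX2 (Q₁ := fun τ => State R X κ σ₄.arr τ ∧ ∀ s < K.S N, Lists (2 * N) K.k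
    (K.cap N) (fun l => τ.arr (R + 3) (s * K.cap N + l)) (K.family φ s)) (a := D + 6) ?_ ?_
  · refine (Wp.forLoop_pow (X := X) (D := D) (K.S N) (fun i τ => State R X κ σ₄.arr τ ∧
      ∀ s < i, Lists (2 * N) K.k (K.cap N) (fun l => τ.arr (R + 3) (s * K.cap N + l))
        (K.family φ s)) hX2 (hlκ 10) (by omega) (hst.const 10 (Or.inl (by omega)))
      ⟨hst.setVar (nc 16 (by omega) (by omega)) (by rw [len_zero]; omega), by omega⟩ ?_).mono ?_
      fun τ h => h.2.2
    · rintro i hi τ hx - ⟨hτ, hL⟩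
      refine (hD X κ σ₄.arr _ (2 * N) (K.L N) (K.cap N) τ φ.family i hctx rfl rfl rfl hX.L_le
        hX.cap_le hτ hB hx (hcap i hi)).mono le_rfl ?_
      rintro τ' ⟨h1, h3, h4, h5⟩
      refine ⟨h3, h1.const 10 (Or.inl (by omega)), h1.setVar (nc 16 (by omega) (by omega)) ?_, ?_⟩
      · exact_mod_cast (len_natCast_mono (show i + 1 ≤ K.S N by omega)).trans (hlκ 10)
      · intro s hs
        rcases Nat.lt_succ_iff_lt_or_eq.1 hs with hs | rfl
        · refine (hL s hs).congr fun l hl => h4 _ ?_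
          calc s * K.cap N + l < (s + 1) * K.cap N := by rw [add_mul, one_mul]; omega
            _ ≤ i * K.cap N := Nat.mul_le_mul_right _ hs
        · exact h5
    -- There are at most as many codes as units, so the loop over all codes stays within the factor
    -- `n + m`.
    · have h1 : K.S N ≤ K.n N := Nat.pow_le_pow_right (by omega) (hK.ba_le_q N)
      have h3 : 0 < K.m N := by rw [m]; positivity
      exact Nat.mul_le_mul (by omega) (pow_le_of_le hX2 (by omega))
  rintro σ₅ ⟨hst₅, hlists⟩
  have hσ₅ := hst₅.bounded
  set y := σ₅.arr (R + 3) with hy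
  have hv₅ : ∀ x, IsConst x → σ₅.var x = κ x := hst₅.const
  have ha₅ : ∀ a < R, σ₅.arr a = φ.input.arr a := fun a ha => by
    rw [hst₅.arr a (by omega) (by omega) (by omega), hσ₄def, tabState_arr_ne (by omega), ha₃]
  have ic : ∀ x, 22 ≤ x → IsConst x := fun x hx => Or.inr hx
  have icl : ∀ x, x < 16 → IsConst x := fun x hx => Or.inl hx
  -- clearing the input
  refine Wp.seq_mul hX2 (Wp.tab_mul hσ₅ (M * K.k) 0 (fun _ => 0) (by omega) (by omega)
    (hv₅ 24 (ic _ (by omega))) hY (hX.input_le.trans (Nat.le_mul_of_pos_left _ hY))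
    (fun i _ => by simp [Ex.val, Ex.eval, tabState_var]) (fun t ht => rfl)
    (fun _ _ => by rw [len_zero]; omega)) ?_
  rintro _ rfl
  have hσ₆ := hσ₅.tabState (a := 0) (x := 21) (base := 0) (v := fun _ => 0)
    (i := M * K.k) (by omega) (hlκ 24) fun _ _ => by rw [len_zero]; omega
  set σ₆ := RAM.tabState σ₅ 0 21 0 (fun _ => 0) (M * K.k) with hσ₆def
  have hv₆ : ∀ x, IsConst x → σ₆.var x = κ x := fun x hx => by
    rw [hσ₆def, tabState_var, if_neg (by rintro rfl; exact nc 21 (by omega) (by omega) hx), hv₅ x hx]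
  have ha₆ : σ₆.arr 0 = fun _ => 0 := by
    ext t
    rw [hσ₆def, tabState_arr_self]
    split_ifs with h
    · rfl
    · rw [ha₅ 0 (by omega)]
      exact φ.input_arr_of_mul_le (not_lt.1 fun h' => h ⟨Nat.zero_le _, by rwa [zero_add]⟩)
  -- the entries
  have hEba : K.b * K.a N ≤ K.E N := (hK.ba_le_p N).trans (p_le_E N)
  have hd : ∀ t, (t % K.d N - K.cap N) / 2 ≤ K.E N := fun t => by
    have := Nat.mod_lt t (hK.d_pos N)
    simp only [d] at this ⊢
    omega
  have hyT : ∀ t, t % K.d N < K.cap N → y (t / K.d N % K.S N * K.cap N + t % K.d N) = 0 ∨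
      ∃ T, T < (2 * N) ^ K.k ∧ y (t / K.d N % K.S N * K.cap N + t % K.d N) = T + 1 := by
    intro t ht
    refine ((hlists _ (Nat.mod_lt _ (K.S_pos N))).zero_or _ ht).imp_right ?_
    rintro ⟨T, hT, -, h⟩
    exact ⟨T, hT, h⟩
  classical
  set vx : ℕ → ℤ := fun t => if LeftCond (2 * N) K.k (K.S N) (K.cap N) (K.E₁ N) y (t / K.d N)
    (t % K.d N) then 1 else 0 with hvx
  set vw : ℕ → ℤ := fun t => if RightCond (2 * N) K.k (K.S N) (K.cap N) (K.E₁ N) y (t / K.d N)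
    (t % K.d N) then -(K.W N : ℤ) else 0 with hvw
  have hlx : ∀ t, len (vx t) ≤ X := fun t => by
    simp only [hvx]; split_ifs
    · rwa [len_one]
    · rw [len_zero]; omega
  have hlw : ∀ t, len (vw t) ≤ X := fun t => by
    simp only [hvw]; split_ifs
    · rw [len_neg]; exact hlκ 25
    · rw [len_zero]; omega
  have hmd : K.m N * K.d N ≤ (K.n N + K.m N) * X :=
    Nat.mul_le_mul (Nat.le_add_left _ _) hX.d_le
  have hnd : K.n N * K.d N ≤ (K.n N + K.m N) * X :=
    Nat.mul_le_mul (Nat.le_add_right _ _) hX.d_le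
  have hvt : ∀ {σ : Memory} {a : ℕ} {v : ℕ → ℤ} {i x : ℕ}, (∀ x, IsConst x → σ.var x = κ x) →
      IsConst x → (RAM.tabState σ a 21 0 v i).var x = κ x := fun h hx => by
    rw [tabState_var, if_neg (by rintro rfl; exact nc 21 (by omega) (by omega) hx), h _ hx]
  refine Wp.seq_mul hX2 (Wp.tab_mul hσ₆ (K.m N * K.d N) 0 vx (by omega) (by omega)
    (hv₆ 22 (ic _ (by omega))) hY hmd
    (fun i _ => by simp [Ex.val, Ex.eval, tabState_var]) (fun t ht => ?_) fun t _ => hlx t) ?_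
  · exact (Tr.x (V := 2 * N) (R := R) (E := K.E N) ⟨hvt hv₆ (icl _ (by omega)), hvt hv₆ (icl _ (by omega)),
      hvt hv₆ (icl _ (by omega))⟩ (hvt hv₆ (icl _ (by omega))) (hvt hv₆ (icl _ (by omega)))
      (hvt hv₆ (icl _ (by omega))) (hvt hv₆ (icl _ (by omega))) (by simp [tabState_var])
      (hvt hv₆ (ic _ (by omega))) (by rw [tabState_arr_ne (by omega), hσ₆def,
        tabState_arr_ne (by omega)]) (hyT t) (by omega) (hd t)).eval_eq
  rintro _ rfl
  have hσ₇ := hσ₆.tabState (a := 0) (x := 21) (base := 0) (v := vx)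
    (i := K.m N * K.d N) (by omega) (hlκ 22) fun t _ => hlx t
  have hv₇ : ∀ x, IsConst x → (RAM.tabState σ₆ 0 21 0 vx (K.m N * K.d N)).var x = κ x :=
    fun x hx => hvt hv₆ hx
  set σ₇ := RAM.tabState σ₆ 0 21 0 vx (K.m N * K.d N) with hσ₇def
  refine Wp.seq_mul hX2 (Wp.tab_mul hσ₇ (K.n N * K.d N) 0 vw (by omega) (by omega)
    (hv₇ 23 (ic _ (by omega))) hY hnd
    (fun i _ => by simp [Ex.val, Ex.eval, tabState_var]) (fun t ht => ?_) fun t _ => hlw t) ?_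
  · have h25 : (RAM.tabState σ₇ 1 21 0 vw t).var 25 = κ 25 := hvt hv₇ (ic _ (by omega))
    have := (Tr.w (V := 2 * N) (ρ := fun _ => 0) (R := R) (E := K.E N) (G := (RAM.tabState σ₇ 1 21 0 vw t).var)
      (A := (RAM.tabState σ₇ 1 21 0 vw t).arr)
      ⟨hvt hv₇ (icl _ (by omega)), hvt hv₇ (icl _ (by omega)),
      hvt hv₇ (icl _ (by omega))⟩ (hvt hv₇ (icl _ (by omega))) (hvt hv₇ (icl _ (by omega)))
      (hvt hv₇ (icl _ (by omega))) (hvt hv₇ (icl _ (by omega))) (by simp [tabState_var])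
      (hvt hv₇ (ic _ (by omega))) (by rw [tabState_arr_ne (by omega), hσ₇def,
        tabState_arr_ne (by omega), hσ₆def,
        tabState_arr_ne (by omega)]) (hyT t) (by omega) (hd t)).eval_eq
    have h25' : (Ex.bin .sub (.c 0) (.g 25)).eval (RAM.tabState σ₇ 1 21 0 vw t).var
        (RAM.tabState σ₇ 1 21 0 vw t).arr (fun _ => 0) = -(K.W N : ℤ) := by
      simp only [Ex.eval, Op.eval, h25, zero_sub]; rfl
    rw [Ex.val, wE, Ex.eval, this, h25']
    simp only [Op.eval, hvw, mul_ite, mul_one, mul_zero]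
    rfl
  rintro _ rfl
  have hσ₈ := hσ₇.tabState (a := 1) (x := 21) (base := 0) (v := vw)
    (i := K.n N * K.d N) (by omega) (hlκ 23) fun t _ => hlw t
  have hv₈ : ∀ x, IsConst x → (RAM.tabState σ₇ 1 21 0 vw (K.n N * K.d N)).var x = κ x :=
    fun x hx => hvt hv₇ hx
  set σ₈ := RAM.tabState σ₇ 1 21 0 vw (K.n N * K.d N) with hσ₈def
  refine (Wp.tab_mul hσ₈ (K.m N) 0 (fun _ => 1) (by omega) (by omega)
    (hv₈ 12 (icl _ (by omega))) hY ((Nat.le_add_left _ _).trans (Nat.le_mul_of_pos_right _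
    (by omega))) (fun i _ => by simp [Ex.val, Ex.eval, tabState_var]) (fun t ht => rfl)
    fun t _ => by rwa [len_one]).mono le_rfl ?_
  rintro _ rfl
  refine ⟨y, hlists, fun a ha => ?_, hvt hv₈ (ic _ (by omega)), hvt hv₈ (icl _ (by omega)),
    hvt hv₈ (icl _ (by omega)), hvt hv₈ (icl _ (by omega))⟩
  have hdp := hK.d_pos N
  ext t
  simp only [GradInstance.input, inst]
  by_cases a0 : a = 0
  · subst a0
    rw [if_pos rfl, tabState_arr_ne (by omega), hσ₈def, tabState_arr_ne (by omega), hσ₇def,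
      tabState_arr_self, ha₆]
    refine Eq.trans ?_ (ofMat_eq hdp (fun i c => if LeftCond (2 * N) K.k (K.S N) (K.cap N)
      (K.E₁ N) y i c then 1 else 0) t).symm
    simp [hvx]
  rw [if_neg a0]
  by_cases a1 : a = 1
  · subst a1
    rw [if_pos rfl, tabState_arr_ne (by omega), hσ₈def, tabState_arr_self, hσ₇def,
      tabState_arr_ne (by omega), hσ₆def, tabState_arr_ne (by omega), ha₅ 1 ha]
    refine Eq.trans ?_ (ofMat_eq hdp (fun i c => if RightCond (2 * N) K.k (K.S N) (K.cap N)
      (K.E₁ N) y i c then -(K.W N : ℤ) else 0) t).symm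
    simp [hvw, KCNF.input]
  rw [if_neg a1]
  have h8 : σ₈.arr a = fun _ => 0 := by
    rw [hσ₈def, tabState_arr_ne (by omega), hσ₇def,
      tabState_arr_ne (by omega), hσ₆def, tabState_arr_ne (by omega), ha₅ a ha]
    simp [KCNF.input, a0]
  by_cases a2 : a = 2
  · subst a2
    rw [if_pos rfl, tabState_arr_self, h8]
    simp [ofVec]
  rw [if_neg a2, tabState_arr_ne (by omega), h8]
  split_ifs
  · simp [ofVec]
  · rfl

end Consts

end RAM

namespace RAM

open Finset Sparsification

/-! ## The complete program -/

/-- The program that checks whether some fraction is less than `-1 / 5`. -/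
def readout (R : ℕ) : Program :=
  forLoop R 18 11 (.seq (.load (tv R 0) 4 (gv R 18)) (.seq (.load (tv R 1) 5 (gv R 18))
    (.seq (.const (tv R 2) 5) (.seq (.arith .mul (tv R 0) (tv R 0) (tv R 2))
      (.seq (.arith .add (tv R 0) (tv R 0) (tv R 1)) (.seq (.const (tv R 2) 0)
        (.seq (.arith .sub (tv R 0) (tv R 2) (tv R 0))
          (.ite (tv R 0) (.const (gv R 26) 1) (.const (tv R 2) 0)))))))))

-- Multiplying out the positive denominator avoids division: a fraction is below `-1 / 5` exactly if
-- `5 * numerator + denominator` is negative. The cost is linear in the lengths of the fractions.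
open Classical in
theorem wp_readout {R : ℕ} {low : ℕ → ℤ} {X n : ℕ} {σ : Memory} (hX : 2 ≤ X)
    (hn : len (n : ℤ) ≤ X) (h11 : σ.var 11 = n) (h26 : σ.var 26 = 0) :
    Wp R low (readout R) (∑ i ∈ range n, (30 * (X + len (σ.arr 4 i) + len (σ.arr 5 i)) + 8 * X) +
      8 * X) σ fun τ => τ.var 26 = if ∃ j < n, 5 * σ.arr 4 j + σ.arr 5 j < 0 then 1 else 0 := by
  refine (Wp.forLoop n (fun i τ => τ.arr = σ.arr ∧
    τ.var 26 = if ∃ j < i, 5 * σ.arr 4 j + σ.arr 5 j < 0 then 1 else 0)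
    (fun i => 30 * (X + len (σ.arr 4 i) + len (σ.arr 5 i))) hX hn (by omega) h11
    ⟨rfl, by simp [setVar_var, h26]⟩ ?_).mono le_rfl fun τ h => h.2.2.2
  rintro i hi τ h18 h11 ⟨harr, hacc⟩ s hs
  have hli : len (i : ℤ) ≤ X := (len_natCast_mono hi.le).trans hn
  have h5 : len 5 = 4 := by decide
  have hgt : ∀ x j, (gv R x = tv R j) = False := fun x j => eq_false (gv_ne_tv R x j)
  have e1 := len_mul_le (σ.arr 4 i) 5
  have e2 := len_add_le (σ.arr 4 i * 5) (σ.arr 5 i)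
  have e3 := len_sub_le 0 (σ.arr 4 i * 5 + σ.arr 5 i)
  rw [h5] at e1
  rw [len_zero] at e3
  have hex : (∃ j < i + 1, 5 * σ.arr 4 j + σ.arr 5 j < 0) ↔
      (∃ j < i, 5 * σ.arr 4 j + σ.arr 5 j < 0) ∨ 5 * σ.arr 4 i + σ.arr 5 i < 0 := by
    constructor
    · rintro ⟨j, hj, h⟩
      rcases Nat.lt_succ_iff_lt_or_eq.1 hj with hj | rfl
      exacts [Or.inl ⟨j, hj, h⟩, Or.inr h]
    · rintro (⟨j, hj, h⟩ | h)
      exacts [⟨j, by omega, h⟩, ⟨i, by omega, h⟩]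
  by_cases hneg : 5 * σ.arr 4 i + σ.arr 5 i < 0
  · refine ⟨_, _, τ.setVar 26 1, Exec.seq (Exec.load _ _ _ _) (Exec.seq (Exec.load _ _ _ _)
      (Exec.seq (Exec.const _ _ _) (Exec.seq (Exec.arith _ _ _ _ _)
      (Exec.seq (Exec.arith _ _ _ _ _) (Exec.seq (Exec.const _ _ _)
      (Exec.seq (Exec.arith _ _ _ _ _) (Exec.ite_pos ?_ (Exec.const _ _ _)))))))), ?_,
      (((((((hs.setVar_tv 0 _).setVar_tv 1 _).setVar_tv 2 _).setVar_tv 0 _).setVar_tv 0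
        _).setVar_tv 2 _).setVar_tv 0 _).setVar_gv 26 _, ?_⟩
    · simp [setVar_var, setVar_arr, tv_inj, hgt, hs.1, hs.2.1, h18, harr, Op.eval]; omega
    · simp [setVar_var, setVar_arr, tv_inj, hgt, hs.1, hs.2.1, h18, harr, Op.eval, len_zero,
        len_one, h5] at *
      omega
    · refine ⟨by simp [setVar_var, h18], by simp [setVar_var, h11], harr, ?_⟩
      rw [setVar_var, setVar_var, if_neg (by omega), if_pos rfl, if_pos (hex.2 (Or.inr hneg))]
  · refine ⟨_, _, τ, Exec.seq (Exec.load _ _ _ _) (Exec.seq (Exec.load _ _ _ _)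
      (Exec.seq (Exec.const _ _ _) (Exec.seq (Exec.arith _ _ _ _ _)
      (Exec.seq (Exec.arith _ _ _ _ _) (Exec.seq (Exec.const _ _ _)
      (Exec.seq (Exec.arith _ _ _ _ _) (Exec.ite_neg ?_ (Exec.const _ _ _)))))))), ?_,
      (((((((hs.setVar_tv 0 _).setVar_tv 1 _).setVar_tv 2 _).setVar_tv 0 _).setVar_tv 0
        _).setVar_tv 2 _).setVar_tv 0 _).setVar_tv 2 _, ?_⟩
    · simp [setVar_var, setVar_arr, tv_inj, hgt, hs.1, hs.2.1, h18, harr, Op.eval]; omega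
    · simp [setVar_var, setVar_arr, tv_inj, hgt, hs.1, hs.2.1, h18, harr, Op.eval, len_zero,
        h5] at *
      omega
    · refine ⟨h18, h11, harr, ?_⟩
      simp only [setVar_var, hex, hneg, or_false]
      simpa using hacc

theorem exec_copy' (s : Memory) {x y : ℕ} {v : ℤ} (h : y ≠ x) (hv : s.var y = v) :
    ∃ s', Exec (copy x y) s s' (len v + 4) ∧ s'.arr = s.arr ∧
      ∀ z, s'.var z = if z = x then v else s.var z := by
  obtain ⟨s', he, ha, hx, hf⟩ := exec_copy s h
  subst hv
  refine ⟨s', he, ha, fun z => ?_⟩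
  split_ifs with hz
  · rw [hz, hx]
  · exact hf z hz

-- The cost of reading the output is not known in advance, but arrays `4` and `5` start at zero, so
-- by `sum_len_le_of_exec` each has total length at most `n + t` afterwards. The `61 t` consists of
-- `t` for the run of `P` and `30 t` for each of the two arrays.
open Classical in
theorem Consts.exists_program (K : Consts) (hK : K.Good) (P : Program) : ∃ (Q : Program) (D : ℕ),
    ∀ (φ : KCNF K.k) (X : ℕ), K.Fits φ.numVars φ.numClauses X → φ.numVars ≤ K.E φ.numVars →
    (∀ s < K.S φ.numVars, #(K.family φ s) ≤ K.cap φ.numVars) → ∃ y : ℕ → ℤ,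
    (∀ s < K.S φ.numVars, Lists (2 * φ.numVars) K.k (K.cap φ.numVars)
      (fun l => y (s * K.cap φ.numVars + l)) (K.family φ s)) ∧
    ∀ (s : Memory) (t : ℕ), Exec P (K.inst φ.numVars y).input s t → ∃ (s' : Memory) (t' : ℕ),
      Exec Q φ.input s' t' ∧ t' ≤ (K.n φ.numVars + K.m φ.numVars) * X ^ D + 61 * t ∧
      s'.var 0 = if ∃ j < K.n φ.numVars, 5 * s.arr 4 j + s.arr 5 j < 0 then 1 else 0 := by
  set R := P.names + 6 with hR
  obtain ⟨D, hD⟩ := K.exists_wp_prep hK R (by omega)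
  refine ⟨.seq (K.prep R) (.seq (copy 0 (gv R 11)) (.seq (copy 1 (gv R 12)) (.seq (copy 2 (gv R 13))
    (.seq P (.seq (readout R) (copy 0 (gv R 26))))))), D + 10, ?_⟩
  intro φ X hX hN hcap
  obtain ⟨s₁, t₁, σ₁, he₁, ht₁, hi₁, y, hy, harr, h26, h11, h12, h13⟩ := hD φ X hX hN hcap φ.input
    ⟨fun x => by simp only [KCNF.input, gv]; rw [if_neg (by omega), if_neg (by omega)], rfl,
      fun _ _ => rfl⟩
  refine ⟨y, hy, fun s t hst => ?_⟩
  set N := φ.numVars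
  have hg : ∀ x y, y < 6 → gv R x ≠ y := fun x y hy => by simp only [gv]; omega
  obtain ⟨s₂, he₂, ha₂, hv₂⟩ := exec_copy' s₁ (hg 11 0 (by omega)) ((hi₁.1 11).trans h11)
  obtain ⟨s₃, he₃, ha₃, hv₃⟩ := exec_copy' s₂ (hg 12 1 (by omega))
    (((hv₂ _).trans (if_neg (hg 12 0 (by omega)))).trans ((hi₁.1 12).trans h12))
  obtain ⟨s₄, he₄, ha₄, hv₄⟩ := exec_copy' s₃ (hg 13 2 (by omega))
    (((hv₃ _).trans (if_neg (hg 13 1 (by omega)))).trans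
      (((hv₂ _).trans (if_neg (hg 13 0 (by omega)))).trans ((hi₁.1 13).trans h13)))
  have hv : ∀ x, s₄.var x = if x = 2 then (K.d N : ℤ) else if x = 1 then (K.m N : ℤ) else
      if x = 0 then (K.n N : ℤ) else s₁.var x := fun x => by rw [hv₄, hv₃, hv₂]
  have ha : s₄.arr = σ₁.arr := by rw [ha₄, ha₃, ha₂, hi₁.2.1]
  obtain ⟨s₅, he₅, hb₅, hab₅⟩ := exec_of_agreeBelow hst (R := R) (by omega) s₄
    ⟨fun x hx => by
      rw [hv]
      simp only [GradInstance.input, inst]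
      by_cases h0 : x = 0
      · simp [h0]
      by_cases h1 : x = 1
      · simp [h1]
      by_cases h2 : x = 2
      · simp [h2]
      rw [if_neg h0, if_neg h1, if_neg h2, if_neg h0, if_neg h1, if_neg h2, hi₁.2.2 x hx]
      simp [KCNF.input, h0, h1], fun a haR => by rw [ha, harr a haR]⟩
  have hvar : ∀ x, s₅.var (gv R x) = σ₁.var x := fun x => by
    rw [hab₅.1 _ (by simp only [gv]; omega), hv, if_neg (hg x 2 (by omega)),
      if_neg (hg x 1 (by omega)), if_neg (hg x 0 (by omega)), hi₁.1]
  have hln : len (K.n N : ℤ) ≤ X := hX.len_glob 11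
  have hlm : len (K.m N : ℤ) ≤ X := hX.len_glob 12
  have hld : len (K.d N : ℤ) ≤ X := hX.len_glob 13
  obtain ⟨s₆, t₆, σ₆, he₆, ht₆, hi₆, hq₆⟩ := wp_readout (R := R) (low := s₅.var) (X := X)
    (n := K.n N) (σ := ⟨fun x => s₅.var (gv R x), s₅.arr⟩) hX.two_le hln
    ((hvar 11).trans h11) ((hvar 26).trans h26) s₅ ⟨fun _ => rfl, rfl, fun _ _ => rfl⟩
  obtain ⟨s₇, he₇, -, hv₇⟩ := exec_copy' s₆ (hg 26 0 (by omega)) ((hi₆.1 26).trans hq₆)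
  have hv₇' : s₇.var 0 = if ∃ j < K.n N, 5 * s₅.arr 4 j + s₅.arr 5 j < 0 then 1 else 0 := by
    rw [hv₇, if_pos rfl]
  refine ⟨s₇, _, he₁.seq (he₂.seq (he₃.seq (he₄.seq (he₅.seq (he₆.seq he₇))))), ?_, ?_⟩
  · have hsum : ∀ a, 4 ≤ a → a < 6 → ∑ i ∈ range (K.n N), len (s₅.arr a i) ≤ K.n N + t := by
      intro a h4 h6
      refine (sum_len_le_of_exec he₅ a (range (K.n N))).trans (Nat.add_le_add_right ?_ t)
      have : ∀ i, s₄.arr a i = 0 := fun i => by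
        rw [ha, harr a (by omega)]
        simp only [GradInstance.input]
        rw [if_neg (by omega), if_neg (by omega), if_neg (by omega), if_neg (by omega)]
      simp [this, len_zero]
    have h4 := hsum 4 (by omega) (by omega)
    have h5 := hsum 5 (by omega) (by omega)
    have hlr : len (s₇.var 0) ≤ 2 := by
      rw [hv₇']; split_ifs
      · rw [len_one]
      · rw [len_zero]; omega
    rw [hv₇, if_pos rfl] at hlr
    simp only [sum_add_distrib, ← mul_sum, sum_const, card_range, smul_eq_mul] at ht₆
    have hX2 := hX.two_le
    set Y := K.n N + K.m N with hYdef
    have hn1 : 1 ≤ K.n N := Nat.one_le_two_pow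
    have hY : 1 ≤ Y := by omega
    have hXY : X ≤ Y * X := Nat.le_mul_of_pos_left _ hY
    have hnX : K.n N * X ≤ Y * X := Nat.mul_le_mul_right _ (by omega)
    have hYX : Y ≤ Y * X := Nat.le_mul_of_pos_right _ (by omega)
    have h8 : 2 ^ 8 ≤ X ^ 8 := Nat.pow_le_pow_left hX2 8
    have h9 : 2 ^ 8 * (Y * X) ≤ X ^ 8 * (Y * X) := Nat.mul_le_mul_right _ h8
    have h10 : X ^ 8 * (Y * X) = Y * X ^ 9 := by ring
    have h11 : Y * X ^ 9 ≤ Y * X ^ (D + 9) :=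
      Nat.mul_le_mul_left _ (pow_le_of_le hX2 (by omega))
    have h12 : Y * X ^ D ≤ Y * X ^ (D + 9) :=
      Nat.mul_le_mul_left _ (pow_le_of_le hX2 (by omega))
    have h13 : Y * X ^ (D + 9) * 2 ≤ Y * X ^ (D + 9) * X := Nat.mul_le_mul_left _ hX2
    have h14 : Y * X ^ (D + 10) = Y * X ^ (D + 9) * X := by ring
    have h15 : K.n N * (8 * X) = 8 * (K.n N * X) := by ring
    omega
  · rw [hv₇', ← hb₅.2 4 (by omega), ← hb₅.2 5 (by omega)]

end RAM

/-! ### Satisfiability as a hitting problem, and correctness of the packed instance. -/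

open Sparsification in
theorem KCNF.satisfiable_iff {k : ℕ} (φ : KCNF k) : φ.Satisfiable ↔
    ∃ f : ℕ → Bool, Hit (fun v => f (v / 2) = decide (v % 2 = 1)) φ.family := by
  have key : ∀ (f : ℕ → Bool) (c : Fin φ.numClauses) (l : Fin k),
      f (φ.code c l / 2) = decide (φ.code c l % 2 = 1) ↔ f (φ.lit c l).1 = (φ.lit c l).2 := by
    intro f c l
    rw [code, dif_pos ⟨c.2, l.2⟩]
    cases h : (φ.lit c l).2
    · simp
    · have h1 : (2 * ((φ.lit c l).1 : ℕ) + 1) / 2 = (φ.lit c l).1 := by omega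
      have h2 : (2 * ((φ.lit c l).1 : ℕ) + 1) % 2 = 1 := by omega
      simp [h1, h2]
  have hit : ∀ f : ℕ → Bool, Hit (fun v => f (v / 2) = decide (v % 2 = 1)) φ.family ↔
      ∀ c, ∃ l, f (φ.lit c l).1 = (φ.lit c l).2 := by
    intro f
    rw [family, hit_minimals]
    constructor
    · intro h c
      obtain ⟨v, hv, hf⟩ := h _ (Finset.mem_image_of_mem _ (Finset.mem_range.2 c.2))
      obtain ⟨l, hl, rfl⟩ := Finset.mem_image.1 hv
      exact ⟨⟨l, Finset.mem_range.1 hl⟩, (key f c ⟨l, Finset.mem_range.1 hl⟩).1 hf⟩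
    · intro h Z hZ
      obtain ⟨c, hc, rfl⟩ := Finset.mem_image.1 hZ
      obtain ⟨l, hl⟩ := h ⟨c, Finset.mem_range.1 hc⟩
      exact ⟨_, Finset.mem_image_of_mem _ (Finset.mem_range.2 l.2),
        (key f ⟨c, Finset.mem_range.1 hc⟩ l).2 hl⟩
  constructor
  · rintro ⟨x, hx⟩
    refine ⟨fun v => if h : v < φ.numVars then x ⟨v, h⟩ else false,
      (hit fun v => if h : v < φ.numVars then x ⟨v, h⟩ else false).2 fun c => ?_⟩
    obtain ⟨l, hl⟩ := hx c
    exact ⟨l, by simpa using hl⟩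
  · rintro ⟨f, hf⟩
    exact ⟨fun v => f v, (hit f).1 hf⟩

open Sparsification in
theorem KCNF.inv_family {k : ℕ} (φ : KCNF k) (γ : ℕ) : Inv γ k (2 * φ.numVars) φ.family 0 := by
  have h : ∀ Z ∈ φ.family, Z ⊆ Finset.range (2 * φ.numVars) ∧ Z.card ≤ k := by
    intro Z hZ
    obtain ⟨c, hc, rfl⟩ := Finset.mem_image.1 (minimals_subset _ hZ)
    refine ⟨Finset.image_subset_iff.2 fun l hl => ?_,
      Finset.card_image_le.trans (Finset.card_range k).le⟩
    exact Finset.mem_range.2 (φ.code_lt (Finset.mem_range.1 hc) (Finset.mem_range.1 hl))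
  exact ⟨minimals_antichain _, fun Z hZ => (h Z hZ).1, fun Z hZ => (h Z hZ).2, Nat.zero_le _,
    by omega⟩

namespace RAM

open Finset Sparsification

namespace Consts

/-- The constants fit together. -/
structure Valid (K : Consts) : Prop where
  p_pos : 1 ≤ K.p
  q_pos : 1 ≤ K.q
  h_gt : 3 ≤ K.h
  γ_pos : 1 ≤ K.γ
  γ_ge : 4 * K.k * 4 ^ K.k * K.Z ≤ K.γ
  b_eq : 2 ^ K.b = 2 * K.γ ^ K.k
  Z_eq : K.Z = (K.p + K.q) * K.b * (K.h - 2)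
  cap₁_eq : K.cap₁ = 2 * K.Z * (K.k * K.γ ^ K.k) + 1
  L₁_eq : K.L₁ = 4 * K.Z * (K.k * 4 ^ K.k * K.γ ^ K.k)

variable {K : Consts}

theorem Valid.good (h : K.Valid) : K.Good :=
  ⟨h.γ_pos, h.p_pos, h.q_pos, by have := h.h_gt; omega, by rw [h.cap₁_eq]; omega⟩

theorem Valid.b_pos (h : K.Valid) : 1 ≤ K.b := by
  have h1 := h.b_eq
  have h2 := Nat.one_le_pow K.k _ h.γ_pos
  rcases Nat.eq_zero_or_pos K.b with h3 | h3
  · rw [h3] at h1; omega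
  · exact h3

theorem Valid.Z_pos (h : K.Valid) : 1 ≤ K.Z := by
  rw [h.Z_eq]
  exact Nat.mul_pos (Nat.mul_pos (by have := h.p_pos; omega) h.b_pos) (by have := h.h_gt; omega)

theorem Valid.lt_mul (h : K.Valid) (N : ℕ) : N < K.Z * K.a N := by
  rw [a, mul_add, mul_one]
  have h1 := Nat.div_add_mod N K.Z
  have h2 := Nat.mod_lt N h.Z_pos
  omega

/-- The number of the variables that are assigned by the units. -/
def E₂ (K : Consts) (N : ℕ) : ℕ := K.b * K.q * K.r N - K.b * K.a N

/-- Of the `b (p + q) r` index bits, `2 b a` are spent on two copies of the code. As `r ≥ h a`, at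
least `b (p + q) (h - 2) a = Z a > N` remain for assignments. -/
theorem Valid.le_add (h : K.Valid) (N : ℕ) : N ≤ K.E₁ N + K.E₂ N := by
  have h1 := h.lt_mul N
  have h2 := h.good.ba_le_p N
  have h3 := h.good.ba_le_q N
  obtain ⟨g, hg⟩ : ∃ g, K.h = g + 2 := ⟨K.h - 2, by have := h.h_gt; omega⟩
  have h4 : K.Z * K.a N + 2 * (K.b * K.a N) ≤ K.b * K.p * K.r N + K.b * K.q * K.r N := by
    have h5 : (g + 2) * K.a N ≤ K.r N := by rw [r, hg]; omega
    have h6 : K.b * (K.p + K.q) * ((g + 2) * K.a N) ≤ K.b * (K.p + K.q) * K.r N :=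
      Nat.mul_le_mul_left _ h5
    have h7 : 2 * (K.b * K.a N) ≤ K.b * (K.p + K.q) * (2 * K.a N) := by
      calc 2 * (K.b * K.a N) = K.b * 1 * (2 * K.a N) := by ring
        _ ≤ _ := by gcongr; have := h.p_pos; omega
    have h8 : K.Z * K.a N = K.b * (K.p + K.q) * (g * K.a N) := by
      rw [h.Z_eq, hg, Nat.add_sub_cancel]; ring
    calc K.Z * K.a N + 2 * (K.b * K.a N)
        ≤ K.b * (K.p + K.q) * (g * K.a N) + K.b * (K.p + K.q) * (2 * K.a N) := by omega
      _ = K.b * (K.p + K.q) * ((g + 2) * K.a N) := by ring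
      _ ≤ _ := h6
      _ = _ := by ring
  rw [E₁, E₂]
  omega

theorem Valid.le_E (h : K.Valid) (N : ℕ) : N ≤ K.E N := by
  have h1 := h.le_add N
  have h2 : K.E N = K.b * K.p * K.r N + K.b * K.q * K.r N := by rw [E]; ring
  rw [E₁, E₂] at h1
  omega

theorem Good.m_eq (h : K.Good) (N : ℕ) : K.m N = 2 ^ K.E₁ N * K.S N := by
  rw [m, S, E₁, ← pow_add, Nat.sub_add_cancel (h.ba_le_p N)]

theorem Good.n_eq (h : K.Good) (N : ℕ) : K.n N = 2 ^ K.E₂ N * K.S N := by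
  rw [n, S, E₂, ← pow_add, Nat.sub_add_cancel (h.ba_le_q N)]

theorem potential_le_div (h : 1 ≤ K.γ) {V : ℕ} (F : Finset (Finset ℕ)) (κ : ℕ)
    (hF : Inv K.γ K.k V F κ) :
    potential K.γ K.k F κ ≤ 2 * V * K.k * 4 ^ K.k * K.γ ^ K.k / K.γ :=
  (Nat.le_div_iff_mul_le h).2 (by rw [mul_comm]; exact potential_le hF)

/-- `L` exceeds the maximal potential, so after `L` steps no heavy flower is left and
`card_le_of_not_heavy` applies. -/
theorem Valid.card_family_le (h : K.Valid) (φ : KCNF K.k) (s : ℕ) :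
    #(K.family φ s) ≤ K.cap φ.numVars := by
  have hp : IsPick K.γ K.k (2 * φ.numVars) (pick K.k K.γ (2 * φ.numVars)) :=
    fun F hF => isPick_pick h.γ_pos hF
  obtain ⟨κ, h1, h2⟩ := exists_inv_iterate (β := 2 ^ K.b) h.γ_pos hp
    (potential_le_div (K := K) h.γ_pos) (K.L φ.numVars) (φ.family, s) 0 (φ.inv_family _)
  have h3 := h2 (by
    refine lt_of_lt_of_le ?_ (Nat.le_add_left _ _)
    refine lt_of_le_of_lt (Nat.div_le_self _ _) ?_
    rw [L, h.L₁_eq, Nat.lt_succ_iff]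
    calc 2 * (2 * φ.numVars) * K.k * 4 ^ K.k * K.γ ^ K.k
        = 4 * φ.numVars * (K.k * 4 ^ K.k * K.γ ^ K.k) := by ring
      _ ≤ 4 * (K.Z * K.a φ.numVars) * (K.k * 4 ^ K.k * K.γ ^ K.k) := by
        have := (h.lt_mul φ.numVars).le
        gcongr
      _ = _ := by ring)
  refine (card_le_of_not_heavy h1 h.γ_pos ((hp _ h1.mem).1 h3)).trans ?_
  rw [cap, h.cap₁_eq, add_mul, one_mul]
  have h4 : 1 ≤ K.a φ.numVars := Nat.le_add_left _ _
  refine Nat.add_le_add ?_ h4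
  calc 2 * φ.numVars * (K.k * K.γ ^ K.k) ≤ 2 * (K.Z * K.a φ.numVars) * (K.k * K.γ ^ K.k) := by
        have := (h.lt_mul φ.numVars).le
        gcongr
    _ = _ := by ring

/-- The code from `exists_code` has `D + 1` digits in base `2 ^ b`, with `D * γ ≤ 4 N k 4 ^ k`. The
choice `γ ≥ 4 k 4 ^ k Z` turns this into `D ≤ N / Z`, so `a` digits suffice. -/
theorem Valid.exists_hit (h : K.Valid) (φ : KCNF K.k) {x : ℕ → Prop} (hx : Hit x φ.family) :
    ∃ s < K.S φ.numVars, Hit x (K.family φ s) := by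
  have hp : IsPick K.γ K.k (2 * φ.numVars) (pick K.k K.γ (2 * φ.numVars)) :=
    fun F hF => isPick_pick h.γ_pos hF
  obtain ⟨s, D, hs, hD, hL⟩ := exists_code h.γ_pos hp (potential_le_div (K := K) h.γ_pos) x _
    φ.family 0 (φ.inv_family _) hx (Nat.le_add_left _ _)
  refine ⟨s, hs.trans_le ?_, ?_⟩
  · rw [S, pow_mul, h.b_eq]
    have hγk := Nat.one_le_pow K.k _ h.γ_pos
    refine Nat.pow_le_pow_right (by omega) (Nat.add_le_add_right ?_ 1)
    rw [Nat.le_div_iff_mul_le h.Z_pos]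
    have h1 : D * K.γ ^ K.k * K.γ ≤ 2 * (2 * φ.numVars) * K.k * 4 ^ K.k * K.γ ^ K.k :=
      (Nat.mul_le_mul_right _ (by omega)).trans (Nat.div_mul_le_self _ _)
    have h2 : D * K.γ ≤ 4 * φ.numVars * K.k * 4 ^ K.k := by
      refine Nat.le_of_mul_le_mul_right (c := K.γ ^ K.k) ?_ hγk
      calc D * K.γ * K.γ ^ K.k = D * K.γ ^ K.k * K.γ := by ring
        _ ≤ _ := h1
        _ = _ := by ring
    -- For `k = 0` the factor to be cancelled vanishes, but then `D = 0` directly.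
    rcases Nat.eq_zero_or_pos K.k with hk | hk
    · have h3 : D = 0 := by
        have := h.γ_pos
        have h4 : 4 * φ.numVars * K.k * 4 ^ K.k = 0 := by simp [hk]
        rcases Nat.mul_eq_zero.1 (show D * K.γ = 0 by omega) with h5 | h5 <;> omega
      simp [h3]
    · refine le_of_mul_le_mul_left ?_
        (show 0 < 4 * K.k * 4 ^ K.k from Nat.mul_pos (by omega) (by positivity))
      calc 4 * K.k * 4 ^ K.k * (D * K.Z) = D * (4 * K.k * 4 ^ K.k * K.Z) := by ring
        _ ≤ D * K.γ := Nat.mul_le_mul_left _ h.γ_ge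
        _ ≤ _ := h2
        _ = _ := by ring
  · rw [family, h.b_eq]
    exact hL _

theorem exists_bit_ne {s s' L : ℕ} (hs : s < 2 ^ L) (hs' : s' < 2 ^ L) (h : s ≠ s') :
    ∃ e < L, s / 2 ^ e % 2 ≠ s' / 2 ^ e % 2 := by
  by_contra! hall
  refine h (Nat.eq_of_testBit_eq fun e => ?_)
  by_cases he : e < L
  · rw [Nat.testBit_eq_decide_div_mod_eq, Nat.testBit_eq_decide_div_mod_eq, hall e he]
  · have h2 : 2 ^ L ≤ 2 ^ e := Nat.pow_le_pow_right (by omega) (by omega)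
    rw [Nat.testBit_lt_two_pow (by omega), Nat.testBit_lt_two_pow (by omega)]

/-- A satisfying assignment is cut at variable `E₁`, and both halves are paired with a code `s`
whose sparse formula it satisfies. Each clause then holds on one side, and equal codes have no
common check coordinate. -/
theorem Valid.exists_disjoint (h : K.Valid) (φ : KCNF K.k) {y : ℕ → ℤ}
    (hy : ∀ s < K.S φ.numVars, Lists (2 * φ.numVars) K.k (K.cap φ.numVars)
      (fun l => y (s * K.cap φ.numVars + l)) (K.family φ s)) (hφ : φ.Satisfiable) :
    ∃ i < K.m φ.numVars, ∃ j < K.n φ.numVars, ∀ c,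
      ¬ (LeftCond (2 * φ.numVars) K.k (K.S φ.numVars) (K.cap φ.numVars) (K.E₁ φ.numVars) y i c ∧
        RightCond (2 * φ.numVars) K.k (K.S φ.numVars) (K.cap φ.numVars) (K.E₁ φ.numVars) y j c) := by
  obtain ⟨f, hf⟩ := φ.satisfiable_iff.1 hφ
  obtain ⟨s, hs, hhit⟩ := h.exists_hit φ hf
  set N := φ.numVars
  have hS := K.S_pos N
  obtain ⟨u, hu, hub⟩ := exists_keySet_map (V := 2) (k := K.E₁ N)
    (fun e => if f e then 1 else 0) (fun e _ => by split_ifs <;> omega)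
  obtain ⟨v, hv, hvb⟩ := exists_keySet_map (V := 2) (k := K.E₂ N)
    (fun e => if f (K.E₁ N + e) then 1 else 0) (fun e _ => by split_ifs <;> omega)
  have hlt : ∀ {A u : ℕ}, u < A → u * K.S N + s < A * K.S N := fun {A u} hu => by
    calc u * K.S N + s < (u + 1) * K.S N := by rw [add_mul, one_mul]; omega
      _ ≤ _ := Nat.mul_le_mul_right _ hu
  have hdiv : ∀ u, (u * K.S N + s) / K.S N = u := fun u => by
    rw [mul_comm, Nat.mul_add_div hS, Nat.div_eq_of_lt hs, add_zero]
  have hmod : ∀ u, (u * K.S N + s) % K.S N = s := fun u => by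
    rw [mul_comm, Nat.mul_add_mod, Nat.mod_eq_of_lt hs]
  refine ⟨u * K.S N + s, by rw [h.good.m_eq]; exact hlt hu, v * K.S N + s,
    by rw [h.good.n_eq]; exact hlt hv, fun c => ?_⟩
  rw [LeftCond, RightCond, hdiv, hdiv, hmod, hmod]
  rintro ⟨⟨hc, hpos, hl⟩ | ⟨hc, hl⟩, ⟨hc', -, hr⟩ | ⟨hc', hr⟩⟩
  · rcases (hy s hs).zero_or c hc with h0 | ⟨t, ht, hmem, hyt⟩
    · omega
    · rw [hyt, show ((t : ℤ) + 1 - 1).toNat = t by omega] at hl hr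
      obtain ⟨w, hw, hfw⟩ := hhit _ hmem
      have hwV := mem_range.1 (keySet_subset ht hw)
      have hb : (if f (w / 2) = true then 1 else 0) = w % 2 := by
        rw [hfw]
        rcases Nat.mod_two_eq_zero_or_one w with h2 | h2 <;> simp [h2]
      by_cases hlt : w / 2 < K.E₁ N
      · exact hl w hwV hw ⟨hlt, by rw [hub _ hlt, hb]⟩
      · have := h.le_add N
        refine hr w hwV hw ⟨hlt, ?_⟩
        rw [hvb _ (by omega), Nat.add_sub_cancel' (by omega), hb]
  · exact hc' hc
  · exact hc hc'
  · exact hl hr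

/-- For equal codes the halves glue to an assignment. It cannot satisfy the sparse formula, since
satisfying any branch implies satisfying the original, so some clause is violated on both sides.
Different codes differ in some bit `e`, and the check coordinate for `e` and the bit of `j` is
common. -/
theorem Valid.exists_common (φ : KCNF K.k) {y : ℕ → ℤ}
    (hy : ∀ s < K.S φ.numVars, Lists (2 * φ.numVars) K.k (K.cap φ.numVars)
      (fun l => y (s * K.cap φ.numVars + l)) (K.family φ s)) (hφ : ¬ φ.Satisfiable) (i j : ℕ) :
    ∃ c < K.d φ.numVars,
      LeftCond (2 * φ.numVars) K.k (K.S φ.numVars) (K.cap φ.numVars) (K.E₁ φ.numVars) y i c ∧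
        RightCond (2 * φ.numVars) K.k (K.S φ.numVars) (K.cap φ.numVars) (K.E₁ φ.numVars) y j c := by
  set N := φ.numVars
  have hi := Nat.mod_lt i (K.S_pos N)
  have hj := Nat.mod_lt j (K.S_pos N)
  by_cases hs : i % K.S N = j % K.S N
  · set f : ℕ → Bool := fun e => if e < K.E₁ N then decide (i / K.S N / 2 ^ e % 2 = 1) else
      decide (j / K.S N / 2 ^ (e - K.E₁ N) % 2 = 1) with hf
    have hno : ¬ Hit (fun v => f (v / 2) = decide (v % 2 = 1)) (K.family φ (i % K.S N)) :=
      fun hh => hφ (φ.satisfiable_iff.2 ⟨f, hit_of_hit_iterate _ _ hh⟩)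
    rw [Hit] at hno
    push Not at hno
    obtain ⟨Z, hZ, hno⟩ := hno
    obtain ⟨l, hl, t, ht, rfl, hyt⟩ := (hy _ hi).exists_index Z hZ
    have hT : ((t : ℤ) + 1 - 1).toNat = t := by omega
    refine ⟨l, by rw [d]; omega, Or.inl ⟨hl, ?_⟩, Or.inl ⟨hl, ?_⟩⟩
    · rw [hyt]
      refine ⟨by omega, fun v _ hv hold => hno v (by rwa [hT] at hv) ?_⟩
      simp only [hf]
      rw [if_pos hold.1, hold.2]
    · rw [← hs, hyt]
      refine ⟨by omega, fun v _ hv hold => hno v (by rwa [hT] at hv) ?_⟩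
      simp only [hf]
      rw [if_neg hold.1, hold.2]
  · obtain ⟨e, he, hne⟩ := exists_bit_ne hi hj hs
    have h2 : j % K.S N / 2 ^ e % 2 < 2 := Nat.mod_lt _ (by omega)
    have hc : K.cap N + (2 * e + j % K.S N / 2 ^ e % 2) - K.cap N =
      2 * e + j % K.S N / 2 ^ e % 2 := by omega
    have hd2 : (2 * e + j % K.S N / 2 ^ e % 2) / 2 = e := by omega
    have hm2 : (2 * e + j % K.S N / 2 ^ e % 2) % 2 = j % K.S N / 2 ^ e % 2 := by omega
    refine ⟨K.cap N + (2 * e + j % K.S N / 2 ^ e % 2), by rw [d]; omega, Or.inr ⟨by omega, ?_⟩,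
      Or.inr ⟨by omega, ?_⟩⟩
    · rw [hc, hd2, hm2]; exact hne
    · rw [hc, hd2, hm2]

theorem Valid.exists_dot_eq_zero (h : K.Valid) (φ : KCNF K.k) {y : ℕ → ℤ}
    (hy : ∀ s < K.S φ.numVars, Lists (2 * φ.numVars) K.k (K.cap φ.numVars)
      (fun l => y (s * K.cap φ.numVars + l)) (K.family φ s)) (hφ : φ.Satisfiable) :
    ∃ (i : Fin (K.m φ.numVars)) (j : Fin (K.n φ.numVars)),
      ∑ c, (K.inst φ.numVars y).x i c * (K.inst φ.numVars y).w j c = 0 := by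
  obtain ⟨i, hi, j, hj, hc⟩ := h.exists_disjoint φ hy hφ
  refine ⟨⟨i, hi⟩, ⟨j, hj⟩, sum_eq_zero fun c _ => ?_⟩
  have := hc c
  simp only [inst]
  split_ifs <;> simp_all

theorem Valid.dot_le (φ : KCNF K.k) {y : ℕ → ℤ}
    (hy : ∀ s < K.S φ.numVars, Lists (2 * φ.numVars) K.k (K.cap φ.numVars)
      (fun l => y (s * K.cap φ.numVars + l)) (K.family φ s)) (hφ : ¬ φ.Satisfiable)
    (i : Fin (K.m φ.numVars)) (j : Fin (K.n φ.numVars)) :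
    ∑ c, (K.inst φ.numVars y).x i c * (K.inst φ.numVars y).w j c ≤ -(K.W φ.numVars : ℤ) := by
  obtain ⟨c, hc, hl, hr⟩ := Valid.exists_common φ hy hφ i j
  have hnp : ∀ c, (K.inst φ.numVars y).x i c * (K.inst φ.numVars y).w j c ≤ 0 := by
    intro c
    simp only [inst]
    split_ifs <;> simp
  rw [← add_sum_erase _ _ (mem_univ (⟨c, hc⟩ : Fin (K.inst φ.numVars y).d))]
  refine (add_le_add le_rfl (sum_nonpos fun c _ => hnp c)).trans ?_
  simp only [inst]
  rw [if_pos hl, if_pos hr]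
  simp

end Consts

end RAM

/-! ## The gradient at the top layer zero -/

/-- At the zero top layer all predictions vanish, so `ℓ` need be differentiable only at `0`, which
holds for the hinge loss too. Each term of the risk is `ℓ` after a linear functional of `α`. -/
theorem hasGradientAt_empiricalRisk {n m d : ℕ} {ℓ : ℝ → ℝ} {c : ℝ} (hℓ : HasDerivAt ℓ c 0)
    (x : Fin m → Fin d → ℝ) (y : Fin m → ℝ) (w : Fin n → Fin d → ℝ) :
    HasGradientAt (empiricalRisk ℓ x y w)
      (WithLp.toLp 2 fun j => c * ∑ i, y i * Real.sigmoid (∑ k, x i k * w j k)) 0 := by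
  rw [hasGradientAt_iff_hasFDerivAt]
  set v : Fin m → EuclideanSpace ℝ (Fin n) := fun i =>
    WithLp.toLp 2 fun j => y i * Real.sigmoid (∑ k, x i k * w j k) with hv
  have hnet : ∀ i α, y i * network w α (x i) = InnerProductSpace.toDual ℝ _ (v i) α := by
    intro i α
    rw [InnerProductSpace.toDual_apply_apply, PiLp.inner_apply, network, Finset.mul_sum]
    refine Finset.sum_congr rfl fun j _ => ?_
    simp [hv]; ring
  have h1 : ∀ i, HasFDerivAt (fun α => ℓ (y i * network w α (x i)))
      (c • (InnerProductSpace.toDual ℝ (EuclideanSpace ℝ (Fin n)) (v i) :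
        EuclideanSpace ℝ (Fin n) →L[ℝ] ℝ)) 0 := by
    intro i
    have h2 : HasFDerivAt (fun α => y i * network w α (x i))
        (InnerProductSpace.toDual ℝ (EuclideanSpace ℝ (Fin n)) (v i) :
          EuclideanSpace ℝ (Fin n) →L[ℝ] ℝ) 0 := by
      simp only [hnet]
      exact ContinuousLinearMap.hasFDerivAt _
    have h3 : HasDerivAt ℓ c (y i * network w 0 (x i)) := by
      rw [hnet, map_zero]; exact hℓ
    exact h3.comp_hasFDerivAt 0 h2
  have h4 := HasFDerivAt.fun_sum (u := Finset.univ) fun i _ => h1 i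
  have h5 : (WithLp.toLp 2 fun j => c * ∑ i, y i * Real.sigmoid (∑ k, x i k * w j k) :
      EuclideanSpace ℝ (Fin n)) = ∑ i, c • v i := by
    ext j
    simp [hv, Finset.mul_sum]
  refine HasFDerivAt.congr_fderiv h4 ?_
  rw [h5, map_sum]
  exact Finset.sum_congr rfl fun i _ => by simp

theorem hasDerivAt_hingeLoss : HasDerivAt hingeLoss (-1) 0 := by
  have h : HasDerivAt (fun z : ℝ => 1 - z) (-1) 0 := by
    simpa using (hasDerivAt_id (0 : ℝ)).const_sub 1
  refine h.congr_of_eventuallyEq ?_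
  filter_upwards [Iio_mem_nhds (show (0 : ℝ) < 1 by norm_num)] with z hz
  rw [hingeLoss, max_eq_right]
  rw [Set.mem_Iio] at hz
  linarith

theorem hasDerivAt_logisticLoss : HasDerivAt logisticLoss (-(1 / (2 * Real.log 2))) 0 := by
  have h1 : HasDerivAt (fun z : ℝ => 1 + Real.exp (-z)) (-1) 0 := by
    have := ((hasDerivAt_id (0 : ℝ)).neg.exp).const_add 1
    simpa using this
  have h2 := (h1.log (by positivity)).const_mul (1 / Real.log 2)
  refine h2.congr_deriv ?_
  have := Real.log_pos (show (1 : ℝ) < 2 by norm_num)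
  simp
  field_simp
  norm_num

/-- The values of `c` are `1` and `1 / (2 log 2) ≈ 0.72`. The reduction needs only this window: `c /
2 ≥ 0.35` for satisfiable formulas and `c ≤ 1` for unsatisfiable ones. -/
theorem exists_hasDerivAt_loss {ℓ : ℝ → ℝ} (hℓ : ℓ = hingeLoss ∨ ℓ = logisticLoss) :
    ∃ c, HasDerivAt ℓ (-c) 0 ∧ 7 / 10 ≤ c ∧ c ≤ 1 := by
  rcases hℓ with rfl | rfl
  · exact ⟨1, hasDerivAt_hingeLoss, by norm_num, le_rfl⟩
  · refine ⟨_, hasDerivAt_logisticLoss, ?_, ?_⟩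
    · rw [div_le_div_iff₀ (by norm_num) (by positivity)]
      have := Real.log_two_lt_d9
      linarith
    · rw [div_le_one (by positivity)]
      have := Real.log_two_gt_d9
      linarith

theorem sigmoid_le_exp (z : ℝ) : Real.sigmoid z ≤ Real.exp z := by
  rw [Real.sigmoid_def, ← inv_inv (Real.exp z), ← Real.exp_neg]
  gcongr
  linarith

theorem abs_sum_sigmoid {ι κ : Type*} (s : Finset ι) (t : Finset κ) (f : κ → ι → ℝ) :
    |∑ j ∈ t, ∑ i ∈ s, Real.sigmoid (f j i)| = ∑ j ∈ t, ∑ i ∈ s, Real.sigmoid (f j i) :=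
  abs_of_nonneg (Finset.sum_nonneg fun _ _ => Finset.sum_nonneg fun _ _ => (Real.sigmoid_pos _).le)

/-- The gap in the sum of the gradient entries. -/
theorem sum_gradient_gap {ℓ : ℝ → ℝ} {c : ℝ} (hℓ : HasDerivAt ℓ c 0) (n m d : ℕ)
    (a : Fin m → Fin d → ℝ) (b : Fin n → Fin d → ℝ) (hn : 1 ≤ n) (hm : m ≤ n ^ 8)
    (ha : ∀ i k, a i k = 0 ∨ a i k = 1) (hb : ∀ j k, b j k = 0 ∨ b j k = 1) :
    ∃ g : EuclideanSpace ℝ (Fin n),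
      HasGradientAt
        (empiricalRisk ℓ a (fun _ => 1) (fun j k => -10 * Real.log (n : ℝ) * b j k)) g 0 ∧
      ((∃ i j, ∑ k, a i k * b j k = 0) → |c| / 2 ≤ |∑ j, g j|) ∧
      ((∀ i j, ∑ k, a i k * b j k ≠ 0) → |∑ j, g j| ≤ |c| / (n : ℝ)) := by
  have hn' : (1 : ℝ) ≤ n := by exact_mod_cast hn
  have hn0 : (0 : ℝ) < n := by linarith
  have hlog : 0 ≤ Real.log (n : ℝ) := Real.log_nonneg hn'
  refine ⟨_, hasGradientAt_empiricalRisk hℓ _ _ _, ?_, ?_⟩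
  all_goals
    intro h
    simp only [one_mul, ← Finset.mul_sum, abs_mul, abs_sum_sigmoid]
    have hdot : ∀ i j, ∑ k, a i k * (-10 * Real.log (n : ℝ) * b j k) =
        -10 * Real.log (n : ℝ) * ∑ k, a i k * b j k := fun i j => by
      rw [Finset.mul_sum]; exact Finset.sum_congr rfl fun k _ => by ring
    simp only [hdot]
  · obtain ⟨i, j, hij⟩ := h
    rw [div_eq_mul_inv]
    refine mul_le_mul_of_nonneg_left ?_ (abs_nonneg _)
    have h1 : Real.sigmoid (-10 * Real.log (n : ℝ) * ∑ k, a i k * b j k) = 2⁻¹ := by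
      rw [hij, mul_zero, Real.sigmoid_zero]
    rw [← h1]
    refine (Finset.single_le_sum (f := fun i =>
      Real.sigmoid (-10 * Real.log (n : ℝ) * ∑ k, a i k * b j k))
      (fun _ _ => (Real.sigmoid_pos _).le) (Finset.mem_univ i)).trans ?_
    exact Finset.single_le_sum (f := fun j => ∑ i,
      Real.sigmoid (-10 * Real.log (n : ℝ) * ∑ k, a i k * b j k))
      (fun _ _ => Finset.sum_nonneg fun _ _ => (Real.sigmoid_pos _).le) (Finset.mem_univ j)
  · rw [div_eq_mul_inv]
    refine mul_le_mul_of_nonneg_left ?_ (abs_nonneg _)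
    have hone : ∀ i j, 1 ≤ ∑ k, a i k * b j k := by
      intro i j
      have h0 : ∀ k, a i k * b j k = 0 ∨ a i k * b j k = 1 := fun k => by
        rcases ha i k with h | h <;> rcases hb j k with h' | h' <;> simp [h, h']
      obtain ⟨k, hk⟩ : ∃ k, a i k * b j k = 1 := by
        by_contra! hne
        exact h i j (Finset.sum_eq_zero fun k _ => (h0 k).resolve_right (hne k))
      rw [← hk]
      exact Finset.single_le_sum (f := fun k => a i k * b j k)
        (fun k _ => by rcases h0 k with h | h <;> simp [h]) (Finset.mem_univ k)
    -- A nonzero 0-1 inner product is at least `1`, so each unit is at most `exp (-10 log n) = n ^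
    -- (-10)`; the `n * m ≤ n ^ 9` terms then sum to at most `1 / n`.
    have hsig : ∀ i j, Real.sigmoid (-10 * Real.log (n : ℝ) * ∑ k, a i k * b j k) ≤
        ((n : ℝ) ^ 10)⁻¹ := by
      intro i j
      refine (sigmoid_le_exp _).trans ?_
      rw [← Real.exp_log (show (0 : ℝ) < ((n : ℝ) ^ 10)⁻¹ by positivity), Real.log_inv,
        Real.log_pow]
      refine Real.exp_le_exp.2 ?_
      push_cast
      nlinarith [hone i j]
    calc ∑ j : Fin n, ∑ i, Real.sigmoid (-10 * Real.log (n : ℝ) * ∑ k, a i k * b j k)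
        ≤ ∑ j : Fin n, ∑ i : Fin m, ((n : ℝ) ^ 10)⁻¹ :=
          Finset.sum_le_sum fun j _ => Finset.sum_le_sum fun i _ => hsig i j
      _ = n * (m * ((n : ℝ) ^ 10)⁻¹) := by simp
      _ ≤ n * ((n : ℝ) ^ 8 * ((n : ℝ) ^ 10)⁻¹) := by
        gcongr; exact_mod_cast hm
      _ = (n : ℝ)⁻¹ := by field_simp

/-! ### From approximate gradients to deciding satisfiability. -/

namespace RAM

open Finset Sparsification

namespace Consts

variable {K : Consts}

/-- `m` is `2` to the power `b p r`, and `W` exceeds this exponent by `5`; moreover `2 ≤ e` and `e ^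
5 ≥ 100`. -/
theorem m_mul_exp_le (K : Consts) (N : ℕ) : (K.m N : ℝ) * Real.exp (-(K.W N : ℝ)) ≤ 1 / 100 := by
  have he := Real.exp_one_gt_d9
  have h1 : (K.m N : ℝ) ≤ Real.exp ((K.b * K.p * K.r N : ℕ) : ℝ) := by
    rw [m, ← mul_one ((K.b * K.p * K.r N : ℕ) : ℝ), Real.exp_nat_mul]
    push_cast
    gcongr
    linarith
  have h2 : (100 : ℝ) ≤ Real.exp ((5 : ℕ) : ℝ) := by
    rw [← mul_one ((5 : ℕ) : ℝ), Real.exp_nat_mul]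
    calc (100 : ℝ) ≤ 2.7 ^ 5 := by norm_num
      _ ≤ _ := by gcongr; linarith
  rw [Real.exp_neg, ← div_eq_mul_inv, div_le_div_iff₀ (Real.exp_pos _) (by norm_num), one_mul, W,
    Nat.cast_add, Real.exp_add]
  gcongr

theorem isBasic_inst {D : ℕ → ℕ} {N : ℕ} (y : ℕ → ℤ) (hd : K.d N ≤ D (K.n N))
    (hW : K.W N ≤ D (K.n N)) : (K.inst N y).IsBasic D := by
  refine ⟨hd, fun i c => ?_, fun _ => rfl, fun j c => ?_, fun _ => rfl⟩
  · simp only [inst]; split_ifs <;> simp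
  · simp only [inst]
    split_ifs
    · rw [abs_neg, Nat.abs_cast]; exact_mod_cast hW
    · simp

theorem hasGradientAt_inst {ℓ : ℝ → ℝ} {c : ℝ} (hℓ : HasDerivAt ℓ (-c) 0) {N : ℕ} {y : ℕ → ℤ}
    {g : EuclideanSpace ℝ (Fin (K.inst N y).n)}
    (hg : HasGradientAt ((K.inst N y).risk ℓ) g
      (WithLp.toLp 2 fun j => ((K.inst N y).α j : ℝ))) (j : Fin (K.n N)) :
    g j = -c * ∑ i, Real.sigmoid
      ((∑ e, (K.inst N y).x i e * (K.inst N y).w j e : ℤ) : ℝ) := by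
  have h0 : (WithLp.toLp 2 fun j => ((K.inst N y).α j : ℝ) :
      EuclideanSpace ℝ (Fin (K.inst N y).n)) = 0 := by
    ext j; simp [inst]
  rw [h0] at hg
  rw [hg.unique (hasGradientAt_empiricalRisk hℓ _ _ _)]
  simp [inst]

theorem gradient_le_of_satisfiable {ℓ : ℝ → ℝ} {c : ℝ} (hℓ : HasDerivAt ℓ (-c) 0)
    (hc : 7 / 10 ≤ c) (hK : K.Valid) (φ : KCNF K.k) {y : ℕ → ℤ}
    (hy : ∀ s < K.S φ.numVars, Lists (2 * φ.numVars) K.k (K.cap φ.numVars)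
      (fun l => y (s * K.cap φ.numVars + l)) (K.family φ s)) (hφ : φ.Satisfiable)
    {g : EuclideanSpace ℝ (Fin (K.inst φ.numVars y).n)}
    (hg : HasGradientAt ((K.inst φ.numVars y).risk ℓ) g
      (WithLp.toLp 2 fun j => ((K.inst φ.numVars y).α j : ℝ))) :
    ∃ j : Fin (K.n φ.numVars), g j ≤ -(35 / 100) := by
  obtain ⟨i, j, hij⟩ := hK.exists_dot_eq_zero φ hy hφ
  refine ⟨j, ?_⟩
  rw [hasGradientAt_inst hℓ hg]
  have h1 : (2 : ℝ)⁻¹ ≤ ∑ i, Real.sigmoid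
      ((∑ e, (K.inst φ.numVars y).x i e * (K.inst φ.numVars y).w j e : ℤ) : ℝ) := by
    rw [← Real.sigmoid_zero, ← Int.cast_zero, ← hij]
    exact Finset.single_le_sum (f := fun i => Real.sigmoid
      ((∑ e, (K.inst φ.numVars y).x i e * (K.inst φ.numVars y).w j e : ℤ) : ℝ))
      (fun _ _ => (Real.sigmoid_pos _).le) (Finset.mem_univ i)
  nlinarith

theorem le_gradient_of_not_satisfiable {ℓ : ℝ → ℝ} {c : ℝ} (hℓ : HasDerivAt ℓ (-c) 0)
    (hc : c ≤ 1) (φ : KCNF K.k) {y : ℕ → ℤ}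
    (hy : ∀ s < K.S φ.numVars, Lists (2 * φ.numVars) K.k (K.cap φ.numVars)
      (fun l => y (s * K.cap φ.numVars + l)) (K.family φ s)) (hφ : ¬ φ.Satisfiable)
    {g : EuclideanSpace ℝ (Fin (K.inst φ.numVars y).n)}
    (hg : HasGradientAt ((K.inst φ.numVars y).risk ℓ) g
      (WithLp.toLp 2 fun j => ((K.inst φ.numVars y).α j : ℝ))) (j : Fin (K.n φ.numVars)) :
    -(1 / 100) ≤ g j := by
  rw [hasGradientAt_inst hℓ hg]
  have h1 : ∑ i, Real.sigmoid
      ((∑ e, (K.inst φ.numVars y).x i e * (K.inst φ.numVars y).w j e : ℤ) : ℝ) ≤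
      K.m φ.numVars * Real.exp (-(K.W φ.numVars : ℝ)) := by
    refine (Finset.sum_le_card_nsmul _ _ (Real.exp (-(K.W φ.numVars : ℝ))) fun i _ =>
      (sigmoid_le_exp _).trans (Real.exp_le_exp.2 ?_)).trans ?_
    · exact_mod_cast Valid.dot_le φ hy hφ i j
    · rw [Finset.card_univ, Fintype.card_fin, nsmul_eq_mul]; rfl
  have h2 := K.m_mul_exp_le φ.numVars
  have h3 : 0 ≤ ∑ i, Real.sigmoid
      ((∑ e, (K.inst φ.numVars y).x i e * (K.inst φ.numVars y).w j e : ℤ) : ℝ) :=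
    Finset.sum_nonneg fun _ _ => (Real.sigmoid_pos _).le
  nlinarith

/-- A bound for the bit lengths and the small values. -/
def bound (K : Consts) (N M : ℕ) : ℕ :=
  K.k + 2 * N + (K.k + 1) * (K.k + 1) * (2 * N) ^ K.k + M + K.a N + K.r N + K.E N + K.d N + K.L N +
    M * K.k + 10

/-- The exponentially large `S`, `n`, `m` enter only through their lengths, at most `E + 2`. This is
possible because they are kept outside the first ten variables, whose values must be small. -/
theorem Good.fits (hK : K.Good) (N M : ℕ) : K.Fits N M (K.bound N M) := by
  have h1 := (hK.ba_le_p N).trans (p_le_E N)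
  have h2 := p_le_E (K := K) N
  have h3 := q_le_E (K := K) N
  have hU : (2 * N) ^ K.k ≤ (K.k + 1) * (K.k + 1) * (2 * N) ^ K.k :=
    Nat.le_mul_of_pos_left _ (by positivity)
  have hc : K.cap N ≤ K.d N := Nat.le_add_right _ _
  have hpow : ∀ j, len ((2 ^ j : ℕ) : ℤ) ≤ j + 2 := fun j =>
    len_le_of_lt_two_pow (by rw [Int.natAbs_natCast]; exact Nat.pow_lt_pow_right (by omega) (by omega))
  have hS : len (K.S N : ℤ) ≤ K.E N + 2 := (hpow _).trans (by omega)
  have hn : len (K.n N : ℤ) ≤ K.E N + 2 := (hpow _).trans (by omega)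
  have hm : len (K.m N : ℤ) ≤ K.E N + 2 := (hpow _).trans (by omega)
  have hd : len (K.d N : ℤ) ≤ K.d N + 1 := len_natCast_le _
  have hnat : ∀ {i X : ℕ}, i + 1 ≤ X → len (i : ℤ) ≤ X := fun h => (len_natCast_le _).trans h
  have h22 : len ((K.m N * K.d N : ℕ) : ℤ) ≤ len (K.m N : ℤ) + len (K.d N : ℤ) := by
    rw [Nat.cast_mul]; exact len_mul_le _ _
  have h23 : len ((K.n N * K.d N : ℕ) : ℤ) ≤ len (K.n N : ℤ) + len (K.d N : ℤ) := by
    rw [Nat.cast_mul]; exact len_mul_le _ _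
  refine ⟨?_, fun x => ?_, fun x hx => ?_, ?_, ?_, ?_, ?_⟩
  · rw [bound]; omega
  · rw [bound]
    unfold glob
    split
    case h_10 => omega
    case h_11 => omega
    case h_12 => omega
    case h_16 => omega
    case h_17 => omega
    all_goals
      refine hnat ?_
      try simp only [W, E₁]
      omega
  · rw [bound]
    interval_cases x <;> simp only [glob] <;> omega
  all_goals rw [bound]; omega

theorem cast_m (hq : 1 ≤ K.q) {κ : ℚ} (hκ : κ = (K.p : ℚ) / K.q) (N : ℕ) :
    (K.m N : ℝ) = (K.n N : ℝ) ^ (κ : ℝ) := by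
  have hq' : (0 : ℝ) < K.q := by exact_mod_cast hq
  rw [m, n, hκ, Nat.cast_pow, Nat.cast_pow, ← Real.rpow_natCast, ← Real.rpow_natCast,
    ← Real.rpow_mul (by norm_num)]
  congr 1
  push_cast
  field_simp

/-- The threshold `-1 / 5` survives the error `1 / 10`: some output is at most `-0.35 + 0.1` for
satisfiable formulas, and all are at least `-0.01 - 0.1` for unsatisfiable ones. -/
theorem Valid.exists_decidedBy (hK : K.Valid) {ℓ : ℝ → ℝ} (hℓ : ℓ = hingeLoss ∨ ℓ = logisticLoss)
    {D : ℕ → ℕ} (hD : ∀ N, K.d N ≤ D (K.n N) ∧ K.W N ≤ D (K.n N)) {κ : ℚ}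
    (hκ : κ = (K.p : ℚ) / K.q) {T : ℕ → ℕ → ℝ} {P : Program}
    (hP : ∀ I : GradInstance, I.IsBasic D → 1 ≤ I.n → (I.m : ℝ) = (I.n : ℝ) ^ (κ : ℝ) →
      I.GradientComputedBy ℓ P (T I.n I.m)) : ∃ (Q : Program) (e : ℕ), ∀ φ : KCNF K.k,
    φ.DecidedBy Q ((K.n φ.numVars + K.m φ.numVars) * (K.bound φ.numVars φ.numClauses : ℝ) ^ e +
      61 * T (K.n φ.numVars) (K.m φ.numVars)) := by
  classical
  obtain ⟨Q, e, hQ⟩ := K.exists_program hK.good P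
  obtain ⟨c, hc, hc1, hc2⟩ := exists_hasDerivAt_loss hℓ
  refine ⟨Q, e, fun φ => ?_⟩
  obtain ⟨y, hy, hrun⟩ := hQ φ _ (hK.good.fits _ _) (hK.le_E _) fun s _ => hK.card_family_le φ s
  set N := φ.numVars
  obtain ⟨s, t, hst, ht, g, hg, hout⟩ := hP (K.inst N y)
    (isBasic_inst y (hD N).1 (hD N).2) Nat.one_le_two_pow (cast_m hK.q_pos hκ N)
  obtain ⟨s', t', hst', ht', hs'⟩ := hrun s t hst
  refine ⟨s', t', hst', ?_, fun hφ => ?_, fun hφ => ?_⟩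
  · have h1 : (t' : ℝ) ≤ (K.n N + K.m N) * (K.bound N φ.numClauses : ℝ) ^ e + 61 * t := by
      exact_mod_cast ht'
    have h2 : (t : ℝ) ≤ T (K.n N) (K.m N) := ht
    linarith
  · obtain ⟨j, hj⟩ := gradient_le_of_satisfiable hc hc1 hK φ hy hφ hg
    rw [hs', if_pos]
    refine ⟨j, j.2, ?_⟩
    obtain ⟨h1, h2⟩ := hout j
    have h3 : (0 : ℝ) < s.arr 5 j := by exact_mod_cast h1
    have h4 := (abs_le.1 h2).2
    have h5 : (s.arr 4 j : ℝ) / s.arr 5 j < -(1 / 5) := by linarith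
    rw [div_lt_iff₀ h3] at h5
    have h6 : (5 * s.arr 4 j + s.arr 5 j : ℝ) < 0 := by linarith
    exact_mod_cast h6
  · rw [hs', if_neg]
    rintro ⟨j, hjn, hneg⟩
    have h1 : 0 < s.arr 5 j := (hout ⟨j, hjn⟩).1
    have h2 : |(s.arr 4 j : ℝ) / s.arr 5 j - g ⟨j, hjn⟩| ≤ 1 / 10 := (hout ⟨j, hjn⟩).2
    have hj : -(1 / 100) ≤ g ⟨j, hjn⟩ := le_gradient_of_not_satisfiable hc hc2 φ hy hφ hg ⟨j, hjn⟩
    have h3 : (0 : ℝ) < s.arr 5 j := by exact_mod_cast h1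
    have h4 := (abs_le.1 h2).1
    have h5 : -(1 / 5) < (s.arr 4 j : ℝ) / s.arr 5 j := by linarith
    rw [lt_div_iff₀ h3] at h5
    have h6 : (5 * s.arr 4 j + s.arr 5 j : ℝ) < 0 := by exact_mod_cast hneg
    linarith

end Consts

end RAM

/-! ### Running time of the reduction and existence of the constants. -/

namespace RAM

namespace Consts

variable {K : Consts}

theorem a_le (K : Consts) (N : ℕ) : K.a N ≤ N + 1 := Nat.add_le_add_right (Nat.div_le_self _ _) 1

theorem exists_bound_le (K : Consts) :
    ∃ A : ℕ, ∀ N M, K.bound N M ≤ A * (N + 1) ^ (K.k + 1) * (M + 1) := by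
  refine ⟨K.k + 2 + (K.k + 1) * (K.k + 1) * 2 ^ K.k + 1 + 1 + (K.h + K.r₀) +
    K.b * (K.p + K.q) * (K.h + K.r₀) + (K.cap₁ + 2 * K.b) + (K.L₁ + 1) + K.k + 10, fun N M => ?_⟩
  set G := (N + 1) ^ (K.k + 1) * (M + 1) with hG
  have hu : 1 ≤ (N + 1) ^ K.k := Nat.one_le_pow _ _ (by omega)
  have hG1 : N + 1 ≤ G := by
    calc N + 1 = 1 * (N + 1) * 1 := by ring
      _ ≤ (N + 1) ^ K.k * (N + 1) * (M + 1) := by gcongr; omega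
      _ = G := by rw [hG, pow_succ]
  have hG2 : (N + 1) ^ K.k ≤ G := by
    calc (N + 1) ^ K.k = (N + 1) ^ K.k * 1 * 1 := by ring
      _ ≤ (N + 1) ^ K.k * (N + 1) * (M + 1) := by gcongr <;> omega
      _ = G := by rw [hG, pow_succ]
  have hG3 : M + 1 ≤ G := by
    rw [hG]
    exact Nat.le_mul_of_pos_left _ (by positivity)
  have ha := K.a_le N
  have hr : K.r N ≤ (K.h + K.r₀) * (N + 1) := by
    calc K.r N ≤ K.h * (N + 1) + K.r₀ * 1 := by rw [r]; gcongr; omega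
      _ ≤ K.h * (N + 1) + K.r₀ * (N + 1) := by gcongr; omega
      _ = _ := by ring
  have h1 : K.r N ≤ (K.h + K.r₀) * G := hr.trans (Nat.mul_le_mul_left _ hG1)
  have h2 : K.E N ≤ K.b * (K.p + K.q) * (K.h + K.r₀) * G := by
    rw [E, mul_assoc _ (K.h + K.r₀)]; exact Nat.mul_le_mul_left _ h1
  have h3 : K.d N ≤ (K.cap₁ + 2 * K.b) * G := by
    calc K.d N = (K.cap₁ + 2 * K.b) * K.a N := by rw [d, cap]; ring
      _ ≤ _ := Nat.mul_le_mul_left _ (ha.trans hG1)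
  have h4 : K.L N ≤ (K.L₁ + 1) * G := by
    calc K.L N ≤ K.L₁ * G + 1 * G := by rw [L]; gcongr <;> omega
      _ = _ := by ring
  have h5 : (K.k + 1) * (K.k + 1) * (2 * N) ^ K.k ≤ (K.k + 1) * (K.k + 1) * 2 ^ K.k * G := by
    rw [mul_assoc _ (2 ^ K.k)]
    refine Nat.mul_le_mul_left _ ?_
    calc (2 * N) ^ K.k ≤ (2 * (N + 1)) ^ K.k := Nat.pow_le_pow_left (by omega) _
      _ = 2 ^ K.k * (N + 1) ^ K.k := mul_pow _ _ _
      _ ≤ _ := Nat.mul_le_mul_left _ hG2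
  have h6 : K.k ≤ K.k * G := Nat.le_mul_of_pos_right _ (by omega)
  have h7 : M * K.k ≤ K.k * G := by rw [mul_comm]; exact Nat.mul_le_mul_left _ (by omega)
  rw [mul_assoc, ← hG]
  simp only [add_mul _ _ G] at *
  rw [bound]
  omega

/-- The factor of `N` is `b (p + q) h / Z = h / (h - 2)`; rounding in `a` and the offset `r₀` cost
only a constant. -/
theorem Valid.E_le (hK : K.Valid) (N : ℕ) : (K.E N : ℝ) ≤
    (1 + 2 / ((K.h : ℝ) - 2)) * N + K.b * (K.p + K.q) * (K.h + K.r₀) := by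
  have hZ : (0 : ℝ) < K.Z := by exact_mod_cast hK.Z_pos
  have hh : (0 : ℝ) < (K.h : ℝ) - 2 := by
    have : (3 : ℝ) ≤ K.h := by exact_mod_cast hK.h_gt
    linarith
  have hZe : (K.Z : ℝ) = (K.p + K.q) * K.b * (K.h - 2) := by
    rw [hK.Z_eq, Nat.cast_mul, Nat.cast_sub (by have := hK.h_gt; omega)]
    push_cast; ring
  have ha : (K.a N : ℝ) ≤ N / K.Z + 1 := by
    rw [a]; push_cast
    gcongr
    exact Nat.cast_div_le
  have hbpq : (0 : ℝ) < K.b * (K.p + K.q) := by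
    have h1 : (1 : ℝ) ≤ K.b := by exact_mod_cast hK.b_pos
    have h2 : (1 : ℝ) ≤ K.p := by exact_mod_cast hK.p_pos
    positivity
  calc (K.E N : ℝ) = K.b * (K.p + K.q) * (K.h * K.a N + K.r₀) := by rw [E, r]; push_cast; ring
    _ ≤ K.b * (K.p + K.q) * (K.h * (N / K.Z + 1) + K.r₀) := by gcongr
    _ = K.b * (K.p + K.q) * K.h / K.Z * N + K.b * (K.p + K.q) * (K.h + K.r₀) := by
      field_simp
      ring
    _ = _ := by
      congr 2
      rw [hZe]
      have h1 : (K.b : ℝ) ≠ 0 := by rintro h; simp [h] at hbpq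
      have h2 : (K.p : ℝ) + K.q ≠ 0 := by rintro h; simp [h] at hbpq
      field_simp
      ring

theorem exists_pow_le (J : ℕ) {ε : ℝ} (hε : 0 < ε) :
    ∃ C : ℝ, 0 ≤ C ∧ ∀ N : ℕ, ((N : ℝ) + 1) ^ J ≤ C * (2 : ℝ) ^ (ε * N) := by
  have hr : 1 < (2 : ℝ) ^ ε := Real.one_lt_rpow (by norm_num) hε
  obtain ⟨C, hC⟩ := (tendsto_pow_const_div_const_pow_of_one_lt J hr).bddAbove_range
  refine ⟨max C 0 * (2 : ℝ) ^ ε, by positivity, fun N => ?_⟩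
  have h1 := hC (Set.mem_range_self (N + 1))
  rw [div_le_iff₀ (by positivity)] at h1
  push_cast at h1
  refine h1.trans ?_
  rw [pow_succ, ← Real.rpow_natCast, ← Real.rpow_mul (by norm_num)]
  calc C * ((2 : ℝ) ^ (ε * N) * 2 ^ ε) ≤ max C 0 * ((2 : ℝ) ^ (ε * N) * 2 ^ ε) := by
        gcongr; exact le_max_left _ _
    _ = _ := by ring

/-- The exponent `θ` dominates `1 - ε`, `p / (p + q)` and `q / (p + q)`, so `(n m) ^ (1 - ε)`, `m`
and `n` are all at most `2 ^ (θ E)`. By `hθ` this is `2 ^ ((1 - 2 ε') N)` up to a constant, and one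
`ε'` is spent on polynomial factors in `N`. -/
theorem Valid.exists_time_le (hK : K.Valid) {θ ε ε' : ℝ} (C : ℝ) (e : ℕ) (hθ0 : 0 ≤ θ)
    (hθ1 : θ ≤ 1) (hε : 1 - ε ≤ θ) (hp : (K.p : ℝ) ≤ θ * (K.p + K.q))
    (hq : (K.q : ℝ) ≤ θ * (K.p + K.q)) (hε' : 0 < ε')
    (hθ : θ * (1 + 2 / ((K.h : ℝ) - 2)) ≤ 1 - 2 * ε') : ∃ C' : ℝ, ∀ N M : ℕ,
    (K.n N + K.m N) * (K.bound N M : ℝ) ^ e + 61 * (C * ((K.n N : ℝ) * K.m N) ^ (1 - ε)) ≤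
      C' * (2 : ℝ) ^ ((1 - ε') * N) * ((M : ℝ) + 1) ^ e := by
  obtain ⟨A, hA⟩ := K.exists_bound_le
  obtain ⟨C₁, hC₁, hpow⟩ := exists_pow_le ((K.k + 1) * e) hε'
  set c : ℝ := K.b * (K.p + K.q) * (K.h + K.r₀) with hc
  have hc0 : 0 ≤ c := by positivity
  refine ⟨2 * 2 ^ c * A ^ e * C₁ + 61 * |C| * 2 ^ c, fun N M => ?_⟩
  have hθE : θ * K.E N ≤ (1 - 2 * ε') * N + c := by
    calc θ * K.E N ≤ θ * ((1 + 2 / ((K.h : ℝ) - 2)) * N + c) := by gcongr; exact hK.E_le N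
      _ = θ * (1 + 2 / ((K.h : ℝ) - 2)) * N + θ * c := by ring
      _ ≤ (1 - 2 * ε') * N + 1 * c := by gcongr
      _ = _ := by ring
  have hB : (2 : ℝ) ^ (θ * K.E N) ≤ 2 ^ c * 2 ^ ((1 - 2 * ε') * N) := by
    rw [← Real.rpow_add (by norm_num), add_comm c]
    exact Real.rpow_le_rpow_of_exponent_le (by norm_num) hθE
  have hE : (K.E N : ℝ) = K.b * (K.p + K.q) * K.r N := by rw [E]; push_cast; ring
  have hn : (K.n N : ℝ) ≤ 2 ^ (θ * K.E N) := by
    rw [n, Nat.cast_pow, ← Real.rpow_natCast, Nat.cast_ofNat]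
    refine Real.rpow_le_rpow_of_exponent_le (by norm_num) ?_
    rw [hE]; push_cast
    calc (K.b : ℝ) * K.q * K.r N = K.b * K.r N * K.q := by ring
      _ ≤ K.b * K.r N * (θ * (K.p + K.q)) := by gcongr
      _ = _ := by ring
  have hm : (K.m N : ℝ) ≤ 2 ^ (θ * K.E N) := by
    rw [m, Nat.cast_pow, ← Real.rpow_natCast, Nat.cast_ofNat]
    refine Real.rpow_le_rpow_of_exponent_le (by norm_num) ?_
    rw [hE]; push_cast
    calc (K.b : ℝ) * K.p * K.r N = K.b * K.r N * K.p := by ring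
      _ ≤ K.b * K.r N * (θ * (K.p + K.q)) := by gcongr
      _ = _ := by ring
  have hnm : ((K.n N : ℝ) * K.m N) ^ (1 - ε) ≤ 2 ^ (θ * K.E N) := by
    have : (K.n N : ℝ) * K.m N = 2 ^ (K.E N : ℝ) := by
      rw [Real.rpow_natCast, n, m, Nat.cast_pow, Nat.cast_pow, Nat.cast_ofNat, ← pow_add, E]
      congr 1; ring
    rw [this, ← Real.rpow_mul (by norm_num), mul_comm]
    exact Real.rpow_le_rpow_of_exponent_le (by norm_num) (by gcongr)
  have hbd : (K.bound N M : ℝ) ^ e ≤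
      A ^ e * (C₁ * 2 ^ (ε' * N)) * ((M : ℝ) + 1) ^ e := by
    calc (K.bound N M : ℝ) ^ e ≤ (A * ((N : ℝ) + 1) ^ (K.k + 1) * ((M : ℝ) + 1)) ^ e := by
          gcongr; exact_mod_cast hA N M
      _ = A ^ e * ((N : ℝ) + 1) ^ ((K.k + 1) * e) * ((M : ℝ) + 1) ^ e := by
          rw [mul_pow, mul_pow, ← pow_mul]
      _ ≤ _ := by gcongr; exact hpow N
  have hexp : (2 : ℝ) ^ ((1 - 2 * ε') * N) * 2 ^ (ε' * N) = 2 ^ ((1 - ε') * N) := by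
    rw [← Real.rpow_add (by norm_num)]; congr 1; ring
  have hexp' : (2 : ℝ) ^ ((1 - 2 * ε') * N) ≤ 2 ^ ((1 - ε') * N) := by
    refine Real.rpow_le_rpow_of_exponent_le (by norm_num) ?_
    gcongr; linarith
  have hM : (1 : ℝ) ≤ ((M : ℝ) + 1) ^ e := one_le_pow₀ (by have := Nat.cast_nonneg (α := ℝ) M; linarith)
  calc (K.n N + K.m N) * (K.bound N M : ℝ) ^ e + 61 * (C * ((K.n N : ℝ) * K.m N) ^ (1 - ε))
      ≤ (2 ^ c * 2 ^ ((1 - 2 * ε') * N) + 2 ^ c * 2 ^ ((1 - 2 * ε') * N)) *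
        (A ^ e * (C₁ * 2 ^ (ε' * N)) * ((M : ℝ) + 1) ^ e) +
        61 * (|C| * (2 ^ c * 2 ^ ((1 - ε') * N) * ((M : ℝ) + 1) ^ e)) := by
        gcongr
        · exact hn.trans hB
        · exact hm.trans hB
        · exact le_abs_self C
        · refine (hnm.trans hB).trans ?_
          rw [← mul_one ((2 : ℝ) ^ c * 2 ^ ((1 - 2 * ε') * N))]
          gcongr
    _ = 2 * 2 ^ c * A ^ e * C₁ * (2 ^ ((1 - 2 * ε') * N) * 2 ^ (ε' * N)) * ((M : ℝ) + 1) ^ e +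
        61 * |C| * 2 ^ c * 2 ^ ((1 - ε') * N) * ((M : ℝ) + 1) ^ e := by ring
    _ = _ := by rw [hexp]; ring

theorem exists_valid (k p q g : ℕ) (hp : 1 ≤ p) (hq : 1 ≤ q) (hg : 1 ≤ g) :
    ∃ γ b Z cap₁ L₁, ∀ r₀, Valid ⟨k, γ, b, p, q, Z, g + 2, r₀, cap₁, L₁⟩ := by
  -- The requirements are circular: `γ` must exceed a multiple of `Z`, and `Z` contains `b = log₂ (2
  -- γ ^ k)`. With `γ = 2 ^ e` one has `b = e k + 1`, linear in `e`, so a large `e` works.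
  obtain ⟨e, he⟩ : ∃ e : ℕ, 4 * k * 4 ^ k * ((p + q) * (e * k + 1) * g) ≤ 2 ^ e := by
    set c := 4 * k * 4 ^ k * (p + q) * g * (k + 1) with hc
    refine ⟨2 * (2 * c), ?_⟩
    have h1 : 2 * c < 2 ^ (2 * c) := Nat.lt_two_pow_self
    calc 4 * k * 4 ^ k * ((p + q) * (2 * (2 * c) * k + 1) * g)
        ≤ 4 * k * 4 ^ k * ((p + q) * ((2 * (2 * c) + 1) * (k + 1)) * g) := by
          gcongr; ring_nf; omega
      _ = c * (2 * (2 * c) + 1) := by rw [hc]; ring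
      _ ≤ 2 * c * (2 * c + 1) := by ring_nf; omega
      _ ≤ 2 ^ (2 * c) * 2 ^ (2 * c) := Nat.mul_le_mul h1.le h1
      _ = _ := by rw [← pow_add]; congr 1; ring
  exact ⟨2 ^ e, e * k + 1, (p + q) * (e * k + 1) * g,
    2 * ((p + q) * (e * k + 1) * g) * (k * (2 ^ e) ^ k) + 1,
    4 * ((p + q) * (e * k + 1) * g) * (k * 4 ^ k * (2 ^ e) ^ k), fun r₀ => ⟨hp, hq, by simp only; omega,
    Nat.one_le_two_pow, he, by rw [pow_succ, pow_mul, mul_comm], by simp only [Nat.add_sub_cancel],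
    rfl, rfl⟩⟩

end Consts

end RAM

/-! ### Fitting the dimension bound, and the contradiction with SETH. -/

namespace RAM

namespace Consts

variable {K : Consts}

theorem r_pos (hh : 1 ≤ K.h) (N : ℕ) : K.r₀ + 1 ≤ K.r N := by
  have : 1 * 1 ≤ K.h * K.a N := Nat.mul_le_mul hh (Nat.succ_pos _)
  rw [r]; omega

/-- Dimension and weights are linear in `r`, and `log n = b q r log 2 ≥ r / 2`. The offset `r₀`
forces `n ≥ r₀`, so the growth of `D` is needed only from `r₀` on, yet all `N` are covered. -/
theorem Valid.dim_le (hK : K.Valid) {D : ℕ → ℕ}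
    (hD : ∀ n : ℕ, K.r₀ ≤ n → 2 * ((K.cap₁ : ℝ) + 2 * K.b + K.b * K.p + 5) * Real.log n ≤ D n)
    (N : ℕ) : K.d N ≤ D (K.n N) ∧ K.W N ≤ D (K.n N) := by
  have hr := r_pos (K := K) (by have := hK.h_gt; omega) N
  have har : K.a N ≤ K.r N := by
    rw [r]
    exact (Nat.le_mul_of_pos_left _ (by have := hK.h_gt; omega)).trans (Nat.le_add_right _ _)
  have hrn : K.r N ≤ K.b * K.q * K.r N :=
    Nat.le_mul_of_pos_left _ (Nat.mul_pos hK.b_pos hK.q_pos)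
  have hn : K.r₀ ≤ K.n N := by
    have := (Nat.lt_two_pow_self (n := K.b * K.q * K.r N))
    rw [n]; omega
  have hlog : (K.r N : ℝ) ≤ 2 * Real.log (K.n N) := by
    have h2 := Real.log_two_gt_d9
    have h3 : (K.r N : ℝ) ≤ (K.b * K.q * K.r N : ℕ) := by exact_mod_cast hrn
    have h4 : (0 : ℝ) ≤ (K.b * K.q * K.r N : ℕ) := Nat.cast_nonneg _
    rw [n, Nat.cast_pow, Real.log_pow, Nat.cast_ofNat]
    nlinarith
  have key : (K.cap₁ + 2 * K.b + K.b * K.p + 5) * K.r N ≤ D (K.n N) := by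
    have h5 : ((K.cap₁ : ℝ) + 2 * K.b + K.b * K.p + 5) * K.r N ≤ D (K.n N) := by
      refine le_trans ?_ (hD _ hn)
      calc ((K.cap₁ : ℝ) + 2 * K.b + K.b * K.p + 5) * K.r N
          ≤ (K.cap₁ + 2 * K.b + K.b * K.p + 5) * (2 * Real.log (K.n N)) := by gcongr
        _ = _ := by ring
    exact_mod_cast h5
  constructor
  · calc K.d N = (K.cap₁ + 2 * K.b) * K.a N := by rw [d, cap]; ring
      _ ≤ (K.cap₁ + 2 * K.b + K.b * K.p + 5) * K.r N :=
        Nat.mul_le_mul (by omega) har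
      _ ≤ _ := key
  · calc K.W N = K.b * K.p * K.r N + 5 * 1 := rfl
      _ ≤ K.b * K.p * K.r N + 5 * K.r N := by gcongr; omega
      _ = (K.b * K.p + 5) * K.r N := by ring
      _ ≤ (K.cap₁ + 2 * K.b + K.b * K.p + 5) * K.r N := by gcongr; omega
      _ ≤ _ := key

end Consts

/-- The order of choices matters: `θ < 1` from `ε` and `κ`, then `g = h - 2` from `θ`, then `k` from
SETH, then the sparsification constants, and `r₀` last, from `D` and all the others. -/
theorem not_gradientComputedBy_of_SETH {ℓ : ℝ → ℝ} (hℓ : ℓ = hingeLoss ∨ ℓ = logisticLoss)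
    (hS : SETH) {D : ℕ → ℕ}
    (hD : Filter.Tendsto (fun n : ℕ => (D n : ℝ) / Real.log (n : ℝ)) Filter.atTop Filter.atTop)
    {κ : ℚ} (hκ : 0 < κ) {ε : ℝ} (hε : 0 < ε) (P : Program) (C : ℝ) :
    ¬ ∀ I : GradInstance, I.IsBasic D → 1 ≤ I.n → (I.m : ℝ) = (I.n : ℝ) ^ (κ : ℝ) →
      I.GradientComputedBy ℓ P (C * ((I.n : ℝ) * (I.m : ℝ)) ^ (1 - ε)) := by
  intro hP
  obtain ⟨p, q, hp, hq, hpq⟩ : ∃ p q : ℕ, 1 ≤ p ∧ 1 ≤ q ∧ κ = (p : ℚ) / q := by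
    have hnum := Rat.num_pos.2 hκ
    refine ⟨κ.num.toNat, κ.den, by omega, κ.den_pos, ?_⟩
    conv_lhs => rw [← Rat.num_div_den κ]
    congr 1
    exact_mod_cast (Int.toNat_of_nonneg hnum.le).symm
  have hp' : (1 : ℝ) ≤ p := by exact_mod_cast hp
  have hq' : (1 : ℝ) ≤ q := by exact_mod_cast hq
  obtain ⟨θ, hθ0, hθ1, hθε, hθp, hθq⟩ : ∃ θ : ℝ, 0 ≤ θ ∧ θ < 1 ∧ 1 - ε ≤ θ ∧
      (p : ℝ) ≤ θ * (p + q) ∧ (q : ℝ) ≤ θ * (p + q) := by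
    have h1 : (p : ℝ) / (p + q) < 1 := by rw [div_lt_one (by linarith)]; linarith
    have h2 : (q : ℝ) / (p + q) < 1 := by rw [div_lt_one (by linarith)]; linarith
    refine ⟨max (1 - ε) (max (p / (p + q)) (q / (p + q))), ?_, ?_, le_max_left _ _, ?_, ?_⟩
    · exact le_max_of_le_right (le_max_of_le_left (by positivity))
    · exact max_lt (by linarith) (max_lt h1 h2)
    · rw [← div_le_iff₀ (by linarith)]
      exact le_max_of_le_right (le_max_left _ _)
    · rw [← div_le_iff₀ (by linarith)]
      exact le_max_of_le_right (le_max_right _ _)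
  -- With this `ε'` and `2 / g ≤ ε'` one gets `θ (1 + 2 / g) ≤ θ + ε' = 1 - 2 ε'`, as
  -- `Consts.Valid.exists_time_le` requires.
  have hε' : 0 < (1 - θ) / 3 := by linarith
  obtain ⟨g, hg⟩ := exists_nat_ge (2 / ((1 - θ) / 3))
  have hg0 : (0 : ℝ) < g := lt_of_lt_of_le (by positivity) hg
  have hg1 : 1 ≤ g := by exact_mod_cast hg0
  obtain ⟨k, hk⟩ := hS _ hε'
  obtain ⟨γ, b, Z, cap₁, L₁, hV⟩ := Consts.exists_valid k p q g hp hq hg1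
  obtain ⟨n₀, hn₀⟩ := Filter.eventually_atTop.1
    (hD.eventually_ge_atTop (2 * ((cap₁ : ℝ) + 2 * b + b * p + 5)))
  have hK := hV (n₀ + 2)
  set K : Consts := ⟨k, γ, b, p, q, Z, g + 2, n₀ + 2, cap₁, L₁⟩
  have hdim := hK.dim_le (D := D) fun n hn => by
    have hn' : n₀ + 2 ≤ n := hn
    have hlog : 0 < Real.log n := Real.log_pos (by exact_mod_cast (by omega : 1 < n))
    exact (le_div_iff₀ hlog).1 (hn₀ n (by omega))
  obtain ⟨Q, e, hQ⟩ := hK.exists_decidedBy hℓ hdim hpq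
    (T := fun n m => C * ((n : ℝ) * (m : ℝ)) ^ (1 - ε)) hP
  obtain ⟨C', hC'⟩ := hK.exists_time_le C e hθ0 hθ1.le hθε hθp hθq hε' (by
    have hgK : (K.h : ℝ) - 2 = g := by simp [K]
    rw [hgK]
    have h1 : 2 / (g : ℝ) ≤ (1 - θ) / 3 := by
      rw [div_le_iff₀ hg0]
      rwa [div_le_iff₀ hε', mul_comm] at hg
    have h2 : θ * (2 / (g : ℝ)) ≤ 1 * (2 / (g : ℝ)) := by gcongr
    linarith)
  refine hk ⟨Q, C', e, fun φ => ?_⟩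
  obtain ⟨s, t, hst, ht, hs⟩ := hQ φ
  exact ⟨s, t, hst, ht.trans (hC' _ _), hs⟩

end RAM

theorem mainTheorem8 (ℓ : ℝ → ℝ) (hℓ : ℓ = hingeLoss ∨ ℓ = logisticLoss) :
    -- Hardness: no algorithm runs in time `O((n m) ^ (1 - ε))` when `m = n ^ κ`.
    (SETH →
      ∀ D : ℕ → ℕ,
        Filter.Tendsto (fun n : ℕ => (D n : ℝ) / Real.log (n : ℝ)) Filter.atTop Filter.atTop →
      ∀ κ : ℚ, 0 < κ →
      ∀ ε : ℝ, 0 < ε →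
        ¬ ∃ (P : RAM.Program) (C : ℝ), ∀ I : GradInstance, I.IsBasic D → 1 ≤ I.n →
            (I.m : ℝ) = (I.n : ℝ) ^ (κ : ℝ) →
            I.GradientComputedBy ℓ P (C * ((I.n : ℝ) * (I.m : ℝ)) ^ (1 - ε))) ∧
    -- The gap in the sum of the gradient entries for the unit weights `-10 log n · b j`.
    deriv ℓ 0 ≠ 0 ∧
    ∀ (n m d : ℕ) (a : Fin m → Fin d → ℝ) (b : Fin n → Fin d → ℝ), 1 ≤ n → m ≤ n ^ 8 →
      (∀ i k, a i k = 0 ∨ a i k = 1) → (∀ j k, b j k = 0 ∨ b j k = 1) →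
      ∃ g : EuclideanSpace ℝ (Fin n),
        HasGradientAt
          (empiricalRisk ℓ a (fun _ => 1) (fun j k => -10 * Real.log (n : ℝ) * b j k)) g 0 ∧
        ((∃ i j, ∑ k, a i k * b j k = 0) → |deriv ℓ 0| / 2 ≤ |∑ j, g j|) ∧
        ((∀ i j, ∑ k, a i k * b j k ≠ 0) → |∑ j, g j| ≤ |deriv ℓ 0| / (n : ℝ)) := by
  obtain ⟨c, hc, hc1, -⟩ := exists_hasDerivAt_loss hℓ
  refine ⟨fun hS D hD κ hκ ε hε ⟨P, C, hP⟩ =>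
    RAM.not_gradientComputedBy_of_SETH hℓ hS hD hκ hε P C hP, ?_, ?_⟩
  · rw [hc.deriv]
    linarith
  · intro n m d a b hn hm ha hb
    rw [hc.deriv]
    exact sum_gradient_gap hc n m d a b hn hm ha hb
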